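/- **Setting.** Let $T\ge 1$ and let $\boldsymbol\xi=(\xi_0,\dots,\xi_T)$ be a stochastic process with values in a measurable space $\Xi$ whose law has finite support. Write $\boldsymbol\xi_{0:t}=(\xi_0,\dots,\xi_t)$, let $\boldsymbol\Xi_{0:t}$ be the support of $\boldsymbol\xi_{0:t}$, and for $\tau\le t$ let $\boldsymbol\Xi_{0:t}(\bar{\boldsymbol\xi}_{0:\tau})$ be the set of elements of $\boldsymbol\Xi_{0:t}$ that begin with $\bar{\boldsymbol\xi}_{0:\tau}$. Consider, for $w=[x;u]\in\mathbb R^{n_x}\times\mathbb R^{n_u}$, $$f(w;\xi)=A(\xi)x+B(\xi)u+d(\xi),\qquad \ell(w;\xi)=\tfrac12\left(x^\top Q(\xi)x+u^\top R(\xi)u\right)-q(\xi)^\top x-r(\xi)^\top u,$$ and $p(\xi)=[q(\xi);r(\xi);d(\xi)]$. Norms are Euclidean norms of vectors and the induced norms of matrices. Fix $\bar\xi_0$ in the support of $\xi_0$; "a.s." refers to the conditional law given $\xi_0=\bar\xi_0$. **Assumptions.** Let $L\ge 1$, $\alpha\in(0,1)$, $\gamma\in(0,1]$ be such that: (a) for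 $0\le t\le T$, the matrices $A(\xi_t),B(\xi_t),Q(\xi_t),R(\xi_t)$ have norm at most $L$ a.s.; (b) for $0\le t\le T$, $Q(\xi_t)\succeq 0$ and $R(\xi_t)\succeq\gamma I$ a.s.; (c) (stabilizability) there are $K_t(\boldsymbol\xi_{0:t})$, $0\le t\le T-1$, with $\|K_t\|\le L$ a.s., such that $\Phi_t=A(\xi_t)-B(\xi_t)K_{t-1}(\boldsymbol\xi_{0:t-1})$, $1\le t\le T$, satisfy $\|\Phi_{t''}\cdots\Phi_{t'+1}\|\le L\alpha^{t''-t'}$ a.s. for all $0\le t'<t''\le T$; (d) (detectability) there are $K_t(\boldsymbol\xi_{0:t})$, $1\le t\le T$, with $\|K_t\|\le L$ a.s., such that $\Phi_t=A(\xi_t)-K_t(\boldsymbol\xi_{0:t})Q(\xi_{t-1})^{1/2}$, $1\le t\le T$, satisfy the same bound. **SPC policy.** For an integer $W\ge 0$, a time $0\le\tau\le T$, an observed history $\bar{\boldsymbol\xi}_{0:\tau}\in\boldsymbol\Xi_{0:\tau}(\bar\xi_0)$ and a previous pair $\bar w_{\tau-1}\in\mathbb R^{n_x}\times\mathbb R^{n_u}$,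 the truncated problem minimizes $$\mathbb E\Big[\sum_{t=\tau}^{\min(\tau+W,T)}\ell(w_t(\boldsymbol\xi_{0:t});\xi_t)\,\Big|\,\boldsymbol\xi_{0:\tau}=\bar{\boldsymbol\xi}_{0:\tau}\Big]$$ over functions $w_t=[x_t;u_t]$ on $\boldsymbol\Xi_{0:t}(\bar{\boldsymbol\xi}_{0:\tau})$, $\tau\le t\le\min(\tau+W,T)$, subject to $x_\tau(\bar{\boldsymbol\xi}_{0:\tau})=f(\bar w_{\tau-1};\bar\xi_\tau)$ and $x_t(\bar{\boldsymbol\xi}_{0:t})=f(w_{t-1}(\bar{\boldsymbol\xi}_{0:t-1});\bar\xi_t)$ for $\tau<t\le\min(\tau+W,T)$ and $\bar{\boldsymbol\xi}_{0:t}\in\boldsymbol\Xi_{0:t}(\bar{\boldsymbol\xi}_{0:\tau})$. Denote its solution by $w^{(\tau,W)}_t(\cdot\,;\bar w_{\tau-1})$. The SPC policy is defined recursively by $w^{(W)}_{-1}=\bar w_{-1}$ and $$w^{(W)}_t(\boldsymbol\xi_{0:t};\bar w_{-1})=w^{(t,W)}_t\big(\boldsymbol\xi_{0:t};\,w^{(W)}_{t-1}(\boldsymbol\xi_{0:t-1};\bar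 w_{-1})\big),\qquad 0\le t\le T.$$ **Constants.** Put $L_H=2L+1$, $\gamma_F=\frac{(1-\alpha)^2}{(1+L)^2L^2}$, $\gamma_G=\frac{\gamma(1-\alpha)^2}{2(1+L)^2L^4}$, $\bar\mu=\frac{2L_H^2/\gamma_G+\gamma_G+L_H}{\gamma_F}$, $$\gamma_H=\left(\frac2{\gamma_G}+\Big(1+\frac{4L_H}{\gamma_G}+\frac{4L_H^2}{\gamma_G^2}\Big)\frac{L_H(1+\bar\mu L_H)}{\gamma_F}+\bar\mu\right)^{-1},\qquad \rho=\left(\frac{L_H^2-\gamma_H^2}{L_H^2+\gamma_H^2}\right)^{1/2},\qquad c_1=\frac{L_H}{\gamma_H^2\rho},$$ $$\overline W=\frac{\log\big((\alpha^{1/2}-\alpha)/(4c_1^2L^3)\big)}{2\log\rho},\qquad c_2=\frac{2c_1^2L}{\rho(1-\rho^{3/2})}.$$ **Theorem (Perturbation Bound, Closed-Loop).** Under these assumptions, let $W\ge\overline W$ be an integer. Then each of the truncated problems above has a unique solution, so that the SPC policy is well defined, and for all $\bar w_{-1}\in\mathbb R^{n_x}\times\mathbb R^{n_u}$ and $0\le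 t\le T$, $$\Big\{\mathbb E\big[\|w^{(W)}_t(\boldsymbol\xi_{0:t};\bar w_{-1})\|^2\,\big|\,\xi_0=\bar\xi_0\big]\Big\}^{1/2}\le c_2\Big(2L\rho^{t/2}\|\bar w_{-1}\|+\sum_{t'=0}^T\rho^{|t-t'|/2}\big\{\mathbb E[\|p(\xi_{t'})\|^2\mid\xi_0=\bar\xi_0]\big\}^{1/2}\Big).$$ In particular the SPC policy is exponentially input-to-state stable in expectation with rate $\rho^{1/2}$: if $\{\mathbb E[\|p(\xi_{t'})\|^2\mid\xi_0=\bar\xi_0]\}^{1/2}\le D$ for all $0\le t'\le T$, then for all $0\le t\le T$ the left-hand side is at most $c_2\big(2L\rho^{t/2}\|\bar w_{-1}\|+\frac{2}{1-\rho^{1/2}}D\big)$. -/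

import Mathlib

open MeasureTheory ProbabilityTheory
open scoped Matrix.Norms.L2Operator MatrixOrder

noncomputable section

namespace SPC

/-- Pairs `w = [x; u]` of a state and a control, with the Euclidean norm of the stacked vector. -/
abbrev StateControl (nx nu : ℕ) : Type :=
  WithLp 2 (EuclideanSpace ℝ (Fin nx) × EuclideanSpace ℝ (Fin nu))

/-- Data of the linear system `x_t = A(ξ_t) x_{t-1} + B(ξ_t) u_{t-1} + d(ξ_t)` and of the quadratic
performance index, as functions of the uncertainty. -/
structure Model (Ξ : Type*) (nx nu : ℕ) where
  A : Ξ → Matrix (Fin nx) (Fin nx) ℝ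
  B : Ξ → Matrix (Fin nx) (Fin nu) ℝ
  d : Ξ → EuclideanSpace ℝ (Fin nx)
  Q : Ξ → Matrix (Fin nx) (Fin nx) ℝ
  R : Ξ → Matrix (Fin nu) (Fin nu) ℝ
  q : Ξ → EuclideanSpace ℝ (Fin nx)
  r : Ξ → EuclideanSpace ℝ (Fin nu)

section Dynamics

variable {Ξ : Type*} {nx nu : ℕ}

/-- `f(w; ξ) = A(ξ) x + B(ξ) u + d(ξ)` for `w = [x; u]`. -/
def Model.f (M : Model Ξ nx nu) (w : StateControl nx nu) (s : Ξ) : EuclideanSpace ℝ (Fin nx) :=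
  Matrix.toEuclideanLin (M.A s) w.fst + Matrix.toEuclideanLin (M.B s) w.snd + M.d s

/-- `ℓ(w; ξ) = ½ (xᵀ Q(ξ) x + uᵀ R(ξ) u) - (q(ξ)ᵀ x + r(ξ)ᵀ u)` for `w = [x; u]`. -/
def Model.cost (M : Model Ξ nx nu) (w : StateControl nx nu) (s : Ξ) : ℝ :=
  1 / 2 * (inner ℝ w.fst (Matrix.toEuclideanLin (M.Q s) w.fst)
      + inner ℝ w.snd (Matrix.toEuclideanLin (M.R s) w.snd))
    - (inner ℝ (M.q s) w.fst + inner ℝ (M.r s) w.snd)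

/-- The stacked vector `p(ξ) = [q(ξ); r(ξ); d(ξ)]`, with its Euclidean norm. -/
def Model.p (M : Model Ξ nx nu) (s : Ξ) :
    WithLp 2 (EuclideanSpace ℝ (Fin nx) ×
      WithLp 2 (EuclideanSpace ℝ (Fin nu) × EuclideanSpace ℝ (Fin nx))) :=
  WithLp.toLp 2 (M.q s, WithLp.toLp 2 (M.r s, M.d s))

end Dynamics

section Histories

variable {Ω Ξ : Type*} [MeasurableSpace Ω]

/-- The history `ξ_{0:t} = (ξ_0, …, ξ_t)`. -/
def hist (ξ : ℕ → Ω → Ξ) (t : ℕ) (ω : Ω) : Fin (t + 1) → Ξ := fun i => ξ i ω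

/-- The law of `ξ_{0:T}` is carried by a finite set. -/
def FiniteSupport (P : Measure Ω) (ξ : ℕ → Ω → Ξ) (T : ℕ) : Prop :=
  ∃ S : Set (Fin (T + 1) → Ξ), S.Finite ∧ ∀ᵐ ω ∂P, hist ξ T ω ∈ S

/-- The support of `ξ_{0:t}`. The law being finitely supported, it is the set of atoms. -/
def histSupport (P : Measure Ω) (ξ : ℕ → Ω → Ξ) (t : ℕ) : Set (Fin (t + 1) → Ξ) :=
  {h | P {ω | hist ξ t ω = h} ≠ 0}

/-- For `τ ≤ t`, the set of those `h'` in the support of `ξ_{0:t}` whose first `τ + 1` entries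
are `h`. -/
def histSupportFrom (P : Measure Ω) (ξ : ℕ → Ω → Ξ) {τ : ℕ} (h : Fin (τ + 1) → Ξ) (t : ℕ) :
    Set (Fin (t + 1) → Ξ) :=
  {h' | h' ∈ histSupport P ξ t ∧
    ∀ (i : Fin (τ + 1)) (j : Fin (t + 1)), (i : ℕ) = (j : ℕ) → h' j = h i}

/-- The probability measure `P` conditioned on the event `ξ_{0:τ} = h`. -/
def condHist (P : Measure Ω) (ξ : ℕ → Ω → Ξ) {τ : ℕ} (h : Fin (τ + 1) → Ξ) : Measure Ω :=
  ProbabilityTheory.cond P {ω | hist ξ τ ω = h}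

/-- The root history `(ξ̄_0)` of length one. -/
def root (s₀ : Ξ) : Fin (0 + 1) → Ξ := fun _ => s₀

/-- The square root `{E[‖g‖²]}^{1/2}` of the second moment of `g`. -/
def rms {F : Type*} [NormedAddCommGroup F] (ν : Measure Ω) (g : Ω → F) : ℝ :=
  Real.sqrt (∫ ω, ‖g ω‖ ^ 2 ∂ν)

end Histories

section StochasticStability

variable {Ω Ξ : Type*} [MeasurableSpace Ω] {nx nu ny : ℕ}

/-- The product `Φ_{s+n} ⋯ Φ_{s+2} Φ_{s+1}`. -/
def transition (Φ : ℕ → Matrix (Fin nx) (Fin nx) ℝ) (s : ℕ) : ℕ → Matrix (Fin nx) (Fin nx) ℝ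
  | 0 => 1
  | n + 1 => Φ (s + n + 1) * transition Φ s n

/-- `(L, α)`-stability of the random matrices `Φ_1, …, Φ_T` under the measure `ν`. -/
def IsStable (ν : Measure Ω) (T : ℕ) (L α : ℝ)
    (Φ : ℕ → Ω → Matrix (Fin nx) (Fin nx) ℝ) : Prop :=
  ∀ s n : ℕ, 0 < n → s + n ≤ T →
    ∀ᵐ ω ∂ν, ‖transition (fun t => Φ t ω) s n‖ ≤ L * α ^ n

/-- `(L, α)`-stabilizability of `({A(ξ_t)}_{1 ≤ t ≤ T}, {B(ξ_t)}_{1 ≤ t ≤ T})` under `ν`: the feedback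
gain `K_t`, `0 ≤ t ≤ T - 1`, is a function of the history `ξ_{0:t}` only. -/
def IsStabilizable (ν : Measure Ω) (ξ : ℕ → Ω → Ξ) (T : ℕ) (L α : ℝ)
    (A : Ξ → Matrix (Fin nx) (Fin nx) ℝ) (B : Ξ → Matrix (Fin nx) (Fin nu) ℝ) : Prop :=
  ∃ K : (t : ℕ) → (Fin (t + 1) → Ξ) → Matrix (Fin nu) (Fin nx) ℝ,
    (∀ t < T, ∀ᵐ ω ∂ν, ‖K t (hist ξ t ω)‖ ≤ L) ∧
    IsStable ν T L α fun t ω => A (ξ t ω) - B (ξ t ω) * K (t - 1) (hist ξ (t - 1) ω)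

/-- `(L, α)`-detectability of `({A(ξ_t)}_{1 ≤ t ≤ T}, {C(ξ_t)}_{0 ≤ t ≤ T - 1})` under `ν`: the observer
gain `K_t`, `1 ≤ t ≤ T`, is a function of the history `ξ_{0:t}` only. -/
def IsDetectable (ν : Measure Ω) (ξ : ℕ → Ω → Ξ) (T : ℕ) (L α : ℝ)
    (A : Ξ → Matrix (Fin nx) (Fin nx) ℝ) (C : Ξ → Matrix (Fin ny) (Fin nx) ℝ) : Prop :=
  ∃ K : (t : ℕ) → (Fin (t + 1) → Ξ) → Matrix (Fin nx) (Fin ny) ℝ,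
    (∀ t, 1 ≤ t → t ≤ T → ∀ᵐ ω ∂ν, ‖K t (hist ξ t ω)‖ ≤ L) ∧
    IsStable ν T L α fun t ω => A (ξ t ω) - K t (hist ξ t ω) * C (ξ (t - 1) ω)

/-- Boundedness, convexity, stabilizability and detectability with constants `L`, `α`, `γ`, almost
surely under `ν`. Here `Q ⪰ 0` and `R ⪰ γ I` include the symmetry of `Q` and `R`, and
`CFC.sqrt Q` is the positive semidefinite square root `Q^{1/2}`. -/
structure Regular (M : Model Ξ nx nu) (ν : Measure Ω) (ξ : ℕ → Ω → Ξ) (T : ℕ)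
    (L α γ : ℝ) : Prop where
  one_le_L : 1 ≤ L
  α_pos : 0 < α
  α_lt_one : α < 1
  γ_pos : 0 < γ
  γ_le_one : γ ≤ 1
  A_bdd : ∀ t ≤ T, ∀ᵐ ω ∂ν, ‖M.A (ξ t ω)‖ ≤ L
  B_bdd : ∀ t ≤ T, ∀ᵐ ω ∂ν, ‖M.B (ξ t ω)‖ ≤ L
  Q_bdd : ∀ t ≤ T, ∀ᵐ ω ∂ν, ‖M.Q (ξ t ω)‖ ≤ L
  R_bdd : ∀ t ≤ T, ∀ᵐ ω ∂ν, ‖M.R (ξ t ω)‖ ≤ L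
  Q_psd : ∀ t ≤ T, ∀ᵐ ω ∂ν, (M.Q (ξ t ω)).PosSemidef
  R_pd : ∀ t ≤ T, ∀ᵐ ω ∂ν,
    (M.R (ξ t ω) - γ • (1 : Matrix (Fin nu) (Fin nu) ℝ)).PosSemidef
  stabilizable : IsStabilizable ν ξ T L α M.A M.B
  detectable : IsDetectable ν ξ T L α M.A fun s => CFC.sqrt (M.Q s)

end StochasticStability

section Policy

variable {Ω Ξ : Type*} [MeasurableSpace Ω] {nx nu : ℕ}

/-- Decision processes: `w_t` is a function of the history `ξ_{0:t}`. -/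
abbrev Decisions (Ξ : Type*) (nx nu : ℕ) : Type _ :=
  (t : ℕ) → (Fin (t + 1) → Ξ) → StateControl nx nu

/-- Constraints of the truncated problem at time `τ` with prediction horizon `W`, observed history
`h = ξ̄_{0:τ}` and previous state and control `w'`. The stages are `τ ≤ t ≤ min (τ + W) T`. -/
def Feasible (M : Model Ξ nx nu) (P : Measure Ω) (ξ : ℕ → Ω → Ξ) (T W τ : ℕ)
    (h : Fin (τ + 1) → Ξ) (w' : StateControl nx nu) (w : Decisions Ξ nx nu) : Prop :=
  (w τ h).fst = M.f w' (h (Fin.last τ)) ∧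
  ∀ t, τ ≤ t → t + 1 ≤ min (τ + W) T → ∀ h' ∈ histSupportFrom P ξ h (t + 1),
    (w (t + 1) h').fst = M.f (w t (Fin.init h')) (h' (Fin.last (t + 1)))

/-- Objective of the truncated problem: the conditional expectation given `ξ_{0:τ} = h` of the
performance index over the stages `τ ≤ t ≤ min (τ + W) T`. -/
def objective (M : Model Ξ nx nu) (P : Measure Ω) (ξ : ℕ → Ω → Ξ) (T W τ : ℕ)
    (h : Fin (τ + 1) → Ξ) (w : Decisions Ξ nx nu) : ℝ :=
  ∫ ω, ∑ t ∈ Finset.Icc τ (min (τ + W) T), M.cost (w t (hist ξ t ω)) (ξ t ω) ∂(condHist P ξ h)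

/-- `w` solves the truncated problem. -/
def IsSolution (M : Model Ξ nx nu) (P : Measure Ω) (ξ : ℕ → Ω → Ξ) (T W τ : ℕ)
    (h : Fin (τ + 1) → Ξ) (w' : StateControl nx nu) (w : Decisions Ξ nx nu) : Prop :=
  Feasible M P ξ T W τ h w' w ∧
  ∀ v, Feasible M P ξ T W τ h w' v → objective M P ξ T W τ h w ≤ objective M P ξ T W τ h v

/-- The truncated problem has a solution, and any two solutions agree at each stage of the horizon
on each history of positive probability that extends `h`. -/
def HasUniqueSolution (M : Model Ξ nx nu) (P : Measure Ω) (ξ : ℕ → Ω → Ξ) (T W τ : ℕ)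
    (h : Fin (τ + 1) → Ξ) (w' : StateControl nx nu) : Prop :=
  ∃ w, IsSolution M P ξ T W τ h w' w ∧
    ∀ v, IsSolution M P ξ T W τ h w' v →
      ∀ t, τ ≤ t → t ≤ min (τ + W) T → ∀ h' ∈ histSupportFrom P ξ h t, v t h' = w t h'

/-- The solution of the truncated problem (an arbitrary process where there is none). -/
def openLoop (M : Model Ξ nx nu) (P : Measure Ω) (ξ : ℕ → Ω → Ξ) (T W τ : ℕ)
    (h : Fin (τ + 1) → Ξ) (w' : StateControl nx nu) : Decisions Ξ nx nu :=
  Classical.epsilon (IsSolution M P ξ T W τ h w')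

/-- The closed-loop SPC policy `w^{(W)}_t(ξ_{0:t}; w̄_{-1})`: at each time only the first decision
of the truncated problem is implemented. -/
def policy (M : Model Ξ nx nu) (P : Measure Ω) (ξ : ℕ → Ω → Ξ) (T W : ℕ)
    (w₀ : StateControl nx nu) : Decisions Ξ nx nu
  | 0, h => openLoop M P ξ T W 0 h w₀ 0 h
  | t + 1, h =>
      openLoop M P ξ T W (t + 1) h (policy M P ξ T W w₀ t (Fin.init h)) (t + 1) h

end Policy

section Constants

def LH (L : ℝ) : ℝ := 2 * L + 1

def gammaF (L α : ℝ) : ℝ := (1 - α) ^ 2 / ((1 + L) ^ 2 * L ^ 2)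

def gammaG (L α γ : ℝ) : ℝ := γ * (1 - α) ^ 2 / (2 * (1 + L) ^ 2 * L ^ 4)

def muBar (L α γ : ℝ) : ℝ :=
  (2 * LH L ^ 2 / gammaG L α γ + gammaG L α γ + LH L) / gammaF L α

def gammaH (L α γ : ℝ) : ℝ :=
  (2 / gammaG L α γ
    + (1 + 4 * LH L / gammaG L α γ + 4 * LH L ^ 2 / gammaG L α γ ^ 2)
        * (LH L * (1 + muBar L α γ * LH L) / gammaF L α)
    + muBar L α γ)⁻¹

def rho (L α γ : ℝ) : ℝ :=
  Real.sqrt ((LH L ^ 2 - gammaH L α γ ^ 2) / (LH L ^ 2 + gammaH L α γ ^ 2))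

def c₁ (L α γ : ℝ) : ℝ := LH L / (gammaH L α γ ^ 2 * rho L α γ)

def c₂ (L α γ : ℝ) : ℝ :=
  2 * c₁ L α γ ^ 2 * L / (rho L α γ * (1 - rho L α γ ^ (3 / 2 : ℝ)))

/-- The threshold `W̄` on the prediction horizon. -/
def WBar (L α γ : ℝ) : ℝ :=
  Real.log ((α ^ (1 / 2 : ℝ) - α) / (4 * c₁ L α γ ^ 2 * L ^ 3)) / (2 * Real.log (rho L α γ))

end Constants

end SPC

end

/-! The conditional law of `ξ_{0:T}` given the root has finitely many atoms. Random vectors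
therefore form a finite-dimensional Euclidean space whose norm is the root mean square, and the
functions of `ξ_{0:t}` form a subspace of it. Multiplication by random matrices turns the stochastic
problem into a deterministic linear-quadratic chain in this space (`Chain`). Non-anticipativity
becomes the requirement that stage `t` unknowns and test vectors lie in the stage `t` subspaces, and
almost sure bounds on matrix products become operator bounds with the same constants.

The core is an a priori estimate for the first-order optimality system, uniform in the horizon
(`Chain.Good.sum_stageSq_le`). Testing the system with its own solution bounds the outputs `C x` and
the controls by the residuals; detectability recovers the states, and stabilizability, dually, the
costates. With zero residual this is uniqueness, hence existence in finite dimension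
(`Chain.Good.exists_exact`). Applied to a solution multiplied by `r ^ |t - s|` with `r` close to
`1`, it gives exponential decay of sensitivity (`Chain.Good.sqrt_stageSq_le`).

For the closed loop (`Chain.Good.closed_loop_le`), the first stages of the successive window
problems, together with their first costates, solve the full-horizon optimality system up to a jump:
the costate at `t + 1` seen from window `t` differs from the one computed by window `t + 1`. The
jump stems from the costate that window `t` sets to zero past its end. Its effect decays over the
window back to `t + 1`, and that end costate itself decays over the window away from the current
state, so the jump is of order `ρ ^ (2 * W - 1)` times the current stage, plus data. For `W ≥ WBar`
the first part is absorbed. The data part is convolved with the decay kernel once more, which costs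
half of the rate and leads to `ρ ^ (1 / 2)`.

What remains is to compare the constants, via `gain ^ 2 ≤ γ_H⁻¹`, and to check that the solution of
the joint optimality system of all scenarios restricts to the unique minimizer on each branch of the
scenario tree (`Scenarios.isSolution`). -/

noncomputable section

namespace SPC

/-! ### Discounted sums in `ℓ²` -/

section Discounted

variable {α : ℝ} {g y : ℕ → ℝ} {lo hi : ℕ}

/-- Convexity of the square, applied to `α * a + (1 - α) * (b / (1 - α))`. -/
theorem sq_discount_le (hα : α ∈ Set.Ioo (0 : ℝ) 1) (a b : ℝ) :
    (α * a + b) ^ 2 ≤ α * a ^ 2 + b ^ 2 / (1 - α) := by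
  obtain ⟨h0, h1⟩ := hα
  have h2 : 0 < 1 - α := by linarith
  have key : α * a ^ 2 + b ^ 2 / (1 - α) - (α * a + b) ^ 2
      = α * ((1 - α) * a - b) ^ 2 / (1 - α) := by
    field_simp
    ring
  have : 0 ≤ α * ((1 - α) * a - b) ^ 2 / (1 - α) := by positivity
  linarith

/-- An `ℓ²` bound for convolution with the kernel `α ^ n`. The induction carries the extra term `α *
y hi ^ 2`, which pays for the next use of `sq_discount_le`. -/
theorem sum_sq_forward (hα : α ∈ Set.Ioo (0 : ℝ) 1) (hle : lo ≤ hi) (h0 : y lo = g lo)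
    (hs : ∀ t, lo ≤ t → y (t + 1) = α * y t + g (t + 1)) :
    (1 - α) ^ 2 * ∑ t ∈ Finset.Icc lo hi, y t ^ 2 ≤ ∑ t ∈ Finset.Icc lo hi, g t ^ 2 := by
  have h1 : 0 < 1 - α := by linarith [hα.2]
  have key : (1 - α) * ∑ t ∈ Finset.Icc lo hi, y t ^ 2 + α * y hi ^ 2
      ≤ (∑ t ∈ Finset.Icc lo hi, g t ^ 2) / (1 - α) := by
    induction hi, hle using Nat.le_induction with
    | base =>
      have := sq_discount_le hα 0 (g lo)
      simp only [Finset.Icc_self, Finset.sum_singleton, h0]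
      calc (1 - α) * g lo ^ 2 + α * g lo ^ 2 = (α * 0 + g lo) ^ 2 := by ring
        _ ≤ _ := by simpa using this
    | succ m hm ih =>
      rw [Finset.sum_Icc_succ_top (by omega), Finset.sum_Icc_succ_top (by omega)]
      have := sq_discount_le hα (y m) (g (m + 1))
      rw [← hs m hm] at this
      rw [add_div]
      linarith
  have hα0 := hα.1.le
  rw [le_div_iff₀ h1] at key
  nlinarith [sq_nonneg (y hi), mul_nonneg (mul_nonneg hα0 (sq_nonneg (y hi))) h1.le]

theorem sum_sq_backward (hα : α ∈ Set.Ioo (0 : ℝ) 1) (hle : lo ≤ hi) (h0 : y hi = g hi)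
    (hs : ∀ t, lo ≤ t → t < hi → y t = α * y (t + 1) + g t) :
    (1 - α) ^ 2 * ∑ t ∈ Finset.Icc lo hi, y t ^ 2 ≤ ∑ t ∈ Finset.Icc lo hi, g t ^ 2 := by
  have h1 : 0 < 1 - α := by linarith [hα.2]
  have key : ∀ m, m ≤ hi → lo ≤ m → (1 - α) * ∑ t ∈ Finset.Icc m hi, y t ^ 2 + α * y m ^ 2
      ≤ (∑ t ∈ Finset.Icc m hi, g t ^ 2) / (1 - α) := by
    intro m hm
    induction hm using Nat.decreasingInduction with
    | self =>
      intro _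
      have := sq_discount_le hα 0 (g hi)
      simp only [Finset.Icc_self, Finset.sum_singleton, h0]
      calc (1 - α) * g hi ^ 2 + α * g hi ^ 2 = (α * 0 + g hi) ^ 2 := by ring
        _ ≤ _ := by simpa using this
    | of_succ m hm ih =>
      intro hlo
      rw [← Finset.add_sum_Ioc_eq_sum_Icc hm.le, ← Finset.add_sum_Ioc_eq_sum_Icc hm.le]
      have e : Finset.Ioc m hi = Finset.Icc (m + 1) hi := by
        ext; simp
      rw [e]
      have := sq_discount_le hα (y (m + 1)) (g m)
      rw [← hs m hlo hm] at this
      rw [add_div]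
      linarith [ih (by omega)]
  have hα0 := hα.1.le
  have key := key lo hle le_rfl
  rw [le_div_iff₀ h1] at key
  nlinarith [sq_nonneg (y lo), mul_nonneg (mul_nonneg hα0 (sq_nonneg (y lo))) h1.le]

theorem sum_prev_le {F : ℕ → ℝ} (hle : lo ≤ hi) (hF : ∀ t, 0 ≤ F t) :
    ∑ t ∈ Finset.Icc lo hi, (if t ≤ lo then 0 else F (t - 1)) ≤ ∑ t ∈ Finset.Icc lo hi, F t := by
  have key : ∑ t ∈ Finset.Icc lo hi, (if t ≤ lo then 0 else F (t - 1)) + F hi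
      = ∑ t ∈ Finset.Icc lo hi, F t := by
    induction hi, hle using Nat.le_induction with
    | base => simp
    | succ m hm ih =>
      rw [Finset.sum_Icc_succ_top (by omega), Finset.sum_Icc_succ_top (by omega),
        if_neg (by omega), Nat.add_sub_cancel, ih]
  linarith [hF hi]

theorem sum_next_le {F : ℕ → ℝ} (hle : lo ≤ hi) (hF : ∀ t, 0 ≤ F t) (h0 : F (hi + 1) = 0) :
    ∑ t ∈ Finset.Icc lo hi, F (t + 1) ≤ ∑ t ∈ Finset.Icc lo hi, F t := by
  have key : F lo + ∑ t ∈ Finset.Icc lo hi, F (t + 1)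
      = ∑ t ∈ Finset.Icc lo hi, F t + F (hi + 1) := by
    clear h0
    induction hi, hle using Nat.le_induction with
    | base => simp
    | succ m hm ih =>
      rw [Finset.sum_Icc_succ_top (by omega), Finset.sum_Icc_succ_top (by omega), ← add_assoc, ih]
  linarith [hF lo]

theorem exists_forward (α : ℝ) (g : ℕ → ℝ) (lo : ℕ) :
    ∃ y : ℕ → ℝ, y lo = g lo ∧ ∀ t, lo ≤ t → y (t + 1) = α * y t + g (t + 1) := by
  let z : ℕ → ℝ := fun k => Nat.rec (g lo) (fun k v => α * v + g (lo + k + 1)) k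
  refine ⟨fun t => z (t - lo), by simp [z], fun t ht => ?_⟩
  obtain ⟨k, rfl⟩ := Nat.exists_eq_add_of_le ht
  have e1 : lo + k + 1 - lo = k + 1 := by omega
  have e2 : lo + k - lo = k := by omega
  simp only [e1, e2]
  rfl

theorem exists_backward (α : ℝ) (g : ℕ → ℝ) (hi : ℕ) :
    ∃ y : ℕ → ℝ, y hi = g hi ∧ ∀ t, t < hi → y t = α * y (t + 1) + g t := by
  let z : ℕ → ℝ := fun k => Nat.rec (g hi) (fun k v => α * v + g (hi - (k + 1))) k
  refine ⟨fun t => z (hi - t), by simp [z], fun t ht => ?_⟩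
  obtain ⟨k, rfl⟩ := Nat.exists_eq_add_of_lt ht
  have e1 : t + k + 1 - t = k + 1 := by omega
  have e2 : t + k + 1 - (t + 1) = k := by omega
  have e3 : g t = g (t + k + 1 - (k + 1)) := by congr 1; omega
  simp only [e1, e2]
  rw [e3]

end Discounted

/-! ### Linear-quadratic control along a filtration of a Hilbert space -/

/-- The product `Φ_{s+n} ∘ ⋯ ∘ Φ_{s+1}`. -/
def flow {E : Type*} [AddCommGroup E] [Module ℝ E] (Φ : ℕ → E →ₗ[ℝ] E) (s : ℕ) : ℕ → E →ₗ[ℝ] E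
  | 0 => LinearMap.id
  | n + 1 => Φ (s + n + 1) ∘ₗ flow Φ s n

/-- By definition `flow` splits off its last factor; the state estimate needs to split off the first
one. -/
theorem flow_succ_apply {E : Type*} [AddCommGroup E] [Module ℝ E] (Φ : ℕ → E →ₗ[ℝ] E) (s n : ℕ)
    (x : E) : flow Φ s (n + 1) x = flow Φ (s + 1) n (Φ (s + 1) x) := by
  induction n with
  | zero => rfl
  | succ n ih =>
    have e : s + 1 + n + 1 = s + (n + 1) + 1 := by omega
    change Φ (s + (n + 1) + 1) (flow Φ s (n + 1) x)
      = Φ (s + 1 + n + 1) (flow Φ (s + 1) n (Φ (s + 1) x))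
    rw [ih, e]

/-- The squared norm of the state, the control and the costate at stage `t`. -/
def stageSq {E F : Type*} [NormedAddCommGroup E] [NormedAddCommGroup F]
    (x : ℕ → E) (u : ℕ → F) (l : ℕ → E) (t : ℕ) : ℝ := ‖x t‖ ^ 2 + ‖u t‖ ^ 2 + ‖l t‖ ^ 2

theorem stageSq_nonneg {E F : Type*} [NormedAddCommGroup E] [NormedAddCommGroup F]
    (x : ℕ → E) (u : ℕ → F) (l : ℕ → E) (t : ℕ) : 0 ≤ stageSq x u l t := by
  unfold stageSq; positivity

/-- Data of a linear-quadratic problem with states `x_t ∈ V t`, controls `u_t ∈ Y t`, dynamics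
`x_{t+1} = A_{t+1} x_t + B_{t+1} u_t + d_{t+1}` and stage cost
`½ (‖C_t x_t‖² + ⟪R_t u_t, u_t⟫) - ⟪q_t, x_t⟫ - ⟪r_t, u_t⟫`. -/
structure Chain (E F : Type*) [NormedAddCommGroup E] [InnerProductSpace ℝ E]
    [NormedAddCommGroup F] [InnerProductSpace ℝ F] where
  V : ℕ → Submodule ℝ E
  Y : ℕ → Submodule ℝ F
  A : ℕ → E →ₗ[ℝ] E
  B : ℕ → F →ₗ[ℝ] E
  C : ℕ → E →ₗ[ℝ] E
  R : ℕ → F →ₗ[ℝ] F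

namespace Chain

variable {E F : Type*} [NormedAddCommGroup E] [InnerProductSpace ℝ E]
    [NormedAddCommGroup F] [InnerProductSpace ℝ F]

/-- Boundedness, convexity, stabilizability and detectability of a chain up to time `T`. -/
structure Good (c : Chain E F) (T : ℕ) (L α γ : ℝ) : Prop where
  one_le_L : 1 ≤ L
  α_pos : 0 < α
  α_lt_one : α < 1
  γ_pos : 0 < γ
  γ_le_one : γ ≤ 1
  A_map : ∀ t < T, ∀ x ∈ c.V t, c.A (t + 1) x ∈ c.V (t + 1)
  B_map : ∀ t < T, ∀ u ∈ c.Y t, c.B (t + 1) u ∈ c.V (t + 1)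
  A_bdd : ∀ t ≤ T, ∀ x, ‖c.A t x‖ ≤ L * ‖x‖
  B_bdd : ∀ t ≤ T, ∀ x, ‖c.B t x‖ ≤ L * ‖x‖
  C_bdd : ∀ t ≤ T, ∀ x, ‖c.C t x‖ ≤ L * ‖x‖
  R_bdd : ∀ t ≤ T, ∀ x, ‖c.R t x‖ ≤ L * ‖x‖
  R_coercive : ∀ t ≤ T, ∀ u, γ * ‖u‖ ^ 2 ≤ inner ℝ (c.R t u) u
  stabilizable : ∃ K : ℕ → E →ₗ[ℝ] F,
    (∀ t < T, ∀ x ∈ c.V t, K t x ∈ c.Y t) ∧ (∀ t < T, ∀ x, ‖K t x‖ ≤ L * ‖x‖) ∧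
    ∀ s n, s + n ≤ T → ∀ x,
      ‖flow (fun t => c.A t - c.B t ∘ₗ K (t - 1)) s n x‖ ≤ L * α ^ n * ‖x‖
  detectable : ∃ J : ℕ → E →ₗ[ℝ] E,
    (∀ t, 1 ≤ t → t ≤ T → ∀ x, ‖J t x‖ ≤ L * ‖x‖) ∧
    ∀ s n, s + n ≤ T → ∀ x,
      ‖flow (fun t => c.A t - J t ∘ₗ c.C (t - 1)) s n x‖ ≤ L * α ^ n * ‖x‖

/-- States `x`, controls `u` and costates `l` on the stages `lo ≤ t ≤ hi` which solve the
first-order optimality system up to an error `e t` at stage `t`. -/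
structure Approx (c : Chain E F) (lo hi : ℕ) (x : ℕ → E) (u : ℕ → F) (l : ℕ → E)
    (e : ℕ → ℝ) : Prop where
  nonneg : ∀ t, 0 ≤ e t
  x_mem : ∀ t, lo ≤ t → t ≤ hi → x t ∈ c.V t
  u_mem : ∀ t, lo ≤ t → t ≤ hi → u t ∈ c.Y t
  l_mem : ∀ t, lo ≤ t → t ≤ hi → l t ∈ c.V t
  l_end : l (hi + 1) = 0
  init : ‖x lo‖ ≤ e lo
  dyn : ∀ t, lo ≤ t → t < hi → ‖x (t + 1) - (c.A (t + 1) (x t) + c.B (t + 1) (u t))‖ ≤ e (t + 1)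
  adj : ∀ t, lo ≤ t → t ≤ hi → ∀ δ ∈ c.V t,
    |inner ℝ (c.C t (x t)) (c.C t δ) + inner ℝ (l t) δ - inner ℝ (l (t + 1)) (c.A (t + 1) δ)|
      ≤ e t * ‖δ‖
  opt : ∀ t, lo ≤ t → t ≤ hi → ∀ δ ∈ c.Y t,
    |inner ℝ (c.R t (u t)) δ - inner ℝ (l (t + 1)) (c.B (t + 1) δ)| ≤ e t * ‖δ‖

/-! ### A priori estimate for the optimality system. -/

variable {c : Chain E F} {T lo hi : ℕ} {L α γ : ℝ} {x l : ℕ → E} {u : ℕ → F} {e : ℕ → ℝ}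

/-- Test the adjoint equation with `x t`, the stationarity condition with `u t`, and add. Along the
dynamics the costate terms telescope and the last one vanishes, so only residuals are left. -/
theorem Approx.energy_le (h : c.Approx lo hi x u l e) (hle : lo ≤ hi) :
    ∑ t ∈ Finset.Icc lo hi, (‖c.C t (x t)‖ ^ 2 + inner ℝ (c.R t (u t)) (u t))
      ≤ ∑ t ∈ Finset.Icc lo hi, e t * (‖x t‖ + ‖u t‖ + ‖l t‖) := by
  have stage : ∀ t, lo ≤ t → t ≤ hi → ‖c.C t (x t)‖ ^ 2 + inner ℝ (c.R t (u t)) (u t)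
      + inner ℝ (l t) (x t) - inner ℝ (l (t + 1)) (c.A (t + 1) (x t) + c.B (t + 1) (u t))
      ≤ e t * (‖x t‖ + ‖u t‖) := by
    intro t h1 h2
    have ha := (abs_le.mp (h.adj t h1 h2 _ (h.x_mem t h1 h2))).2
    have hb := (abs_le.mp (h.opt t h1 h2 _ (h.u_mem t h1 h2))).2
    rw [real_inner_self_eq_norm_sq] at ha
    rw [inner_add_right]
    linarith
  have key : ∀ m, lo ≤ m → m ≤ hi →
      ∑ t ∈ Finset.Icc lo m, (‖c.C t (x t)‖ ^ 2 + inner ℝ (c.R t (u t)) (u t))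
        - inner ℝ (l (m + 1)) (c.A (m + 1) (x m) + c.B (m + 1) (u m))
      ≤ ∑ t ∈ Finset.Icc lo m, e t * (‖x t‖ + ‖u t‖ + ‖l t‖) := by
    intro m hm
    induction m, hm using Nat.le_induction with
    | base =>
      intro _
      simp only [Finset.Icc_self, Finset.sum_singleton]
      have h1 := stage lo le_rfl hle
      have h2 := (abs_le.mp (abs_real_inner_le_norm (l lo) (x lo))).1
      have h3 := mul_le_mul_of_nonneg_left h.init (norm_nonneg (l lo))
      linarith
    | succ m hm ih =>
      intro hmh
      rw [Finset.sum_Icc_succ_top (by omega), Finset.sum_Icc_succ_top (by omega)]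
      have h0 := ih (by omega)
      have h1 := stage (m + 1) (by omega) hmh
      have h2 := (abs_le.mp (abs_real_inner_le_norm (l (m + 1))
        (x (m + 1) - (c.A (m + 1) (x m) + c.B (m + 1) (u m))))).1
      have h3 := mul_le_mul_of_nonneg_left (h.dyn m hm (by omega)) (norm_nonneg (l (m + 1)))
      rw [inner_sub_right] at h2
      linarith
  simpa [h.l_end] using key hi hle le_rfl

/-- Output injection: `x (t + 1) = (A - J C) x t + (J C x t + B u t + residual)` is a stable
recursion driven by outputs and controls. -/
theorem Good.sum_sq_state_le (hg : c.Good T L α γ) (h : c.Approx lo hi x u l e) (hle : lo ≤ hi)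
    (hT : hi ≤ T) :
    (1 - α) ^ 2 * ∑ t ∈ Finset.Icc lo hi, ‖x t‖ ^ 2
      ≤ L ^ 2 * (3 * L ^ 2 * ∑ t ∈ Finset.Icc lo hi, (‖c.C t (x t)‖ ^ 2 + ‖u t‖ ^ 2)
        + 3 * ∑ t ∈ Finset.Icc lo hi, e t ^ 2) := by
  obtain ⟨J, hJ, hflow⟩ := hg.detectable
  have hL : 0 ≤ L := by linarith [hg.one_le_L]
  have hα : α ∈ Set.Ioo (0 : ℝ) 1 := ⟨hg.α_pos, hg.α_lt_one⟩
  set f : ℕ → ℝ := fun t => ‖c.C t (x t)‖ + ‖u t‖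
  set g : ℕ → ℝ := fun t => (if t ≤ lo then 0 else L * f (t - 1)) + e t
  obtain ⟨y, hy0, hy⟩ := exists_forward α g lo
  -- Only products of the matrices `A - J C` are small, not the single factors, so the induction
  -- bounds all future transports of `x t` at once by the scalar majorant `y`; the case `n = 0` is
  -- the one used.
  have bound : ∀ t, lo ≤ t → t ≤ hi → ∀ n, t + n ≤ T →
      ‖flow (fun t => c.A t - J t ∘ₗ c.C (t - 1)) t n (x t)‖ ≤ L * α ^ n * y t := by
    intro t ht
    induction t, ht using Nat.le_induction with
    | base =>
      intro _ n hn
      refine (hflow lo n hn _).trans ?_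
      have : L * α ^ n ≥ 0 := mul_nonneg hL (pow_nonneg hα.1.le _)
      refine mul_le_mul_of_nonneg_left ?_ this
      simpa [hy0, g] using h.init
    | succ t ht ih =>
      intro hth n hn
      have hc : L * α ^ n ≥ 0 := mul_nonneg hL (pow_nonneg hα.1.le _)
      set d := x (t + 1) - (c.A (t + 1) (x t) + c.B (t + 1) (u t)) with hd
      have dec : x (t + 1) = (c.A (t + 1) - J (t + 1) ∘ₗ c.C (t + 1 - 1)) (x t)
          + (J (t + 1) (c.C t (x t)) + c.B (t + 1) (u t) + d) := by
        simp only [hd, LinearMap.sub_apply, LinearMap.comp_apply, Nat.add_sub_cancel]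
        abel
      have b1 : ‖J (t + 1) (c.C t (x t)) + c.B (t + 1) (u t) + d‖ ≤ g (t + 1) := by
        have e1 := hJ (t + 1) (by omega) (by omega) (c.C t (x t))
        have e2 := hg.B_bdd (t + 1) (by omega) (u t)
        have e3 := h.dyn t ht (by omega)
        have : ¬ (t + 1 ≤ lo) := by omega
        simp only [g, f, this, if_false, Nat.add_sub_cancel]
        refine (norm_add₃_le).trans ?_
        linarith
      have e4 : t + (n + 1) = t + 1 + n := by omega
      have b2 := ih (by omega) (n + 1) (by omega)
      rw [flow_succ_apply] at b2
      have b3 := hflow (t + 1) n (by omega)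
        (J (t + 1) (c.C t (x t)) + c.B (t + 1) (u t) + d)
      rw [dec, map_add]
      refine (norm_add_le _ _).trans ?_
      rw [hy t ht]
      have b4 := mul_le_mul_of_nonneg_left b1 hc
      have : L * α ^ (n + 1) * y t = L * α ^ n * (α * y t) := by ring
      linarith
  have b0 : ∀ t ∈ Finset.Icc lo hi, ‖x t‖ ^ 2 ≤ L ^ 2 * y t ^ 2 := by
    intro t ht
    rw [Finset.mem_Icc] at ht
    have := bound t ht.1 ht.2 0 (by omega)
    simp only [flow, LinearMap.id_coe, id_eq, pow_zero, mul_one] at this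
    rw [← mul_pow]
    exact pow_le_pow_left₀ (norm_nonneg _) this 2
  have b1 := sum_sq_forward hα hle hy0 hy
  have b2 : ∑ t ∈ Finset.Icc lo hi, g t ^ 2 ≤
      3 * L ^ 2 * ∑ t ∈ Finset.Icc lo hi, (‖c.C t (x t)‖ ^ 2 + ‖u t‖ ^ 2)
        + 3 * ∑ t ∈ Finset.Icc lo hi, e t ^ 2 := by
    have b3 : ∀ t ∈ Finset.Icc lo hi, g t ^ 2 ≤
        3 * L ^ 2 * (if t ≤ lo then 0 else ‖c.C (t - 1) (x (t - 1))‖ ^ 2 + ‖u (t - 1)‖ ^ 2)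
          + 3 * e t ^ 2 := by
      intro t _
      by_cases h1 : t ≤ lo
      · simp only [g, h1, if_true]
        nlinarith [sq_nonneg (e t)]
      · simp only [g, f, h1, if_false]
        calc _ = (L * ‖c.C (t - 1) (x (t - 1))‖ + L * ‖u (t - 1)‖ + e t) ^ 2 := by ring
          _ ≤ _ := by
            linarith [sq_nonneg (L * ‖c.C (t - 1) (x (t - 1))‖ - L * ‖u (t - 1)‖),
              sq_nonneg (L * ‖c.C (t - 1) (x (t - 1))‖ - e t),
              sq_nonneg (L * ‖u (t - 1)‖ - e t)]
    refine (Finset.sum_le_sum b3).trans ?_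
    rw [Finset.sum_add_distrib, ← Finset.mul_sum, ← Finset.mul_sum]
    have := sum_prev_le (F := fun t => ‖c.C t (x t)‖ ^ 2 + ‖u t‖ ^ 2) hle
      (fun t => by positivity)
    have := mul_le_mul_of_nonneg_left this (by positivity : 0 ≤ 3 * L ^ 2)
    linarith
  have := Finset.sum_le_sum b0
  rw [← Finset.mul_sum] at this
  have h3 := mul_le_mul_of_nonneg_left (b1.trans b2) (sq_nonneg L)
  have h4 := mul_le_mul_of_nonneg_left this (sq_nonneg (1 - α))
  linarith

theorem flow_mem {Φ : ℕ → E →ₗ[ℝ] E} (hΦ : ∀ t < T, ∀ x ∈ c.V t, Φ (t + 1) x ∈ c.V (t + 1))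
    (s n : ℕ) (hn : s + n ≤ T) {x : E} (hx : x ∈ c.V s) : flow Φ s n x ∈ c.V (s + n) := by
  induction n with
  | zero => exact hx
  | succ n ih => exact hΦ (s + n) (by omega) _ (ih (by omega))

/-- Dual to the state estimate: subtracting the stationarity condition tested with `K t δ` from the
adjoint equation tested with `δ` gives `⟪l t, δ⟫ = ⟪l (t + 1), Φ (t + 1) δ⟫` up to `g t * ‖δ‖`, a
stable backward recursion. The gain must preserve adaptedness for `K t δ` to be an admissible test
vector. -/
theorem Good.sum_sq_costate_le (hg : c.Good T L α γ) (h : c.Approx lo hi x u l e) (hle : lo ≤ hi)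
    (hT : hi ≤ T) :
    (1 - α) ^ 2 * ∑ t ∈ Finset.Icc lo hi, ‖l t‖ ^ 2
      ≤ L ^ 2 * (3 * L ^ 4 * ∑ t ∈ Finset.Icc lo hi, (‖c.C t (x t)‖ ^ 2 + ‖u t‖ ^ 2)
        + 12 * L ^ 4 * ∑ t ∈ Finset.Icc lo hi, e t ^ 2) := by
  obtain ⟨K, hKm, hK, hflow⟩ := hg.stabilizable
  have hL1 := hg.one_le_L
  have hL : 0 ≤ L := by linarith
  have hLL : L ≤ L ^ 2 := by nlinarith
  have hα : α ∈ Set.Ioo (0 : ℝ) 1 := ⟨hg.α_pos, hg.α_lt_one⟩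
  set Φ : ℕ → E →ₗ[ℝ] E := fun t => c.A t - c.B t ∘ₗ K (t - 1) with hΦ
  have hΦm : ∀ t < T, ∀ x ∈ c.V t, Φ (t + 1) x ∈ c.V (t + 1) := fun t ht x hx =>
    Submodule.sub_mem _ (hg.A_map t ht x hx) (hg.B_map t ht _ (hKm t ht x hx))
  -- The output term costs `L` and the control term `L ^ 2` (one factor from `R`, one from `K`); the
  -- two residuals cost `1` and `L`. All are majorized by `L ^ 2`.
  set g : ℕ → ℝ := fun t => L ^ 2 * (‖c.C t (x t)‖ + ‖u t‖ + 2 * e t) with hgdef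
  obtain ⟨y, hy0, hy⟩ := exists_backward α g hi
  have local_last : ∀ δ ∈ c.V hi, |inner ℝ (l hi) δ| ≤ g hi * ‖δ‖ := by
    intro δ hδ
    have h1 := h.adj hi hle le_rfl δ hδ
    rw [h.l_end, inner_zero_left, sub_zero] at h1
    have h2 := abs_real_inner_le_norm (c.C hi (x hi)) (c.C hi δ)
    have h3 := mul_le_mul_of_nonneg_left (hg.C_bdd hi hT δ) (norm_nonneg (c.C hi (x hi)))
    have h4 : L * (‖c.C hi (x hi)‖ * ‖δ‖) ≤ L ^ 2 * (‖c.C hi (x hi)‖ * ‖δ‖) :=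
      mul_le_mul_of_nonneg_right hLL (by positivity)
    have h5 : e hi * ‖δ‖ ≤ L ^ 2 * 2 * e hi * ‖δ‖ := by
      have := mul_nonneg (h.nonneg hi) (norm_nonneg δ)
      nlinarith
    have h6 : 0 ≤ L ^ 2 * ‖u hi‖ * ‖δ‖ := by positivity
    simp only [hgdef]
    rw [abs_le] at h1 h2 ⊢
    constructor <;> nlinarith
  have local_step : ∀ t, lo ≤ t → t < hi → ∀ δ ∈ c.V t,
      |inner ℝ (l t) δ - inner ℝ (l (t + 1)) (Φ (t + 1) δ)| ≤ g t * ‖δ‖ := by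
    intro t h0 ht δ hδ
    have h1 := h.adj t h0 ht.le δ hδ
    have h1' := h.opt t h0 ht.le _ (hKm t (by omega) δ hδ)
    have h2 := abs_real_inner_le_norm (c.C t (x t)) (c.C t δ)
    have h2' := abs_real_inner_le_norm (c.R t (u t)) (K t δ)
    have hk := hK t (by omega) δ
    have h3 := mul_le_mul_of_nonneg_left (hg.C_bdd t (by omega) δ) (norm_nonneg (c.C t (x t)))
    have h3' := mul_le_mul (hg.R_bdd t (by omega) (u t)) hk (norm_nonneg _) (by positivity)
    have h4 : L * (‖c.C t (x t)‖ * ‖δ‖) ≤ L ^ 2 * (‖c.C t (x t)‖ * ‖δ‖) :=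
      mul_le_mul_of_nonneg_right hLL (by positivity)
    have h5 : e t * ‖δ‖ ≤ L ^ 2 * (e t * ‖δ‖) :=
      le_mul_of_one_le_left (mul_nonneg (h.nonneg t) (norm_nonneg δ)) (by nlinarith)
    have h6 : e t * ‖K t δ‖ ≤ L ^ 2 * (e t * ‖δ‖) := by
      have h7 := mul_le_mul_of_nonneg_left hk (h.nonneg t)
      have h8 : L * (e t * ‖δ‖) ≤ L ^ 2 * (e t * ‖δ‖) :=
        mul_le_mul_of_nonneg_right hLL (mul_nonneg (h.nonneg t) (norm_nonneg δ))
      linarith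
    have e1 : inner ℝ (l (t + 1)) (Φ (t + 1) δ)
        = inner ℝ (l (t + 1)) (c.A (t + 1) δ) - inner ℝ (l (t + 1)) (c.B (t + 1) (K t δ)) := by
      rw [← inner_sub_right]
      rfl
    rw [e1]
    simp only [hgdef]
    rw [abs_le] at h1 h1' h2 h2' ⊢
    constructor <;> nlinarith
  -- Testing with transports of earlier vectors makes the recursion meet products of the `Φ` only;
  -- the norm is recovered from `s = t`, `n = 0`, `δ = l t`.
  have bound : ∀ t, t ≤ hi → ∀ s n, lo ≤ s → s + n = t → ∀ δ ∈ c.V s,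
      |inner ℝ (l t) (flow Φ s n δ)| ≤ L * α ^ n * y t * ‖δ‖ := by
    intro t ht
    induction ht using Nat.decreasingInduction with
    | self =>
      intro s n hs hn δ hδ
      subst hn
      refine (local_last _ (flow_mem hΦm s n hT hδ)).trans ?_
      have h1 := mul_le_mul_of_nonneg_left (hflow s n hT δ)
        (by have := h.nonneg (s + n); positivity : 0 ≤ g (s + n))
      rw [hy0]
      linarith
    | of_succ t ht ih =>
      intro s n hs hn δ hδ
      have h1 := ih s (n + 1) hs (by omega) δ hδ
      subst hn
      have h2 := local_step (s + n) (by omega) ht _ (flow_mem hΦm s n (by omega) hδ)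
      have h3 := mul_le_mul_of_nonneg_left (hflow s n (by omega) δ)
        (by have := h.nonneg (s + n); positivity : 0 ≤ g (s + n))
      change |inner ℝ (l (s + n + 1)) (Φ (s + n + 1) (flow Φ s n δ))| ≤ _ at h1
      rw [hy _ ht]
      have e1 : L * α ^ n * (α * y (s + n + 1) + g (s + n)) * ‖δ‖
        = L * α ^ (n + 1) * y (s + n + 1) * ‖δ‖ + g (s + n) * (L * α ^ n * ‖δ‖) := by ring
      rw [e1]
      rw [abs_le] at h1 h2 ⊢
      constructor <;> linarith
  have b0 : ∀ t ∈ Finset.Icc lo hi, ‖l t‖ ^ 2 ≤ L ^ 2 * y t ^ 2 := by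
    intro t ht
    rw [Finset.mem_Icc] at ht
    have := bound t ht.2 t 0 ht.1 rfl (l t) (h.l_mem t ht.1 ht.2)
    simp only [flow, LinearMap.id_coe, id_eq, pow_zero, mul_one] at this
    rw [real_inner_self_eq_norm_sq, abs_of_nonneg (sq_nonneg _)] at this
    rw [← mul_pow]
    rcases (norm_nonneg (l t)).eq_or_lt with h0 | h0
    · rw [← h0, zero_pow two_ne_zero]
      positivity
    · rw [sq] at this
      exact pow_le_pow_left₀ h0.le (le_of_mul_le_mul_right this h0) 2
  have b1 := sum_sq_backward hα hle hy0 (fun t _ ht => hy t ht)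
  have b2 : ∑ t ∈ Finset.Icc lo hi, g t ^ 2 ≤
      3 * L ^ 4 * ∑ t ∈ Finset.Icc lo hi, (‖c.C t (x t)‖ ^ 2 + ‖u t‖ ^ 2)
        + 12 * L ^ 4 * ∑ t ∈ Finset.Icc lo hi, e t ^ 2 := by
    rw [Finset.mul_sum, Finset.mul_sum, ← Finset.sum_add_distrib]
    refine Finset.sum_le_sum fun t _ => ?_
    have : (‖c.C t (x t)‖ + ‖u t‖ + 2 * e t) ^ 2
        ≤ 3 * (‖c.C t (x t)‖ ^ 2 + ‖u t‖ ^ 2) + 12 * e t ^ 2 := by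
      linarith [sq_nonneg (‖c.C t (x t)‖ - ‖u t‖), sq_nonneg (‖c.C t (x t)‖ - 2 * e t),
        sq_nonneg (‖u t‖ - 2 * e t)]
    have := mul_le_mul_of_nonneg_left this (by positivity : 0 ≤ L ^ 4)
    simp only [hgdef]
    calc _ = L ^ 4 * (‖c.C t (x t)‖ + ‖u t‖ + 2 * e t) ^ 2 := by ring
      _ ≤ _ := by linarith
  have := Finset.sum_le_sum b0
  rw [← Finset.mul_sum] at this
  have h3 := mul_le_mul_of_nonneg_left (b1.trans b2) (sq_nonneg L)
  have h4 := mul_le_mul_of_nonneg_left this (sq_nonneg (1 - α))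
  linarith

/-- A bound on the inverse of the optimality system. -/
def gain (L α γ : ℝ) : ℝ := 30 * L ^ 6 / ((1 - α) ^ 2 * γ)

/-- The state and costate estimates bound the whole solution by `S + D`, and the energy inequality
bounds `S` by a small multiple of the whole solution plus a large multiple of `D`. Absorbing the
former closes the circle. -/
theorem Good.sum_stageSq_le (hg : c.Good T L α γ) (h : c.Approx lo hi x u l e) (hle : lo ≤ hi)
    (hT : hi ≤ T) :
    ∑ t ∈ Finset.Icc lo hi, stageSq x u l t
      ≤ gain L α γ ^ 2 * ∑ t ∈ Finset.Icc lo hi, e t ^ 2 := by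
  have hL := hg.one_le_L
  have hγ := hg.γ_pos
  have hγ1 := hg.γ_le_one
  have h1α : 0 < 1 - α := by linarith [hg.α_lt_one]
  set S := ∑ t ∈ Finset.Icc lo hi, (‖c.C t (x t)‖ ^ 2 + ‖u t‖ ^ 2) with hS
  set X := ∑ t ∈ Finset.Icc lo hi, ‖x t‖ ^ 2
  set U := ∑ t ∈ Finset.Icc lo hi, ‖u t‖ ^ 2
  set Λ := ∑ t ∈ Finset.Icc lo hi, ‖l t‖ ^ 2
  set D := ∑ t ∈ Finset.Icc lo hi, e t ^ 2
  have hD : 0 ≤ D := Finset.sum_nonneg fun t _ => sq_nonneg _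
  have hS0 : 0 ≤ S := Finset.sum_nonneg fun t _ => by positivity
  have hZ : ∑ t ∈ Finset.Icc lo hi, stageSq x u l t = X + U + Λ := by
    simp only [stageSq, Finset.sum_add_distrib, X, U, Λ]
  have hx := hg.sum_sq_state_le h hle hT
  have hl := hg.sum_sq_costate_le h hle hT
  have hUS : U ≤ S := Finset.sum_le_sum fun t _ => by linarith [sq_nonneg ‖c.C t (x t)‖]
  set β := L ^ 6 / (1 - α) ^ 2 with hβ
  have hβ1 : 1 ≤ β := by
    rw [hβ, one_le_div (by positivity)]
    calc (1 - α) ^ 2 ≤ 1 := by nlinarith [hg.α_pos]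
      _ ≤ L ^ 6 := one_le_pow₀ hL
  have hZβ : X + U + Λ ≤ 16 * β * (S + D) := by
    have p1 : L ^ 2 * L ^ 2 ≤ L ^ 6 := by
      rw [← pow_add]; exact pow_le_pow_right₀ hL (by norm_num)
    have p2 : L ^ 2 ≤ L ^ 6 := pow_le_pow_right₀ hL (by norm_num)
    have q1 : (1 - α) ^ 2 * X ≤ 3 * L ^ 6 * (S + D) := by nlinarith
    have q2 : (1 - α) ^ 2 * Λ ≤ 12 * L ^ 6 * (S + D) := by
      nlinarith [pow_nonneg (by linarith : 0 ≤ L) 6]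
    have q3 : X + Λ ≤ 15 * β * (S + D) := by
      rw [hβ, show 15 * (L ^ 6 / (1 - α) ^ 2) * (S + D) = 15 * L ^ 6 * (S + D) / (1 - α) ^ 2 by
        ring,
        le_div_iff₀ (by positivity)]
      linarith
    nlinarith
  have hE : γ * S ≤ γ / (32 * β) * (X + U + Λ) + 24 * β / γ * D := by
    have e1 : γ * S ≤
        ∑ t ∈ Finset.Icc lo hi, (‖c.C t (x t)‖ ^ 2 + inner ℝ (c.R t (u t)) (u t)) := by
      rw [hS, Finset.mul_sum]
      refine Finset.sum_le_sum fun t ht => ?_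
      have := hg.R_coercive t (by have := (Finset.mem_Icc.mp ht).2; omega) (u t)
      nlinarith [sq_nonneg ‖c.C t (x t)‖]
    refine (e1.trans (h.energy_le hle)).trans ?_
    rw [← hZ, Finset.mul_sum, Finset.mul_sum, ← Finset.sum_add_distrib]
    refine Finset.sum_le_sum fun t _ => ?_
    -- This weight in `e a ≤ θ a² + e² / (4 θ)` makes `θ * (16 * β) = γ / 2`, so half of `γ * S`
    -- survives the absorption.
    set θ := γ / (32 * β) with hθ
    have hθ0 : 0 < θ := by positivity
    have hθ1 : 24 * β / γ = 3 * (1 / (4 * θ)) := by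
      rw [hθ]; field_simp; norm_num
    have am : ∀ a : ℝ, e t * a ≤ θ * a ^ 2 + 1 / (4 * θ) * e t ^ 2 := by
      intro a
      have : θ * a ^ 2 + 1 / (4 * θ) * e t ^ 2 - e t * a = (2 * θ * a - e t) ^ 2 / (4 * θ) := by
        field_simp
        ring
      have : 0 ≤ (2 * θ * a - e t) ^ 2 / (4 * θ) := by positivity
      linarith
    rw [hθ1, stageSq]
    linarith [am ‖x t‖, am ‖u t‖, am ‖l t‖]
  have hS' : S ≤ 49 * (β / γ ^ 2) * D := by
    have e1 : γ / (32 * β) * (X + U + Λ) ≤ γ / 2 * (S + D) := by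
      calc _ ≤ γ / (32 * β) * (16 * β * (S + D)) :=
            mul_le_mul_of_nonneg_left hZβ (by positivity)
        _ = _ := by field_simp; ring
    have e2 : S ≤ D + 48 * (β / γ ^ 2) * D := by
      have : γ / 2 * S ≤ γ / 2 * (D + 48 * (β / γ ^ 2) * D) := by
        have : γ / 2 * (D + 48 * (β / γ ^ 2) * D) = γ / 2 * D + 24 * β / γ * D := by
          field_simp
          ring
        linarith
      exact le_of_mul_le_mul_left this (by positivity)
    have e3 : 1 ≤ β / γ ^ 2 := by
      rw [one_le_div (by positivity)]
      nlinarith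
    nlinarith
  have e3 : 1 ≤ β / γ ^ 2 := by
    rw [one_le_div (by positivity)]
    nlinarith
  have hG : gain L α γ ^ 2 = 900 * β * (β / γ ^ 2) := by
    rw [gain, hβ]
    field_simp
    norm_num
  rw [hZ, hG]
  calc X + U + Λ ≤ 16 * β * (S + D) := hZβ
    _ ≤ 16 * β * (49 * (β / γ ^ 2) * D + β / γ ^ 2 * D) := by
      refine mul_le_mul_of_nonneg_left ?_ (by positivity)
      nlinarith
    _ = 800 * (β * (β / γ ^ 2) * D) := by ring
    _ ≤ 900 * (β * (β / γ ^ 2) * D) := by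
      refine mul_le_mul_of_nonneg_right (by norm_num) (by positivity)
    _ = _ := by ring

end Chain

/-! ### Exponential decay of sensitivity. -/

namespace Chain

variable {E F : Type*} [NormedAddCommGroup E] [InnerProductSpace ℝ E]
    [NormedAddCommGroup F] [InnerProductSpace ℝ F]

variable {c : Chain E F} {T lo hi : ℕ} {L α γ : ℝ} {x l : ℕ → E} {u : ℕ → F} {e : ℕ → ℝ}

theorem gain_nonneg (hγ : 0 < γ) (hL : 1 ≤ L) : 0 ≤ gain L α γ := by
  unfold gain
  have : 0 ≤ L := by linarith
  positivity

/-- Neighbouring weights have ratio `r` or `1 / r`. Both forms are needed: the dynamics involve the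
preceding state and control, the adjoint and stationarity conditions the following costate. -/
theorem abs_pow_dist_sub_le {r : ℝ} (hr0 : 0 < r) (hr1 : r ≤ 1) (s t : ℕ) :
    |r ^ Nat.dist t s - r ^ Nat.dist (t + 1) s| ≤ (1 / r - 1) * r ^ Nat.dist (t + 1) s ∧
    |r ^ Nat.dist t s - r ^ Nat.dist (t + 1) s| ≤ (1 / r - 1) * r ^ Nat.dist t s := by
  have hη : 0 ≤ 1 / r - 1 := by
    rw [sub_nonneg, one_le_div hr0]
    exact hr1
  have hη' : (1 / r - 1) * r = 1 - r := by field_simp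
  rcases le_or_gt s t with h | h
  · have e1 : Nat.dist (t + 1) s = Nat.dist t s + 1 := by unfold Nat.dist; omega
    rw [e1, pow_succ]
    have hp : 0 < r ^ Nat.dist t s := by positivity
    have e2 : r ^ Nat.dist t s - r ^ Nat.dist t s * r = (1 / r - 1) * (r ^ Nat.dist t s * r) := by
      linear_combination -(r ^ Nat.dist t s) * hη'
    rw [e2, abs_of_nonneg (by positivity)]
    exact ⟨le_rfl, mul_le_mul_of_nonneg_left (by nlinarith) hη⟩
  · have e1 : Nat.dist t s = Nat.dist (t + 1) s + 1 := by unfold Nat.dist; omega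
    rw [e1, pow_succ]
    have hp : 0 < r ^ Nat.dist (t + 1) s := by positivity
    have e2 : r ^ Nat.dist (t + 1) s * r - r ^ Nat.dist (t + 1) s
        = -((1 / r - 1) * (r ^ Nat.dist (t + 1) s * r)) := by
      linear_combination r ^ Nat.dist (t + 1) s * hη'
    rw [e2, abs_neg, abs_of_nonneg (by positivity)]
    exact ⟨mul_le_mul_of_nonneg_left (by nlinarith) hη, le_rfl⟩

/-- Exponentially weighted form of an approximate solution. -/
theorem Good.approx_weighted (hg : c.Good T L α γ) (h : c.Approx lo hi x u l e)
    (hT : hi ≤ T) {r : ℝ} (hr0 : 0 < r) (hr1 : r ≤ 1) (s : ℕ) :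
    c.Approx lo hi (fun t => r ^ Nat.dist t s • x t) (fun t => r ^ Nat.dist t s • u t)
      (fun t => r ^ Nat.dist t s • l t)
      (fun t => r ^ Nat.dist t s * e t + (1 / r - 1) * L * (r ^ Nat.dist (t + 1) s * ‖l (t + 1)‖ +
        (if t ≤ lo then 0 else
          r ^ Nat.dist (t - 1) s * ‖x (t - 1)‖ + r ^ Nat.dist (t - 1) s * ‖u (t - 1)‖))) := by
  have hL : 0 ≤ L := by linarith [hg.one_le_L]
  have hη : 0 ≤ 1 / r - 1 := by
    rw [sub_nonneg, one_le_div hr0]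
    exact hr1
  have hw : ∀ t, 0 < r ^ Nat.dist t s := fun t => by positivity
  have hif : ∀ t, 0 ≤ (if t ≤ lo then 0 else
          r ^ Nat.dist (t - 1) s * ‖x (t - 1)‖ + r ^ Nat.dist (t - 1) s * ‖u (t - 1)‖) := by
    intro t
    split_ifs
    · exact le_rfl
    · positivity
  constructor
  · intro t
    have := h.nonneg t
    have := hif t
    positivity
  · exact fun t h1 h2 => Submodule.smul_mem _ _ (h.x_mem t h1 h2)
  · exact fun t h1 h2 => Submodule.smul_mem _ _ (h.u_mem t h1 h2)
  · exact fun t h1 h2 => Submodule.smul_mem _ _ (h.l_mem t h1 h2)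
  · simp [h.l_end]
  · rw [norm_smul, Real.norm_of_nonneg (hw lo).le, if_pos le_rfl]
    have := mul_le_mul_of_nonneg_left h.init (hw lo).le
    have : 0 ≤ (1 / r - 1) * L * (r ^ Nat.dist (lo + 1) s * ‖l (lo + 1)‖ + 0) := by positivity
    linarith
  · intro t h1 h2
    -- The weighted residual plus a commutator, which is small because consecutive weights are
    -- close.
    have e1 : r ^ Nat.dist (t + 1) s • x (t + 1) - (c.A (t + 1) (r ^ Nat.dist t s • x t)
          + c.B (t + 1) (r ^ Nat.dist t s • u t))
        = r ^ Nat.dist (t + 1) s • (x (t + 1) - (c.A (t + 1) (x t) + c.B (t + 1) (u t)))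
          - (r ^ Nat.dist t s - r ^ Nat.dist (t + 1) s)
            • (c.A (t + 1) (x t) + c.B (t + 1) (u t)) := by
      rw [map_smul, map_smul]
      module
    rw [e1, if_neg (by omega), Nat.add_sub_cancel]
    refine (norm_sub_le _ _).trans ?_
    rw [norm_smul, norm_smul, Real.norm_of_nonneg (hw _).le, Real.norm_eq_abs]
    have b1 := mul_le_mul_of_nonneg_left (h.dyn t h1 h2) (hw (t + 1)).le
    have b2 : ‖c.A (t + 1) (x t) + c.B (t + 1) (u t)‖ ≤ L * (‖x t‖ + ‖u t‖) := by
      refine (norm_add_le _ _).trans ?_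
      have := hg.A_bdd (t + 1) (by omega) (x t)
      have := hg.B_bdd (t + 1) (by omega) (u t)
      linarith
    have b3 := mul_le_mul (abs_pow_dist_sub_le hr0 hr1 s t).2 b2 (norm_nonneg _)
      (mul_nonneg hη (hw t).le)
    have : 0 ≤ (1 / r - 1) * L * (r ^ Nat.dist (t + 1 + 1) s * ‖l (t + 1 + 1)‖) := by positivity
    linarith
  · intro t h1 h2 δ hδ
    have b1 := mul_le_mul_of_nonneg_left (h.adj t h1 h2 δ hδ) (hw t).le
    have b2 : ‖inner ℝ (l (t + 1)) (c.A (t + 1) δ)‖ ≤ ‖l (t + 1)‖ * (L * ‖δ‖) := by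
      -- At `t = hi` the bound on `A (hi + 1)` may be unavailable, but there the costate vanishes.
      rcases h2.eq_or_lt with h3 | h3
      · rw [h3, h.l_end]; simp
      · exact (norm_inner_le_norm _ _).trans
          (mul_le_mul_of_nonneg_left (hg.A_bdd _ (by omega) _) (norm_nonneg _))
    have b3 := mul_le_mul (abs_pow_dist_sub_le hr0 hr1 s t).1 b2 (norm_nonneg _)
      (mul_nonneg hη (hw _).le)
    have b4 := mul_nonneg (mul_nonneg (mul_nonneg hη hL) (hif t)) (norm_nonneg δ)
    rw [Real.norm_eq_abs, ← abs_mul] at b3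
    rw [← abs_of_pos (hw t), ← abs_mul, abs_of_pos (hw t)] at b1
    simp only [map_smul, inner_smul_left, RCLike.conj_to_real]
    refine le_trans (b := _ + _) ?_ ((add_le_add b1 b3).trans ?_)
    · refine le_trans (le_of_eq ?_) (abs_add_le _ _)
      congr 1
      ring
    · linarith
  · intro t h1 h2 δ hδ
    have b1 := mul_le_mul_of_nonneg_left (h.opt t h1 h2 δ hδ) (hw t).le
    have b2 : ‖inner ℝ (l (t + 1)) (c.B (t + 1) δ)‖ ≤ ‖l (t + 1)‖ * (L * ‖δ‖) := by
      rcases h2.eq_or_lt with h3 | h3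
      · rw [h3, h.l_end]; simp
      · exact (norm_inner_le_norm _ _).trans
          (mul_le_mul_of_nonneg_left (hg.B_bdd _ (by omega) _) (norm_nonneg _))
    have b3 := mul_le_mul (abs_pow_dist_sub_le hr0 hr1 s t).1 b2 (norm_nonneg _)
      (mul_nonneg hη (hw _).le)
    have b4 := mul_nonneg (mul_nonneg (mul_nonneg hη hL) (hif t)) (norm_nonneg δ)
    rw [Real.norm_eq_abs, ← abs_mul] at b3
    rw [← abs_of_pos (hw t), ← abs_mul, abs_of_pos (hw t)] at b1
    simp only [map_smul, inner_smul_left, RCLike.conj_to_real]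
    refine le_trans (b := _ + _) ?_ ((add_le_add b1 b3).trans ?_)
    · refine le_trans (le_of_eq ?_) (abs_add_le _ _)
      congr 1
      ring
    · linarith

/-- Exponential decay of sensitivity: the solution at stage `s` depends on the error at stage `t`
with a weight that decays exponentially in `|t - s|`. The errors may depend on the solution. -/
theorem Good.sqrt_stageSq_le (hg : c.Good T L α γ) (h : c.Approx lo hi x u l e)
    (hT : hi ≤ T) {r ε : ℝ} (hr0 : 0 < r) (hr1 : r ≤ 1)
    (hr : 5 * gain L α γ * (L * (1 / r - 1)) ≤ 1) (hε0 : 0 ≤ ε) (hε : 5 * gain L α γ * ε ≤ 1)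
    {g : ℕ → ℝ} (hg0 : ∀ t, 0 ≤ g t)
    (he : ∀ t, lo ≤ t → t ≤ hi → e t ≤ ε * √(stageSq x u l t) + g t)
    {s : ℕ} (hs0 : lo ≤ s) (hs1 : s ≤ hi) :
    √(stageSq x u l s) ≤ 4 * gain L α γ * ∑ t ∈ Finset.Icc lo hi, r ^ Nat.dist t s * g t := by
  have hle := hs0.trans hs1
  have hL : 0 ≤ L := by linarith [hg.one_le_L]
  have hη : 0 ≤ 1 / r - 1 := by
    rw [sub_nonneg, one_le_div hr0]
    exact hr1
  have hw : ∀ t, 0 < r ^ Nat.dist t s := fun t => by positivity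
  have hG := gain_nonneg (α := α) hg.γ_pos hg.one_le_L
  have main := hg.sum_stageSq_le (hg.approx_weighted h hT hr0 hr1 s) hle hT
  set G := gain L α γ
  set Z := ∑ t ∈ Finset.Icc lo hi, stageSq (fun t => r ^ Nat.dist t s • x t)
    (fun t => r ^ Nat.dist t s • u t) (fun t => r ^ Nat.dist t s • l t) t with hZ
  have hst : ∀ t, stageSq (fun t => r ^ Nat.dist t s • x t)
    (fun t => r ^ Nat.dist t s • u t) (fun t => r ^ Nat.dist t s • l t) t
      = (r ^ Nat.dist t s) ^ 2 * stageSq x u l t := by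
    intro t
    simp only [stageSq, norm_smul, Real.norm_of_nonneg (hw t).le]
    ring
  set η := L * (1 / r - 1) with hηd
  set P : ℕ → ℝ := fun t => (r ^ Nat.dist t s * ‖l t‖) ^ 2
  set N : ℕ → ℝ := fun t => (r ^ Nat.dist t s * ‖x t‖) ^ 2 + (r ^ Nat.dist t s * ‖u t‖) ^ 2
  -- The weighted error has five summands: the part depending on the solution, the data, and three
  -- commutators with neighbouring stages. Cauchy–Schwarz produces the factor `5`.
  have pt : ∀ t ∈ Finset.Icc lo hi, (r ^ Nat.dist t s * e t + (1 / r - 1) * L *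
      (r ^ Nat.dist (t + 1) s * ‖l (t + 1)‖ + (if t ≤ lo then 0 else
          r ^ Nat.dist (t - 1) s * ‖x (t - 1)‖ + r ^ Nat.dist (t - 1) s * ‖u (t - 1)‖))) ^ 2
      ≤ 5 * ε ^ 2 * ((r ^ Nat.dist t s) ^ 2 * stageSq x u l t)
        + 5 * (r ^ Nat.dist t s * g t) ^ 2
        + 5 * η ^ 2 * (P (t + 1) + if t ≤ lo then 0 else N (t - 1)) := by
    intro t ht
    rw [Finset.mem_Icc] at ht
    have h1 := mul_le_mul_of_nonneg_left (he t ht.1 ht.2) (hw t).le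
    have hsq := Real.sq_sqrt (stageSq_nonneg x u l t)
    have five : ∀ a b p q v : ℝ, (a + b + (p + (q + v))) ^ 2
        ≤ 5 * (a ^ 2 + b ^ 2 + p ^ 2 + q ^ 2 + v ^ 2) := by
      intro a b p q v
      linarith [sq_nonneg (a - b), sq_nonneg (a - p), sq_nonneg (a - q), sq_nonneg (a - v),
        sq_nonneg (b - p), sq_nonneg (b - q), sq_nonneg (b - v), sq_nonneg (p - q),
        sq_nonneg (p - v), sq_nonneg (q - v)]
    have e0 := h.nonneg t
    have f := five (ε * (r ^ Nat.dist t s * √(stageSq x u l t))) (r ^ Nat.dist t s * g t)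
      (η * (r ^ Nat.dist (t + 1) s * ‖l (t + 1)‖))
    rw [mul_pow ε, mul_pow _ √(stageSq x u l t), hsq] at f
    by_cases hlo : t ≤ lo
    · simp only [hlo, if_true]
      refine (pow_le_pow_left₀ (by positivity) ?_ 2).trans ((f 0 0).trans ?_)
      · simp only [hηd]; linarith
      · simp only [P]; nlinarith
    · simp only [hlo, if_false]
      refine (pow_le_pow_left₀ (by positivity) ?_ 2).trans
        ((f (η * (r ^ Nat.dist (t - 1) s * ‖x (t - 1)‖))
          (η * (r ^ Nat.dist (t - 1) s * ‖u (t - 1)‖))).trans ?_)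
      · simp only [hηd]; linarith
      · simp only [P, N]; nlinarith
  have S1 := Finset.sum_le_sum pt
  simp only [Finset.sum_add_distrib, ← Finset.mul_sum] at S1
  have S2 : ∑ t ∈ Finset.Icc lo hi, P (t + 1) ≤ ∑ t ∈ Finset.Icc lo hi, P t :=
    sum_next_le hle (fun t => sq_nonneg _) (by simp [P, h.l_end])
  have S3 : ∑ t ∈ Finset.Icc lo hi, (if t ≤ lo then 0 else N (t - 1))
      ≤ ∑ t ∈ Finset.Icc lo hi, N t :=
    sum_prev_le hle (fun t => by positivity)
  have S4 : ∑ t ∈ Finset.Icc lo hi, P t + ∑ t ∈ Finset.Icc lo hi, N t = Z := by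
    rw [hZ, ← Finset.sum_add_distrib]
    refine Finset.sum_congr rfl fun t _ => ?_
    rw [hst]
    simp only [P, N, stageSq]
    ring
  have S5 : ∑ t ∈ Finset.Icc lo hi, (r ^ Nat.dist t s) ^ 2 * stageSq x u l t = Z :=
    Finset.sum_congr rfl fun t _ => (hst t).symm
  rw [S5] at S1
  have S6 : ∑ t ∈ Finset.Icc lo hi, (r ^ Nat.dist t s * g t) ^ 2
      ≤ (∑ t ∈ Finset.Icc lo hi, r ^ Nat.dist t s * g t) ^ 2 :=
    Finset.sum_sq_le_sq_sum_of_nonneg fun t _ => mul_nonneg (hw t).le (hg0 t)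
  set Sg := ∑ t ∈ Finset.Icc lo hi, r ^ Nat.dist t s * g t with hSg
  have hSg0 : 0 ≤ Sg := Finset.sum_nonneg fun t _ => mul_nonneg (hw t).le (hg0 t)
  have hZ0 : 0 ≤ Z := Finset.sum_nonneg fun t _ => stageSq_nonneg _ _ _ _
  have hη0 : 0 ≤ η := mul_nonneg hL hη
  -- The commutators and the solution-dependent error contribute at most `Z / 5` each. This leaves
  -- `3 / 5 * Z ≤ 5 * G ^ 2 * Sg ^ 2`, and `25 / 3 ≤ 16`.
  have c1 : 5 * (G * η) ^ 2 ≤ 1 / 5 := by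
    have : 5 * (G * η) ≤ 1 := by linarith
    nlinarith [mul_nonneg hG hη0]
  have c2 : 5 * (G * ε) ^ 2 ≤ 1 / 5 := by
    have : 5 * (G * ε) ≤ 1 := by linarith
    nlinarith [mul_nonneg hG hε0]
  have S7 := main.trans (mul_le_mul_of_nonneg_left S1 (sq_nonneg G))
  have S8 : Z ≤ (4 * G * Sg) ^ 2 := by
    have t1 : G ^ 2 * (5 * η ^ 2 * (∑ t ∈ Finset.Icc lo hi, P (t + 1)
        + ∑ t ∈ Finset.Icc lo hi, if t ≤ lo then 0 else N (t - 1))) ≤ 1 / 5 * Z := by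
      calc _ ≤ G ^ 2 * (5 * η ^ 2 * Z) := by
            refine mul_le_mul_of_nonneg_left (mul_le_mul_of_nonneg_left ?_ (by positivity))
              (sq_nonneg G)
            linarith
        _ = 5 * (G * η) ^ 2 * Z := by ring
        _ ≤ _ := mul_le_mul_of_nonneg_right c1 hZ0
    have t2 : G ^ 2 * (5 * ε ^ 2 * Z) ≤ 1 / 5 * Z := by
      calc _ = 5 * (G * ε) ^ 2 * Z := by ring
        _ ≤ _ := mul_le_mul_of_nonneg_right c2 hZ0
    have t3 := mul_le_mul_of_nonneg_left S6 (by positivity : 0 ≤ G ^ 2 * 5)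
    have t4 : 0 ≤ G ^ 2 * Sg ^ 2 := by positivity
    nlinarith
  -- The weight at `s` itself is `1`.
  have S9 : stageSq x u l s ≤ Z := by
    have := Finset.single_le_sum (f := fun t => (r ^ Nat.dist t s) ^ 2 * stageSq x u l t)
      (fun t _ => mul_nonneg (sq_nonneg _) (stageSq_nonneg x u l t))
      (Finset.mem_Icc.mpr ⟨hs0, hs1⟩)
    rw [S5] at this
    simpa using this
  exact Real.sqrt_le_iff.mpr ⟨by positivity, S9.trans S8⟩

end Chain

/-! ### Existence for the optimality system and first-order optimality. -/

namespace Chain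

variable {E F : Type*} [NormedAddCommGroup E] [InnerProductSpace ℝ E]
    [NormedAddCommGroup F] [InnerProductSpace ℝ F]

variable {c : Chain E F} {T lo hi : ℕ} {L α γ : ℝ}

/-- Exact solutions of the first-order optimality system on the stages `lo ≤ t ≤ hi`, for the
initial state `y`. -/
structure Exact (c : Chain E F) (lo hi : ℕ) (q : ℕ → E) (r : ℕ → F) (d : ℕ → E) (y : E)
    (x : ℕ → E) (u : ℕ → F) (l : ℕ → E) : Prop where
  x_mem : ∀ t, lo ≤ t → t ≤ hi → x t ∈ c.V t
  u_mem : ∀ t, lo ≤ t → t ≤ hi → u t ∈ c.Y t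
  l_mem : ∀ t, lo ≤ t → t ≤ hi → l t ∈ c.V t
  l_end : l (hi + 1) = 0
  init : x lo = y
  dyn : ∀ t, lo ≤ t → t < hi → x (t + 1) = c.A (t + 1) (x t) + c.B (t + 1) (u t) + d (t + 1)
  adj : ∀ t, lo ≤ t → t ≤ hi → ∀ δ ∈ c.V t,
    inner ℝ (c.C t (x t)) (c.C t δ) + inner ℝ (l t) δ
      = inner ℝ (l (t + 1)) (c.A (t + 1) δ) + inner ℝ (q t) δ
  opt : ∀ t, lo ≤ t → t ≤ hi → ∀ δ ∈ c.Y t,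
    inner ℝ (c.R t (u t)) δ = inner ℝ (l (t + 1)) (c.B (t + 1) δ) + inner ℝ (r t) δ

/-- Sequences of states, controls and costates on the stages `lo ≤ t ≤ hi`. -/
def window (c : Chain E F) (lo hi : ℕ) : Submodule ℝ (ℕ → E × F × E) where
  carrier := {z | (∀ t, (z t).1 ∈ c.V t ∧ (z t).2.1 ∈ c.Y t ∧ (z t).2.2 ∈ c.V t) ∧
    ∀ t, t ∉ Finset.Icc lo hi → z t = 0}
  add_mem' := by
    rintro a b ⟨ha, ha'⟩ ⟨hb, hb'⟩
    refine ⟨fun t => ⟨add_mem (ha t).1 (hb t).1, add_mem (ha t).2.1 (hb t).2.1,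
      add_mem (ha t).2.2 (hb t).2.2⟩, fun t ht => ?_⟩
    simp [ha' t ht, hb' t ht]
  zero_mem' := ⟨fun t => ⟨zero_mem _, zero_mem _, zero_mem _⟩, fun t _ => rfl⟩
  smul_mem' := by
    rintro k a ⟨ha, ha'⟩
    refine ⟨fun t => ⟨Submodule.smul_mem _ k (ha t).1, Submodule.smul_mem _ k (ha t).2.1,
      Submodule.smul_mem _ k (ha t).2.2⟩, fun t ht => ?_⟩
    simp [ha' t ht]

instance [FiniteDimensional ℝ E] [FiniteDimensional ℝ F] (c : Chain E F) (lo hi : ℕ) :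
    FiniteDimensional ℝ (c.window lo hi) := by
  let f : c.window lo hi →ₗ[ℝ] (Finset.Icc lo hi → E × F × E) :=
    (LinearMap.funLeft ℝ (E × F × E) (fun i : Finset.Icc lo hi => (i : ℕ))) ∘ₗ
      (c.window lo hi).subtype
  refine FiniteDimensional.of_injective f fun a b hab => ?_
  ext1
  funext t
  by_cases ht : t ∈ Finset.Icc lo hi
  · exact congrFun hab ⟨t, ht⟩
  · rw [a.2.2 t ht, b.2.2 t ht]

/-- The stage `t` part of the bilinear form of the optimality system. -/
def stageForm (c : Chain E F) (lo t : ℕ) (z : ℕ → E × F × E) (v : E × F × E) : ℝ :=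
  inner ℝ (c.C t (z t).1) (c.C t v.1) + inner ℝ (z t).2.2 v.1
    - inner ℝ (z (t + 1)).2.2 (c.A (t + 1) v.1)
    + (inner ℝ (c.R t (z t).2.1) v.2.1 - inner ℝ (z (t + 1)).2.2 (c.B (t + 1) v.2.1))
    + inner ℝ ((z t).1 - if t = lo then 0 else c.A t (z (t - 1)).1 + c.B t (z (t - 1)).2.1) v.2.2

/-- The bilinear form of the optimality system. -/
def form (c : Chain E F) (lo hi : ℕ) : c.window lo hi →ₗ[ℝ] Module.Dual ℝ (c.window lo hi) :=
  LinearMap.mk₂ ℝ (fun z z' => ∑ t ∈ Finset.Icc lo hi, c.stageForm lo t z.1 (z'.1 t))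
    (fun z₁ z₂ z' => by
      rw [← Finset.sum_add_distrib]
      refine Finset.sum_congr rfl fun t _ => ?_
      simp only [stageForm, Submodule.coe_add, Pi.add_apply, Prod.fst_add, Prod.snd_add, map_add,
        inner_add_left, inner_sub_left]
      split_ifs
      · simp only [inner_zero_left]; ring
      · simp only [inner_add_left]; ring)
    (fun k z z' => by
      rw [Finset.smul_sum]
      refine Finset.sum_congr rfl fun t _ => ?_
      simp only [stageForm, Submodule.coe_smul, Pi.smul_apply, Prod.smul_fst, Prod.smul_snd,
        map_smul, inner_smul_left, inner_sub_left, RCLike.conj_to_real, smul_eq_mul]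
      split_ifs
      · simp only [inner_zero_left]; ring
      · simp only [inner_add_left, inner_smul_left, RCLike.conj_to_real]; ring)
    (fun z z₁ z₂ => by
      rw [← Finset.sum_add_distrib]
      refine Finset.sum_congr rfl fun t _ => ?_
      simp only [stageForm, Submodule.coe_add, Pi.add_apply, Prod.fst_add, Prod.snd_add, map_add,
        inner_add_right]
      ring)
    (fun k z z' => by
      rw [Finset.smul_sum]
      refine Finset.sum_congr rfl fun t _ => ?_
      simp only [stageForm, Submodule.coe_smul, Pi.smul_apply, Prod.smul_fst, Prod.smul_snd,
        map_smul, inner_smul_right, smul_eq_mul]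
      ring)

theorem stageForm_zero (c : Chain E F) (lo t : ℕ) (z : ℕ → E × F × E) :
    c.stageForm lo t z 0 = 0 := by
  simp [stageForm]

theorem single_mem_window {t : ℕ} (ht : t ∈ Finset.Icc lo hi) {v : E × F × E} (h1 : v.1 ∈ c.V t)
    (h2 : v.2.1 ∈ c.Y t) (h3 : v.2.2 ∈ c.V t) : Pi.single t v ∈ c.window lo hi := by
  refine ⟨fun s => ?_, fun s hs => ?_⟩
  · by_cases h : s = t
    · subst h
      simpa using ⟨h1, h2, h3⟩
    · simp [Pi.single_eq_of_ne h]
  · exact Pi.single_eq_of_ne (by rintro rfl; exact hs ht) _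

theorem form_single (z : c.window lo hi) {t : ℕ} (ht : t ∈ Finset.Icc lo hi) {v : E × F × E}
    (hv : Pi.single t v ∈ c.window lo hi) :
    c.form lo hi z ⟨Pi.single t v, hv⟩ = c.stageForm lo t z.1 v := by
  change ∑ s ∈ Finset.Icc lo hi, c.stageForm lo s z.1 ((Pi.single t v : ℕ → E × F × E) s) = _
  rw [Finset.sum_eq_single t]
  · simp
  · intro s _ hs
    rw [Pi.single_eq_of_ne hs, stageForm_zero]
  · exact fun h => (h ht).elim

/-- Test vectors supported at one stage show that an element of the kernel satisfies the optimality
system with zero residual, so the a priori estimate annihilates it. -/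
theorem Good.form_injective (hg : c.Good T L α γ) (hle : lo ≤ hi) (hT : hi ≤ T) :
    Function.Injective (c.form lo hi) := by
  rw [injective_iff_map_eq_zero]
  intro z hz
  have key : ∀ t, lo ≤ t → t ≤ hi → ∀ v : E × F × E, v.1 ∈ c.V t → v.2.1 ∈ c.Y t →
      v.2.2 ∈ c.V t → c.stageForm lo t z.1 v = 0 := by
    intro t h1 h2 v hv1 hv2 hv3
    have ht := Finset.mem_Icc.mpr ⟨h1, h2⟩
    have hv := single_mem_window (c := c) ht hv1 hv2 hv3
    rw [← form_single z ht hv, hz]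
    rfl
  have hap : c.Approx lo hi (fun t => (z.1 t).1) (fun t => (z.1 t).2.1) (fun t => (z.1 t).2.2)
      (fun _ => 0) := by
    refine ⟨fun _ => le_rfl, fun t _ _ => (z.2.1 t).1, fun t _ _ => (z.2.1 t).2.1,
      fun t _ _ => (z.2.1 t).2.2, ?_, ?_, ?_, ?_, ?_⟩
    · rw [z.2.2 (hi + 1) (by simp)]
      rfl
    · have := key lo le_rfl hle (0, 0, (z.1 lo).1) (zero_mem _) (zero_mem _) (z.2.1 lo).1
      simp only [stageForm, map_zero, inner_zero_right, if_true, sub_zero, zero_add,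
        inner_self_eq_zero] at this
      simp [this]
    · intro t h1 h2
      have hm : (z.1 (t + 1)).1 - (c.A (t + 1) (z.1 t).1 + c.B (t + 1) (z.1 t).2.1)
          ∈ c.V (t + 1) :=
        sub_mem (z.2.1 _).1 (add_mem (hg.A_map t (by omega) _ (z.2.1 t).1)
          (hg.B_map t (by omega) _ (z.2.1 t).2.1))
      -- The residual of the dynamics is itself an admissible test vector.
      have := key (t + 1) (by omega) h2 (0, 0, _) (zero_mem _) (zero_mem _) hm
      have hne : t + 1 ≠ lo := by omega
      simp only [stageForm, map_zero, inner_zero_right, hne, if_false, sub_zero, zero_add,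
        Nat.add_sub_cancel, inner_self_eq_zero] at this
      simp [this]
    · intro t h1 h2 δ hδ
      have := key t h1 h2 (δ, 0, 0) hδ (zero_mem _) (zero_mem _)
      simp only [stageForm, map_zero, inner_zero_right, sub_zero, add_zero] at this
      simp [this]
    · intro t h1 h2 δ hδ
      have := key t h1 h2 (0, δ, 0) (zero_mem _) hδ (zero_mem _)
      simp only [stageForm, map_zero, inner_zero_right, sub_zero, add_zero, zero_add] at this
      simp [this]
  have hsum := hg.sum_stageSq_le hap hle hT
  simp only [ne_eq, OfNat.ofNat_ne_zero, not_false_eq_true, zero_pow, Finset.sum_const_zero,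
    mul_zero] at hsum
  ext1
  funext t
  by_cases ht : t ∈ Finset.Icc lo hi
  · have h0 := (Finset.single_le_sum (fun t _ => stageSq_nonneg (fun t => (z.1 t).1)
      (fun t => (z.1 t).2.1) (fun t => (z.1 t).2.2) t) ht).trans hsum
    simp only [stageSq] at h0
    have e1 : ‖(z.1 t).1‖ = 0 := by
      nlinarith [sq_nonneg ‖(z.1 t).1‖, sq_nonneg ‖(z.1 t).2.1‖, sq_nonneg ‖(z.1 t).2.2‖]
    have e2 : ‖(z.1 t).2.1‖ = 0 := by
      nlinarith [sq_nonneg ‖(z.1 t).1‖, sq_nonneg ‖(z.1 t).2.1‖, sq_nonneg ‖(z.1 t).2.2‖]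
    have e3 : ‖(z.1 t).2.2‖ = 0 := by
      nlinarith [sq_nonneg ‖(z.1 t).1‖, sq_nonneg ‖(z.1 t).2.1‖, sq_nonneg ‖(z.1 t).2.2‖]
    rw [norm_eq_zero] at e1 e2 e3
    exact Prod.ext e1 (Prod.ext e2 e3)
  · exact z.2.2 t ht

/-- Unknowns and test vectors range over the same finite-dimensional space, so injectivity of `form`
gives surjectivity onto the dual. -/
theorem Good.exists_exact [FiniteDimensional ℝ E] [FiniteDimensional ℝ F]
    (hg : c.Good T L α γ) (hle : lo ≤ hi) (hT : hi ≤ T) (q : ℕ → E) (r : ℕ → F) {d : ℕ → E}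
    (hd : ∀ t, lo < t → t ≤ hi → d t ∈ c.V t) {y : E} (hy : y ∈ c.V lo) :
    ∃ x u l, c.Exact lo hi q r d y x u l := by
  have hsurj : Function.Surjective (c.form lo hi) :=
    (LinearMap.injective_iff_surjective_of_finrank_eq_finrank
      (Subspace.dual_finrank_eq (K := ℝ) (V := c.window lo hi)).symm).mp
      (hg.form_injective hle hT)
  -- At `lo` the initial condition takes the place of the dynamics.
  let b : ℕ → E := fun t => if t = lo then y else d t
  let rhs : Module.Dual ℝ (c.window lo hi) :=
    { toFun := fun z => ∑ t ∈ Finset.Icc lo hi, (inner ℝ (q t) (z.1 t).1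
        + inner ℝ (r t) (z.1 t).2.1 + inner ℝ (b t) (z.1 t).2.2)
      map_add' := fun z z' => by
        rw [← Finset.sum_add_distrib]
        refine Finset.sum_congr rfl fun t _ => ?_
        simp only [Submodule.coe_add, Pi.add_apply, Prod.fst_add, Prod.snd_add, inner_add_right]
        ring
      map_smul' := fun k z => by
        rw [Finset.smul_sum]
        refine Finset.sum_congr rfl fun t _ => ?_
        simp only [Submodule.coe_smul, Pi.smul_apply, Prod.smul_fst, Prod.smul_snd,
          inner_smul_right, smul_eq_mul, RingHom.id_apply]
        ring }
  obtain ⟨z, hz⟩ := hsurj rhs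
  have key : ∀ t, lo ≤ t → t ≤ hi → ∀ v : E × F × E, v.1 ∈ c.V t → v.2.1 ∈ c.Y t →
      v.2.2 ∈ c.V t → c.stageForm lo t z.1 v
        = inner ℝ (q t) v.1 + inner ℝ (r t) v.2.1 + inner ℝ (b t) v.2.2 := by
    intro t h1 h2 v hv1 hv2 hv3
    have ht := Finset.mem_Icc.mpr ⟨h1, h2⟩
    have hv := single_mem_window (c := c) ht hv1 hv2 hv3
    rw [← form_single z ht hv, hz]
    change ∑ s ∈ Finset.Icc lo hi, (inner ℝ (q s) ((Pi.single t v : ℕ → E × F × E) s).1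
      + inner ℝ (r s) ((Pi.single t v : ℕ → E × F × E) s).2.1
      + inner ℝ (b s) ((Pi.single t v : ℕ → E × F × E) s).2.2) = _
    rw [Finset.sum_eq_single t]
    · simp
    · intro s _ hs
      rw [Pi.single_eq_of_ne hs]
      simp
    · exact fun h => (h ht).elim
  refine ⟨fun t => (z.1 t).1, fun t => (z.1 t).2.1, fun t => (z.1 t).2.2,
    fun t _ _ => (z.2.1 t).1, fun t _ _ => (z.2.1 t).2.1, fun t _ _ => (z.2.1 t).2.2,
    ?_, ?_, ?_, ?_, ?_⟩
  · rw [z.2.2 (hi + 1) (by simp)]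
    rfl
  · have := key lo le_rfl hle (0, 0, (z.1 lo).1 - y) (zero_mem _) (zero_mem _)
      (sub_mem (z.2.1 lo).1 hy)
    simp only [stageForm, map_zero, inner_zero_right, if_true, sub_zero, zero_add, b] at this
    rw [← sub_eq_zero, ← inner_sub_left, inner_self_eq_zero] at this
    exact sub_eq_zero.mp this
  · intro t h1 h2
    have hm : (z.1 (t + 1)).1 - (c.A (t + 1) (z.1 t).1 + c.B (t + 1) (z.1 t).2.1) - d (t + 1)
        ∈ c.V (t + 1) :=
      sub_mem (sub_mem (z.2.1 _).1 (add_mem (hg.A_map t (by omega) _ (z.2.1 t).1)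
        (hg.B_map t (by omega) _ (z.2.1 t).2.1))) (hd _ (by omega) h2)
    have := key (t + 1) (by omega) h2 (0, 0, _) (zero_mem _) (zero_mem _) hm
    have hne : t + 1 ≠ lo := by omega
    simp only [stageForm, map_zero, inner_zero_right, hne, if_false, sub_zero, zero_add,
      Nat.add_sub_cancel, b] at this
    rw [← sub_eq_zero, ← inner_sub_left, inner_self_eq_zero] at this
    rw [sub_sub, sub_eq_zero] at this
    exact this
  · intro t h1 h2 δ hδ
    have := key t h1 h2 (δ, 0, 0) hδ (zero_mem _) (zero_mem _)
    simp only [stageForm, map_zero, inner_zero_right, sub_zero, add_zero] at this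
    linarith
  · intro t h1 h2 δ hδ
    have := key t h1 h2 (0, δ, 0) (zero_mem _) hδ (zero_mem _)
    simp only [stageForm, map_zero, inner_zero_right, sub_zero, add_zero, zero_add] at this
    linarith

/-- First-order optimality: the derivative of the objective vanishes in all feasible directions. -/
theorem Exact.sum_eq_zero {q d : ℕ → E} {r : ℕ → F} {y : E} {x l : ℕ → E} {u : ℕ → F}
    (h : c.Exact lo hi q r d y x u l) (hle : lo ≤ hi) {δx : ℕ → E} {δu : ℕ → F}
    (hx : ∀ t, lo ≤ t → t ≤ hi → δx t ∈ c.V t) (hu : ∀ t, lo ≤ t → t ≤ hi → δu t ∈ c.Y t)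
    (h0 : δx lo = 0)
    (hs : ∀ t, lo ≤ t → t < hi → δx (t + 1) = c.A (t + 1) (δx t) + c.B (t + 1) (δu t)) :
    ∑ t ∈ Finset.Icc lo hi, (inner ℝ (c.C t (x t)) (c.C t (δx t)) - inner ℝ (q t) (δx t)
      + (inner ℝ (c.R t (u t)) (δu t) - inner ℝ (r t) (δu t))) = 0 := by
  have key : ∀ m, lo ≤ m → m ≤ hi →
      ∑ t ∈ Finset.Icc lo m, (inner ℝ (c.C t (x t)) (c.C t (δx t)) - inner ℝ (q t) (δx t)
        + (inner ℝ (c.R t (u t)) (δu t) - inner ℝ (r t) (δu t)))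
      = inner ℝ (l (m + 1)) (c.A (m + 1) (δx m) + c.B (m + 1) (δu m)) := by
    intro m hm
    induction m, hm using Nat.le_induction with
    | base =>
      intro _
      have h1 := h.adj lo le_rfl hle _ (hx lo le_rfl hle)
      have h2 := h.opt lo le_rfl hle _ (hu lo le_rfl hle)
      rw [Finset.Icc_self, Finset.sum_singleton, inner_add_right]
      rw [h0] at h1 ⊢
      rw [inner_zero_right (l lo)] at h1
      linarith
    | succ m hm ih =>
      intro hmh
      have h1 := h.adj (m + 1) (by omega) hmh _ (hx _ (by omega) hmh)
      have h2 := h.opt (m + 1) (by omega) hmh _ (hu _ (by omega) hmh)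
      rw [Finset.sum_Icc_succ_top (by omega), ih (by omega), inner_add_right (l (m + 1 + 1)),
        ← hs m hm (by omega)]
      linarith
  rw [key hi hle le_rfl, h.l_end, inner_zero_left]

end Chain

/-! ### Sums of two-sided geometric kernels. -/

theorem geom_sum_le {σ : ℝ} (h0 : 0 ≤ σ) (h1 : σ < 1) (n : ℕ) :
    ∑ i ∈ Finset.range n, σ ^ i ≤ 1 / (1 - σ) := by
  have := (summable_geometric_of_lt_one h0 h1).sum_le_tsum (Finset.range n)
    (fun i _ => pow_nonneg h0 i)
  rwa [tsum_geometric_of_lt_one h0 h1, ← one_div] at this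

theorem sum_pow_dist_le {σ : ℝ} (h0 : 0 ≤ σ) (h1 : σ < 1) (s n : ℕ) :
    ∑ t ∈ Finset.range n, σ ^ Nat.dist s t ≤ 2 / (1 - σ) := by
  have e1 : ∑ t ∈ Finset.range n, σ ^ Nat.dist s t
      ≤ ∑ t ∈ Finset.range (s + 1 + n), σ ^ Nat.dist s t :=
    Finset.sum_le_sum_of_subset_of_nonneg
      (fun t ht => by simp only [Finset.mem_range] at ht ⊢; omega) (fun t _ _ => pow_nonneg h0 _)
  have e2 : ∑ t ∈ Finset.range (s + 1), σ ^ Nat.dist s t ≤ 1 / (1 - σ) := by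
    rw [← Finset.sum_range_reflect]
    refine le_trans (le_of_eq (Finset.sum_congr rfl fun t ht => ?_)) (geom_sum_le h0 h1 (s + 1))
    congr 1
    have := Finset.mem_range.mp ht
    unfold Nat.dist
    omega
  have e3 : ∑ t ∈ Finset.range n, σ ^ Nat.dist s (s + 1 + t) ≤ 1 / (1 - σ) := by
    refine le_trans (Finset.sum_le_sum fun t ht => ?_) (geom_sum_le h0 h1 n)
    refine pow_le_pow_of_le_one h0 h1.le ?_
    unfold Nat.dist
    omega
  rw [Finset.sum_range_add] at e1
  have : 2 / (1 - σ) = 1 / (1 - σ) + 1 / (1 - σ) := by ring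
  linarith

/-- By the triangle inequality `|k - t| + |s - k| ≥ |s - t|`, one of the two factors `σ ^ |s - k|`
is spent on the weight `σ ^ |s - t|`, and the other makes the sum over `k` converge. This is where
the rate drops from `σ ^ 2` to `σ`. -/
theorem sum_pow_dist_convolution_le {σ : ℝ} (h0 : 0 ≤ σ) (h1 : σ < 1) {P : ℕ → ℝ}
    (hP : ∀ s, 0 ≤ P s) (t n : ℕ) :
    ∑ k ∈ Finset.range n, σ ^ Nat.dist k t * ∑ s ∈ Finset.range n, (σ ^ 2) ^ Nat.dist s k * P s
      ≤ 2 / (1 - σ) * ∑ s ∈ Finset.range n, σ ^ Nat.dist s t * P s := by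
  simp only [Finset.mul_sum]
  rw [Finset.sum_comm]
  refine Finset.sum_le_sum fun s _ => ?_
  calc ∑ k ∈ Finset.range n, σ ^ Nat.dist k t * ((σ ^ 2) ^ Nat.dist s k * P s)
      ≤ ∑ k ∈ Finset.range n, σ ^ Nat.dist s k * (σ ^ Nat.dist s t * P s) := by
        refine Finset.sum_le_sum fun k _ => ?_
        rw [← mul_assoc, ← mul_assoc, ← pow_mul, ← pow_add, ← pow_add]
        refine mul_le_mul_of_nonneg_right (pow_le_pow_of_le_one h0 h1.le ?_) (hP s)
        unfold Nat.dist
        omega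
    _ = (∑ k ∈ Finset.range n, σ ^ Nat.dist s k) * (σ ^ Nat.dist s t * P s) := by
        rw [Finset.sum_mul]
    _ ≤ _ := mul_le_mul_of_nonneg_right (sum_pow_dist_le h0 h1 s n)
        (mul_nonneg (pow_nonneg h0 _) (hP s))

theorem norm_costate_le {E F : Type*} [NormedAddCommGroup E] [NormedAddCommGroup F]
    (x l : ℕ → E) (u : ℕ → F) (t : ℕ) : ‖l t‖ ≤ √(stageSq x u l t) := by
  refine Real.le_sqrt_of_sq_le ?_
  unfold stageSq
  nlinarith [sq_nonneg ‖x t‖, sq_nonneg ‖u t‖]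

/-! ### Receding-horizon control. -/

namespace Chain

variable {E F : Type*} [NormedAddCommGroup E] [InnerProductSpace ℝ E]
    [NormedAddCommGroup F] [InnerProductSpace ℝ F]

variable {c : Chain E F} {T lo hi : ℕ} {L α γ : ℝ}

/-- Data of the problem count as residuals, so the estimates for approximate solutions apply to
exact ones. -/
theorem Exact.approx {q d : ℕ → E} {r : ℕ → F} {y : E} {x l : ℕ → E} {u : ℕ → F} {e : ℕ → ℝ}
    (h : c.Exact lo hi q r d y x u l) (he : ∀ t, 0 ≤ e t) (hy : ‖y‖ ≤ e lo)
    (hq : ∀ t, lo ≤ t → t ≤ hi → ‖q t‖ ≤ e t) (hr : ∀ t, lo ≤ t → t ≤ hi → ‖r t‖ ≤ e t)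
    (hd : ∀ t, lo < t → t ≤ hi → ‖d t‖ ≤ e t) : c.Approx lo hi x u l e := by
  refine ⟨he, h.x_mem, h.u_mem, h.l_mem, h.l_end, h.init ▸ hy, ?_, ?_, ?_⟩
  · intro t h1 h2
    rw [h.dyn t h1 h2, add_sub_cancel_left]
    exact hd _ (by omega) h2
  · intro t h1 h2 δ hδ
    rw [h.adj t h1 h2 δ hδ, add_sub_cancel_left]
    exact (abs_real_inner_le_norm _ _).trans
      (mul_le_mul_of_nonneg_right (hq t h1 h2) (norm_nonneg _))
  · intro t h1 h2 δ hδ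
    rw [h.opt t h1 h2 δ hδ, add_sub_cancel_left]
    exact (abs_real_inner_le_norm _ _).trans
      (mul_le_mul_of_nonneg_right (hr t h1 h2) (norm_nonneg _))

/-- Two exact solutions on overlapping windows whose first stages agree: the costates differ by an
amount that decays exponentially in the distance to the end of the first window. -/
theorem Good.norm_costate_sub_le (hg : c.Good T L α γ) {q d : ℕ → E} {r : ℕ → F} {y y' : E}
    {x l x' l' : ℕ → E} {u u' : ℕ → F} {t hi hi' : ℕ}
    (h : c.Exact t hi q r d y x u l) (h' : c.Exact (t + 1) hi' q r d y' x' u' l')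
    (hy : y' = c.A (t + 1) (x t) + c.B (t + 1) (u t) + d (t + 1))
    (ht : t + 1 ≤ hi) (hh : hi ≤ hi') (hT : hi' ≤ T) {ρ : ℝ} (hρ0 : 0 < ρ) (hρ1 : ρ ≤ 1)
    (hρ : 5 * gain L α γ * (L * (1 / ρ - 1)) ≤ 1) :
    ‖l' (t + 1) - l (t + 1)‖ ≤
      4 * gain L α γ * (ρ ^ (hi - (t + 1)) * (L * ‖l' (hi + 1)‖)) := by
  have hL : 0 ≤ L := by linarith [hg.one_le_L]
  have end_A : ∀ δ, |inner ℝ (l' (hi + 1)) (c.A (hi + 1) δ)| ≤ L * ‖l' (hi + 1)‖ * ‖δ‖ := by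
    intro δ
    rcases hh.eq_or_lt with h3 | h3
    · rw [h3, h'.l_end]; simp
    · have h4 := abs_real_inner_le_norm (l' (hi + 1)) (c.A (hi + 1) δ)
      have h5 := mul_le_mul_of_nonneg_left (hg.A_bdd (hi + 1) (by omega) δ)
        (norm_nonneg (l' (hi + 1)))
      linarith
  have end_B : ∀ δ, |inner ℝ (l' (hi + 1)) (c.B (hi + 1) δ)| ≤ L * ‖l' (hi + 1)‖ * ‖δ‖ := by
    intro δ
    rcases hh.eq_or_lt with h3 | h3
    · rw [h3, h'.l_end]; simp
    · have h4 := abs_real_inner_le_norm (l' (hi + 1)) (c.B (hi + 1) δ)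
      have h5 := mul_le_mul_of_nonneg_left (hg.B_bdd (hi + 1) (by omega) δ)
        (norm_nonneg (l' (hi + 1)))
      linarith
  -- The difference solves the homogeneous system from initial state zero. Cutting its costate off
  -- past `hi` creates the only residual, at stage `hi`, from the costate that the shorter window
  -- ignores.
  have hap : c.Approx (t + 1) hi (fun s => x' s - x s) (fun s => u' s - u s)
      (fun s => if s ≤ hi then l' s - l s else 0)
      (fun s => if s = hi then L * ‖l' (hi + 1)‖ else 0) := by
    constructor
    · intro s
      split_ifs
      · positivity
      · exact le_rfl
    · exact fun s h1 h2 => sub_mem (h'.x_mem s h1 (by omega)) (h.x_mem s (by omega) h2)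
    · exact fun s h1 h2 => sub_mem (h'.u_mem s h1 (by omega)) (h.u_mem s (by omega) h2)
    · intro s h1 h2
      rw [if_pos h2]
      exact sub_mem (h'.l_mem s h1 (by omega)) (h.l_mem s (by omega) h2)
    · rw [if_neg (by omega)]
    · rw [h'.init, hy, h.dyn t le_rfl ht, sub_self, norm_zero]
      split_ifs
      · positivity
      · exact le_rfl
    · intro s h1 h2
      rw [h'.dyn s h1 (by omega), h.dyn s (by omega) h2, map_sub, map_sub]
      have : c.A (s + 1) (x' s) + c.B (s + 1) (u' s) + d (s + 1)
          - (c.A (s + 1) (x s) + c.B (s + 1) (u s) + d (s + 1))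
          - (c.A (s + 1) (x' s) - c.A (s + 1) (x s) + (c.B (s + 1) (u' s) - c.B (s + 1) (u s)))
          = 0 := by abel
      rw [this, norm_zero]
      split_ifs
      · positivity
      · exact le_rfl
    · intro s h1 h2 δ hδ
      have a1 := h'.adj s h1 (by omega) δ hδ
      have a2 := h.adj s (by omega) h2 δ hδ
      rw [if_pos h2, map_sub, inner_sub_left, inner_sub_left]
      rcases h2.eq_or_lt with h3 | h3
      · subst h3
        rw [if_neg (by omega), if_pos rfl, inner_zero_left, sub_zero]
        rw [h.l_end, inner_zero_left] at a2
        convert end_A δ using 2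
        linarith
      · rw [if_pos (by omega), if_neg (by omega), inner_sub_left, zero_mul]
        refine le_of_eq (abs_eq_zero.mpr ?_)
        linarith
    · intro s h1 h2 δ hδ
      have a1 := h'.opt s h1 (by omega) δ hδ
      have a2 := h.opt s (by omega) h2 δ hδ
      rw [map_sub, inner_sub_left]
      rcases h2.eq_or_lt with h3 | h3
      · subst h3
        rw [if_neg (by omega), if_pos rfl, inner_zero_left, sub_zero]
        rw [h.l_end, inner_zero_left] at a2
        convert end_B δ using 2
        linarith
      · rw [if_pos (by omega), if_neg (by omega), inner_sub_left, zero_mul]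
        refine le_of_eq (abs_eq_zero.mpr ?_)
        linarith
  have := hg.sqrt_stageSq_le hap (by omega) hρ0 hρ1 hρ le_rfl (by simp) hap.nonneg
    (fun s _ _ => by simp) le_rfl ht
  have h2 := (norm_costate_le _ _ _ _).trans this
  rw [if_pos ht] at h2
  refine h2.trans (le_of_eq ?_)
  congr 1
  rw [Finset.sum_eq_single hi]
  · rw [if_pos rfl]
    congr 2
    unfold Nat.dist
    omega
  · intro s _ hs
    rw [if_neg hs, mul_zero]
  · intro hs
    exact (hs (Finset.mem_Icc.mpr ⟨ht, le_rfl⟩)).elim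

/-- The end-of-window costate of an exact solution decays in the initial state. -/
theorem Good.norm_end_costate_le (hg : c.Good T L α γ) {q d : ℕ → E} {r : ℕ → F} {y : E}
    {x l : ℕ → E} {u : ℕ → F} {P : ℕ → ℝ} {b : ℝ}
    (h : c.Exact lo hi q r d y x u l) (hle : lo ≤ hi) (hT : hi ≤ T)
    (hP : ∀ t, 0 ≤ P t) (hb : 0 ≤ b) (hy : ‖y‖ ≤ b + P lo)
    (hq : ∀ t ≤ T, ‖q t‖ ≤ P t) (hr : ∀ t ≤ T, ‖r t‖ ≤ P t) (hd : ∀ t ≤ T, ‖d t‖ ≤ P t)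
    {ρ : ℝ} (hρ0 : 0 < ρ) (hρ1 : ρ ≤ 1) (hρ : 5 * gain L α γ * (L * (1 / ρ - 1)) ≤ 1) :
    ‖l hi‖ ≤ 4 * gain L α γ *
      (ρ ^ (hi - lo) * b + ∑ s ∈ Finset.Icc lo hi, ρ ^ (hi - s) * P s) := by
  have hP' : ∀ t, P t ≤ P t + if t = lo then b else 0 := by
    intro t
    split_ifs <;> linarith
  have hap : c.Approx lo hi x u l (fun t => P t + if t = lo then b else 0) := by
    refine h.approx (fun t => (hP t).trans (hP' t)) ?_
      (fun t _ h2 => (hq t (by omega)).trans (hP' t))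
      (fun t _ h2 => (hr t (by omega)).trans (hP' t))
      (fun t _ h2 => (hd t (by omega)).trans (hP' t))
    rw [if_pos rfl]
    linarith
  have := hg.sqrt_stageSq_le hap hT hρ0 hρ1 hρ le_rfl (by simp) hap.nonneg
    (fun s _ _ => by simp) hle le_rfl
  refine ((norm_costate_le _ _ _ _).trans this).trans (le_of_eq ?_)
  congr 1
  simp only [mul_add, Finset.sum_add_distrib]
  rw [add_comm]
  congr 1
  · rw [Finset.sum_eq_single lo]
    · rw [if_pos rfl]
      congr 2
      unfold Nat.dist
      omega
    · intro s _ hs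
      rw [if_neg hs, mul_zero]
    · intro hs
      exact (hs (Finset.mem_Icc.mpr ⟨le_rfl, hle⟩)).elim
  · refine Finset.sum_congr rfl fun s hs => ?_
    have := Finset.mem_Icc.mp hs
    congr 2
    unfold Nat.dist
    omega

/-- Receding-horizon control: if `(X t, U t)` is the first stage of the solution of the optimality
system on `t, …, min (t + W) T` started from `(X (t - 1), U (t - 1))`, then the closed loop is
exponentially stable with respect to the data. -/
theorem Good.closed_loop_le (hg : c.Good T L α γ) {W : ℕ} (hW1 : 1 ≤ W)
    {q d : ℕ → E} {r : ℕ → F} {P : ℕ → ℝ} (hP : ∀ t, 0 ≤ P t)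
    (hq : ∀ t ≤ T, ‖q t‖ ≤ P t) (hr : ∀ t ≤ T, ‖r t‖ ≤ P t) (hd : ∀ t ≤ T, ‖d t‖ ≤ P t)
    {y₀ : E} {b : ℝ} (hb : 0 ≤ b) (hy₀ : ‖y₀‖ ≤ b + P 0) {X : ℕ → E} {U : ℕ → F}
    (hXU : ∀ t ≤ T, ∃ x u l, c.Exact t (min (t + W) T) q r d
      (if t = 0 then y₀ else c.A t (X (t - 1)) + c.B t (U (t - 1)) + d t) x u l ∧
      x t = X t ∧ u t = U t)
    {σ : ℝ} (hσ0 : 0 < σ) (hσ1 : σ < 1)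
    (hσ : 5 * gain L α γ * (L * (1 / σ ^ 2 - 1)) ≤ 1)
    (hσW : 5 * gain L α γ * (32 * gain L α γ ^ 2 * L ^ 3 * (σ ^ 2) ^ (2 * W - 1)) ≤ 1)
    {t : ℕ} (ht : t ≤ T) :
    √(‖X t‖ ^ 2 + ‖U t‖ ^ 2) ≤ 4 * gain L α γ * (σ ^ t * b +
      (1 + 32 * gain L α γ ^ 2 * L ^ 2 / (σ ^ 4 * (1 - σ))) *
        ∑ s ∈ Finset.range (T + 1), σ ^ Nat.dist s t * P s) := by
  have hL1 := hg.one_le_L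
  have hL : 0 ≤ L := by linarith
  have hG := gain_nonneg (α := α) hg.γ_pos hg.one_le_L
  set G := gain L α γ with hGdef
  set ρ := σ ^ 2 with hρdef
  have hρ0 : 0 < ρ := by positivity
  have hρ1 : ρ ≤ 1 := pow_le_one₀ hσ0.le hσ1.le
  have hρσ : ρ ≤ σ := by rw [hρdef, sq]; nlinarith
  -- Here `x t`, `u t`, `l t` are entire solutions on the window starting at `t`; `Λ` keeps the
  -- first costate of each.
  choose! x u l hex hxX huU using hXU
  set Λ : ℕ → E := fun t => if t ≤ T then l t t else 0 with hΛ
  set m : ℕ → ℝ := fun t => √(stageSq X U Λ t) with hm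
  have hm0 : ∀ t, 0 ≤ m t := fun t => Real.sqrt_nonneg _
  have hXm : ∀ t, ‖X t‖ ≤ m t := fun t => by
    refine Real.le_sqrt_of_sq_le ?_
    unfold stageSq
    nlinarith [sq_nonneg ‖U t‖, sq_nonneg ‖Λ t‖]
  have hUm : ∀ t, ‖U t‖ ≤ m t := fun t => by
    refine Real.le_sqrt_of_sq_le ?_
    unfold stageSq
    nlinarith [sq_nonneg ‖X t‖, sq_nonneg ‖Λ t‖]
  set S : ℕ → ℝ := fun t => ∑ s ∈ Finset.range (T + 1), ρ ^ Nat.dist s t * P s with hS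
  have hS0 : ∀ t, 0 ≤ S t := fun t => Finset.sum_nonneg fun s _ => mul_nonneg (by positivity) (hP s)
  -- Two decay estimates are composed: back from the end of window `t`, with factor `ρ ^ (W - 1)`,
  -- and along window `t + 1` from its initial state to its end, with factor `ρ ^ W`.
  have jump : ∀ t, t < T → ‖l (t + 1) (t + 1) - l t (t + 1)‖
      ≤ 16 * G ^ 2 * L * (2 * L * ρ ^ (2 * W - 1) * m t + S t / ρ ^ 2) := by
    intro t ht
    have hy : (if t + 1 = 0 then y₀ else c.A (t + 1) (X (t + 1 - 1))
        + c.B (t + 1) (U (t + 1 - 1)) + d (t + 1))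
        = c.A (t + 1) (x t t) + c.B (t + 1) (u t t) + d (t + 1) := by
      rw [if_neg (by omega), Nat.add_sub_cancel, hxX t ht.le, huU t ht.le]
    have j1 := hg.norm_costate_sub_le (hex t ht.le) (hex (t + 1) ht) hy
      (by omega) (by omega) (by omega) hρ0 hρ1 hσ
    -- If window `t` already reaches `T`, both windows end there and the costate beyond is zero: no
    -- jump.
    rcases le_or_gt T (t + W) with h1 | h1
    · have e1 : min (t + W) T = min (t + 1 + W) T := by omega
      rw [e1, (hex (t + 1) ht).l_end, norm_zero, mul_zero, mul_zero, mul_zero] at j1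
      refine j1.trans ?_
      have := hS0 t
      have := hm0 t
      positivity
    · have e1 : min (t + W) T = t + W := by omega
      have e2 : min (t + 1 + W) T = t + W + 1 := by omega
      have hnew := hex (t + 1) ht
      rw [e2] at hnew
      rw [e1] at j1
      have hy2 : ‖if t + 1 = 0 then y₀ else c.A (t + 1) (X (t + 1 - 1))
          + c.B (t + 1) (U (t + 1 - 1)) + d (t + 1)‖ ≤ 2 * L * m t + P (t + 1) := by
        rw [if_neg (by omega), Nat.add_sub_cancel]
        refine norm_add₃_le.trans ?_
        have a1 := hg.A_bdd (t + 1) ht (X t)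
        have a2 := hg.B_bdd (t + 1) ht (U t)
        have a3 := mul_le_mul_of_nonneg_left (hXm t) hL
        have a4 := mul_le_mul_of_nonneg_left (hUm t) hL
        have a5 := hd (t + 1) ht
        linarith
      have j2 := hg.norm_end_costate_le hnew (by omega) (by omega) hP
        (mul_nonneg (mul_nonneg two_pos.le hL) (hm0 t)) hy2 hq hr hd hρ0 hρ1 hσ
      have e3 : t + W + 1 - (t + 1) = W := by omega
      have e4 : t + W - (t + 1) = W - 1 := by omega
      rw [e3] at j2
      rw [e4] at j1
      -- After multiplication by `ρ ^ 2` the exponent is `2 * W + 2 - (s - t)`, which is at least `s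
      -- - t` because `s ≤ t + W + 1`.
      have j3 : ρ ^ (W - 1) * ∑ s ∈ Finset.Icc (t + 1) (t + W + 1), ρ ^ (t + W + 1 - s) * P s
          ≤ S t / ρ ^ 2 := by
        rw [le_div_iff₀ (by positivity), Finset.mul_sum, Finset.sum_mul]
        refine le_trans ?_ (Finset.sum_le_sum_of_subset_of_nonneg
          (s := Finset.Icc (t + 1) (t + W + 1)) ?_ ?_)
        · refine Finset.sum_le_sum fun s hs => ?_
          have hs := Finset.mem_Icc.mp hs
          calc ρ ^ (W - 1) * (ρ ^ (t + W + 1 - s) * P s) * ρ ^ 2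
              = ρ ^ (W - 1 + (t + W + 1 - s) + 2) * P s := by rw [pow_add, pow_add]; ring
            _ ≤ ρ ^ Nat.dist s t * P s := by
              refine mul_le_mul_of_nonneg_right (pow_le_pow_of_le_one hρ0.le hρ1 ?_) (hP s)
              unfold Nat.dist
              omega
        · intro s hs
          have hs := Finset.mem_Icc.mp hs
          exact Finset.mem_range.mpr (by omega)
        · exact fun s _ _ => mul_nonneg (by positivity) (hP s)
      have e5 : ρ ^ (2 * W - 1) = ρ ^ (W - 1) * ρ ^ W := by
        rw [← pow_add]; congr 1; omega
      calc _ ≤ _ := j1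
        _ ≤ 4 * G * (ρ ^ (W - 1) * (L * (4 * G * (ρ ^ W * (2 * L * m t)
            + ∑ s ∈ Finset.Icc (t + 1) (t + W + 1), ρ ^ (t + W + 1 - s) * P s)))) := by
          gcongr
        _ = 16 * G ^ 2 * L * (2 * L * (ρ ^ (W - 1) * ρ ^ W) * m t + ρ ^ (W - 1) *
            ∑ s ∈ Finset.Icc (t + 1) (t + W + 1), ρ ^ (t + W + 1 - s) * P s) := by ring
        _ ≤ _ := by
          rw [e5]
          gcongr
  set e : ℕ → ℝ := fun t => L * (if t < T then ‖l (t + 1) (t + 1) - l t (t + 1)‖ else 0)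
    + (P t + if t = 0 then b else 0) with he
  have hjump0 : ∀ t, 0 ≤ if t < T then ‖l (t + 1) (t + 1) - l t (t + 1)‖ else 0 := fun t => by
    split_ifs <;> simp
  have hPb : ∀ t, P t ≤ P t + if t = 0 then b else 0 := fun t => by
    split_ifs <;> linarith
  have hPe : ∀ t, P t ≤ e t := fun t => by
    have := mul_nonneg hL (hjump0 t)
    linarith [hPb t]
  have hstart : ∀ t ≤ T, X t = if t = 0 then y₀ else
      c.A t (X (t - 1)) + c.B t (U (t - 1)) + d t := fun t ht => by
    rw [← hxX t ht]
    exact (hex t ht).init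
  have hjA : ∀ t ≤ T, ∀ δ, |inner ℝ (l t (t + 1)) (c.A (t + 1) δ)
      - inner ℝ (Λ (t + 1)) (c.A (t + 1) δ)| ≤
      L * (if t < T then ‖l (t + 1) (t + 1) - l t (t + 1)‖ else 0) * ‖δ‖ := by
    intro t ht δ
    rw [← inner_sub_left]
    rcases ht.eq_or_lt with h3 | h3
    · have := (hex t ht).l_end
      rw [show min (t + W) T = t by omega] at this
      rw [this, hΛ]
      simp [show ¬ (t + 1 ≤ T) by omega, show ¬ (t < T) by omega]
    · rw [if_pos h3, hΛ]
      simp only [show t + 1 ≤ T from h3, if_true]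
      rw [norm_sub_rev]
      have a1 := abs_real_inner_le_norm (l t (t + 1) - l (t + 1) (t + 1)) (c.A (t + 1) δ)
      have a2 := mul_le_mul_of_nonneg_left (hg.A_bdd (t + 1) h3 δ)
        (norm_nonneg (l t (t + 1) - l (t + 1) (t + 1)))
      linarith
  have hjB : ∀ t ≤ T, ∀ δ, |inner ℝ (l t (t + 1)) (c.B (t + 1) δ)
      - inner ℝ (Λ (t + 1)) (c.B (t + 1) δ)| ≤
      L * (if t < T then ‖l (t + 1) (t + 1) - l t (t + 1)‖ else 0) * ‖δ‖ := by
    intro t ht δ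
    rw [← inner_sub_left]
    rcases ht.eq_or_lt with h3 | h3
    · have := (hex t ht).l_end
      rw [show min (t + W) T = t by omega] at this
      rw [this, hΛ]
      simp [show ¬ (t + 1 ≤ T) by omega, show ¬ (t < T) by omega]
    · rw [if_pos h3, hΛ]
      simp only [show t + 1 ≤ T from h3, if_true]
      rw [norm_sub_rev]
      have a1 := abs_real_inner_le_norm (l t (t + 1) - l (t + 1) (t + 1)) (c.B (t + 1) δ)
      have a2 := mul_le_mul_of_nonneg_left (hg.B_bdd (t + 1) h3 δ)
        (norm_nonneg (l t (t + 1) - l (t + 1) (t + 1)))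
      linarith
  have hΛt : ∀ t ≤ T, Λ t = l t t := fun t ht => by simp [hΛ, ht]
  -- The closed loop satisfies the dynamics up to the data alone; the jump enters only through the
  -- adjoint and stationarity equations.
  have hap : c.Approx 0 T X U Λ e := by
    constructor
    · exact fun t => (hP t).trans (hPe t)
    · exact fun t _ h2 => hxX t h2 ▸ (hex t h2).x_mem t le_rfl (by omega)
    · exact fun t _ h2 => huU t h2 ▸ (hex t h2).u_mem t le_rfl (by omega)
    · exact fun t _ h2 => hΛt t h2 ▸ (hex t h2).l_mem t le_rfl (by omega)
    · simp [hΛ]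
    · rw [hstart 0 (Nat.zero_le _), if_pos rfl]
      have := mul_nonneg hL (hjump0 0)
      simp only [he, if_true]
      linarith
    · intro t _ h2
      rw [hstart (t + 1) h2, if_neg (by omega), Nat.add_sub_cancel, add_sub_cancel_left]
      exact (hd _ h2).trans (hPe _)
    · intro t _ h2 δ hδ
      have a1 := (hex t h2).adj t le_rfl (by omega) δ hδ
      rw [hxX t h2] at a1
      rw [hΛt t h2, a1]
      have a2 := hjA t h2 δ
      have a3 := (abs_real_inner_le_norm (q t) δ).trans
        (mul_le_mul_of_nonneg_right ((hq t h2).trans (hPb t)) (norm_nonneg _))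
      refine le_trans (le_trans (le_of_eq ?_) (abs_add_le _ _)) ((add_le_add a2 a3).trans ?_)
      · congr 1; ring
      · exact le_of_eq (by simp only [he]; ring)
    · intro t _ h2 δ hδ
      have a1 := (hex t h2).opt t le_rfl (by omega) δ hδ
      rw [huU t h2] at a1
      rw [a1]
      have a2 := hjB t h2 δ
      have a3 := (abs_real_inner_le_norm (r t) δ).trans
        (mul_le_mul_of_nonneg_right ((hr t h2).trans (hPb t)) (norm_nonneg _))
      refine le_trans (le_trans (le_of_eq ?_) (abs_add_le _ _)) ((add_le_add a2 a3).trans ?_)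
      · congr 1; ring
      · exact le_of_eq (by simp only [he]; ring)
  set g : ℕ → ℝ := fun t =>
    16 * G ^ 2 * L ^ 2 / ρ ^ 2 * S t + (P t + if t = 0 then b else 0) with hgd
  have hg0 : ∀ t, 0 ≤ g t := fun t => by
    have := hS0 t
    have := (hP t).trans (hPb t)
    positivity
  -- The error splits into a small multiple of the current stage, absorbed by the decay estimate,
  -- and the data.
  have heg : ∀ t, 0 ≤ t → t ≤ T →
      e t ≤ 32 * G ^ 2 * L ^ 3 * ρ ^ (2 * W - 1) * √(stageSq X U Λ t) + g t := by
    intro t _ h2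
    change e t ≤ 32 * G ^ 2 * L ^ 3 * ρ ^ (2 * W - 1) * m t + g t
    simp only [he, hgd]
    have := hm0 t
    have := hS0 t
    split_ifs with h3
    · have j := mul_le_mul_of_nonneg_left (jump t h3) hL
      have : L * (16 * G ^ 2 * L * (2 * L * ρ ^ (2 * W - 1) * m t + S t / ρ ^ 2))
        = 32 * G ^ 2 * L ^ 3 * ρ ^ (2 * W - 1) * m t + 16 * G ^ 2 * L ^ 2 / ρ ^ 2 * S t := by
        ring
      linarith
    · have j := mul_le_mul_of_nonneg_left (jump t h3) hL
      have : L * (16 * G ^ 2 * L * (2 * L * ρ ^ (2 * W - 1) * m t + S t / ρ ^ 2))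
        = 32 * G ^ 2 * L ^ 3 * ρ ^ (2 * W - 1) * m t + 16 * G ^ 2 * L ^ 2 / ρ ^ 2 * S t := by
        ring
      linarith
    · have : 0 ≤ 32 * G ^ 2 * L ^ 3 * ρ ^ (2 * W - 1) * m t + 16 * G ^ 2 * L ^ 2 / ρ ^ 2 * S t := by
        positivity
      linarith
    · have : 0 ≤ 32 * G ^ 2 * L ^ 3 * ρ ^ (2 * W - 1) * m t + 16 * G ^ 2 * L ^ 2 / ρ ^ 2 * S t := by
        positivity
      linarith
  -- Decay is used with the slower rate `σ`, where `σ ^ 2 = ρ`, leaving room for the convolution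
  -- with `S`.
  have hσ' : 5 * G * (L * (1 / σ - 1)) ≤ 1 := by
    refine le_trans ?_ hσ
    have : 1 / σ ≤ 1 / ρ := one_div_le_one_div_of_le hρ0 hρσ
    gcongr
  have main := hg.sqrt_stageSq_le hap le_rfl hσ0 hσ1.le hσ' (by positivity) hσW hg0 heg
    (Nat.zero_le t) ht
  have hleft : √(‖X t‖ ^ 2 + ‖U t‖ ^ 2) ≤ √(stageSq X U Λ t) := by
    refine Real.sqrt_le_sqrt ?_
    unfold stageSq
    linarith [sq_nonneg ‖Λ t‖]
  refine (hleft.trans main).trans (mul_le_mul_of_nonneg_left ?_ (by positivity))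
  have hIcc : Finset.Icc 0 T = Finset.range (T + 1) := by
    ext s; simp
  rw [hIcc]
  simp only [hgd, mul_add, Finset.sum_add_distrib]
  have f1 : ∑ s ∈ Finset.range (T + 1), σ ^ Nat.dist s t * (if s = 0 then b else 0) =
      σ ^ t * b := by
    rw [Finset.sum_eq_single 0]
    · rw [if_pos rfl]
      congr 2
      unfold Nat.dist
      omega
    · intro s _ hs
      rw [if_neg hs, mul_zero]
    · simp
  have f2 := sum_pow_dist_convolution_le hσ0.le hσ1 hP t (T + 1)
  have f3 : ∑ s ∈ Finset.range (T + 1), σ ^ Nat.dist s t * (16 * G ^ 2 * L ^ 2 / ρ ^ 2 * S s)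
      = 16 * G ^ 2 * L ^ 2 / ρ ^ 2 * ∑ s ∈ Finset.range (T + 1), σ ^ Nat.dist s t * S s := by
    rw [Finset.mul_sum]
    exact Finset.sum_congr rfl fun s _ => by ring
  have f4 := mul_le_mul_of_nonneg_left f2 (by positivity : 0 ≤ 16 * G ^ 2 * L ^ 2 / ρ ^ 2)
  rw [f1, f3]
  have f5 : 16 * G ^ 2 * L ^ 2 / ρ ^ 2 * (2 / (1 - σ) *
      ∑ s ∈ Finset.range (T + 1), σ ^ Nat.dist s t * P s)
      = 32 * G ^ 2 * L ^ 2 / (σ ^ 4 * (1 - σ)) *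
      ∑ s ∈ Finset.range (T + 1), σ ^ Nat.dist s t * P s := by
    have : 1 - σ ≠ 0 := by linarith
    rw [hρdef]
    field_simp
    ring
  rw [f5] at f4
  linarith

end Chain

/-! ### Estimates for the constants -/

section ConstantBounds

variable {L α γ : ℝ}

/-- In particular `30 ≤ gain`, so that powers of `gain` absorb all numerical factors below. -/
theorem le_gain (hL : 1 ≤ L) (hα0 : 0 < α) (hα1 : α < 1) (hγ0 : 0 < γ) (hγ1 : γ ≤ 1) :
    30 * L ≤ Chain.gain L α γ := by
  have h1α : 0 < 1 - α := by linarith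
  rw [Chain.gain, le_div_iff₀ (by positivity)]
  have h1 : (1 - α) ^ 2 * γ ≤ 1 := mul_le_one₀ (pow_le_one₀ h1α.le (by linarith)) hγ0.le hγ1
  have h2 : L ≤ L ^ 6 := le_self_pow₀ hL (by norm_num)
  nlinarith

theorem gain_le_gammaG (hL : 1 ≤ L) (hα1 : α < 1) (hγ0 : 0 < γ) :
    Chain.gain L α γ ≤ 15 * (1 / gammaG L α γ) := by
  have h1α : 0 < 1 - α := by linarith
  have hL0 : 0 < L := by linarith
  have e : 15 * (1 / gammaG L α γ) = 30 * ((1 + L) ^ 2 * L ^ 4) / ((1 - α) ^ 2 * γ) := by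
    rw [gammaG]
    field_simp
    ring
  rw [e, Chain.gain]
  refine div_le_div_of_nonneg_right ?_ (by positivity)
  have : L ^ 2 ≤ (1 + L) ^ 2 := by nlinarith
  have := mul_le_mul_of_nonneg_right this (by positivity : 0 ≤ L ^ 4)
  nlinarith

/-- A single summand of `γ_H⁻¹` suffices: it is at least `432 / γ_G ^ 2`, while `gain ^ 2 ≤ 225 /
γ_G ^ 2`. -/
theorem gain_sq_le (hL : 1 ≤ L) (hα0 : 0 < α) (hα1 : α < 1) (hγ0 : 0 < γ) :
    Chain.gain L α γ ^ 2 ≤ (gammaH L α γ)⁻¹ := by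
  have h1α : 0 < 1 - α := by linarith
  have hL0 : 0 < L := by linarith
  have hG : 0 < gammaG L α γ := by unfold gammaG; positivity
  have hF : 0 < gammaF L α := by unfold gammaF; positivity
  have hH : 3 ≤ LH L := by unfold LH; linarith
  have hH0 : 0 < LH L := by linarith
  have hμ : 0 < muBar L α γ := by unfold muBar; positivity
  have hF4 : 4 ≤ 1 / gammaF L α := by
    have e : 1 / gammaF L α = (1 + L) ^ 2 * L ^ 2 / (1 - α) ^ 2 := by
      rw [gammaF]; field_simp
    rw [e, le_div_iff₀ (by positivity)]
    have h1 : (1 - α) ^ 2 ≤ 1 := pow_le_one₀ h1α.le (by linarith)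
    have h2 : 4 ≤ (1 + L) ^ 2 := by nlinarith
    have h3 : 1 ≤ L ^ 2 := one_le_pow₀ hL
    nlinarith
  have hg := gain_le_gammaG hL hα1 hγ0
  have hg0 := Chain.gain_nonneg (α := α) hγ0 hL
  rw [gammaH, inv_inv]
  set g := 1 / gammaG L α γ with hgd
  have hgp : 0 < g := by positivity
  have big : 432 * g ^ 2 ≤ 4 * LH L ^ 2 / gammaG L α γ ^ 2
      * (LH L * (1 + muBar L α γ * LH L) / gammaF L α) := by
    have e1 : 36 * g ^ 2 ≤ 4 * LH L ^ 2 / gammaG L α γ ^ 2 := by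
      have : 4 * LH L ^ 2 / gammaG L α γ ^ 2 = 4 * LH L ^ 2 * g ^ 2 := by
        rw [hgd]; field_simp
      rw [this]
      refine mul_le_mul_of_nonneg_right ?_ (by positivity)
      nlinarith
    have e2 : 12 ≤ LH L * (1 + muBar L α γ * LH L) / gammaF L α := by
      have : LH L * (1 + muBar L α γ * LH L) / gammaF L α
        = LH L * (1 + muBar L α γ * LH L) * (1 / gammaF L α) := by ring
      rw [this]
      have h1 : 3 ≤ LH L * (1 + muBar L α γ * LH L) := by
        nlinarith [mul_pos hμ hH0]
      nlinarith
    calc 432 * g ^ 2 = 36 * g ^ 2 * 12 := by ring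
      _ ≤ _ := mul_le_mul e1 e2 (by norm_num) (by positivity)
  have rest : 4 * LH L ^ 2 / gammaG L α γ ^ 2
      * (LH L * (1 + muBar L α γ * LH L) / gammaF L α) ≤ 2 / gammaG L α γ
    + (1 + 4 * LH L / gammaG L α γ + 4 * LH L ^ 2 / gammaG L α γ ^ 2)
        * (LH L * (1 + muBar L α γ * LH L) / gammaF L α)
    + muBar L α γ := by
    have : 0 ≤ 2 / gammaG L α γ + (1 + 4 * LH L / gammaG L α γ)
        * (LH L * (1 + muBar L α γ * LH L) / gammaF L α) + muBar L α γ := by positivity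
    linarith
  nlinarith

theorem gammaH_pos (hL : 1 ≤ L) (hα1 : α < 1) (hγ0 : 0 < γ) : 0 < gammaH L α γ := by
  have h1α : 0 < 1 - α := by linarith
  have hL0 : 0 < L := by linarith
  have hG : 0 < gammaG L α γ := by unfold gammaG; positivity
  have hF : 0 < gammaF L α := by unfold gammaF; positivity
  have hH0 : 0 < LH L := by unfold LH; linarith
  have hμ : 0 < muBar L α γ := by unfold muBar; positivity
  unfold gammaH
  positivity

theorem gammaH_mul_le (hL : 1 ≤ L) (hα0 : 0 < α) (hα1 : α < 1) (hγ0 : 0 < γ) :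
    gammaH L α γ * Chain.gain L α γ ^ 2 ≤ 1 := by
  have h := gain_sq_le hL hα0 hα1 hγ0
  have h0 := gammaH_pos hL hα1 hγ0
  calc _ ≤ gammaH L α γ * (gammaH L α γ)⁻¹ := mul_le_mul_of_nonneg_left h h0.le
    _ = 1 := mul_inv_cancel₀ h0.ne'

/-- Since `1 / ρ - 1 ≤ 1 / ρ ^ 2 - 1 = 2 γ_H ^ 2 / (L_H ^ 2 - γ_H ^ 2) ≤ 2 γ_H ^ 2` and `γ_H ≤ gain
^ (-2)`, the rate `ρ` is close enough to `1` to be admissible in `Chain.Good.sqrt_stageSq_le`. -/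
theorem rho_bounds (hL : 1 ≤ L) (hα0 : 0 < α) (hα1 : α < 1) (hγ0 : 0 < γ) (hγ1 : γ ≤ 1) :
    0 < rho L α γ ∧ rho L α γ < 1 ∧ 1 / 2 ≤ rho L α γ ∧
      5 * Chain.gain L α γ * (L * (1 / rho L α γ - 1)) ≤ 1 := by
  have hG := le_gain hL hα0 hα1 hγ0 hγ1
  have hm := gammaH_mul_le hL hα0 hα1 hγ0
  have h0 := gammaH_pos hL hα1 hγ0
  have hH : 3 ≤ LH L := by unfold LH; linarith
  set G := Chain.gain L α γ
  set h := gammaH L α γ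
  have hG30 : 30 ≤ G := by linarith
  have hG2 : 900 ≤ G ^ 2 := by nlinarith
  have hh1 : h ≤ 1 := by nlinarith
  have hH2 : 9 ≤ LH L ^ 2 := by nlinarith
  have hh2 : h ^ 2 ≤ 1 := pow_le_one₀ h0.le hh1
  have hh4 : h ^ 2 * G ^ 4 ≤ 1 := by
    calc h ^ 2 * G ^ 4 = (h * G ^ 2) ^ 2 := by ring
      _ ≤ 1 := pow_le_one₀ (by positivity) hm
  have hpos : 0 < rho L α γ := by
    unfold rho
    refine Real.sqrt_pos.mpr (div_pos ?_ (by positivity))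
    change 0 < LH L ^ 2 - h ^ 2
    linarith
  have hsq : rho L α γ ^ 2 = (LH L ^ 2 - h ^ 2) / (LH L ^ 2 + h ^ 2) := by
    unfold rho
    refine Real.sq_sqrt (div_nonneg ?_ (by positivity))
    change 0 ≤ LH L ^ 2 - h ^ 2
    linarith
  set ρ := rho L α γ
  have hsq1 : ρ ^ 2 < 1 := by
    rw [hsq, div_lt_one (by positivity)]
    nlinarith
  have hlt : ρ < 1 := by nlinarith
  have hinv : 1 / ρ - 1 ≤ 2 * h ^ 2 := by
    have h1 : 1 / ρ ≤ 1 / ρ ^ 2 := one_div_le_one_div_of_le (by positivity) (by nlinarith)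
    have h2 : 1 / ρ ^ 2 - 1 = 2 * h ^ 2 / (LH L ^ 2 - h ^ 2) := by
      have : LH L ^ 2 - h ^ 2 ≠ 0 := by linarith
      rw [hsq]
      field_simp
      ring
    have h3 : 2 * h ^ 2 / (LH L ^ 2 - h ^ 2) ≤ 2 * h ^ 2 :=
      div_le_self (by positivity) (by linarith)
    linarith
  have hhs : h ^ 2 * 900 ≤ 1 := by
    have : h ^ 2 * 900 ≤ h ^ 2 * G ^ 4 := by
      refine mul_le_mul_of_nonneg_left ?_ (sq_nonneg _)
      nlinarith
    linarith
  refine ⟨hpos, hlt, ?_, ?_⟩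
  · have : 1 / ρ ≤ 2 := by linarith
    rw [div_le_iff₀ hpos] at this
    linarith
  · have hLG : L ≤ G := by linarith
    calc 5 * G * (L * (1 / ρ - 1)) ≤ 5 * G * (G * (2 * h ^ 2)) := by
          refine mul_le_mul_of_nonneg_left ?_ (by linarith)
          refine mul_le_mul hLG hinv ?_ (by linarith)
          rw [sub_nonneg, one_le_div hpos]
          exact hlt.le
      _ = 10 * (h ^ 2 * G ^ 2) := by ring
      _ ≤ h ^ 2 * G ^ 4 := by
          have : 0 ≤ h ^ 2 * G ^ 2 := by positivity
          nlinarith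
      _ ≤ 1 := hh4

theorem le_c₁ (hL : 1 ≤ L) (hα0 : 0 < α) (hα1 : α < 1) (hγ0 : 0 < γ) (hγ1 : γ ≤ 1) :
    3 * Chain.gain L α γ ^ 4 ≤ c₁ L α γ := by
  obtain ⟨hρ0, hρ1, -, -⟩ := rho_bounds hL hα0 hα1 hγ0 hγ1
  have hm := gammaH_mul_le hL hα0 hα1 hγ0
  have h0 := gammaH_pos hL hα1 hγ0
  have hH : 3 ≤ LH L := by unfold LH; linarith
  rw [c₁, le_div_iff₀ (by positivity)]
  have h4 : (gammaH L α γ * Chain.gain L α γ ^ 2) ^ 2 ≤ 1 := pow_le_one₀ (by positivity) hm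
  have h5 : (gammaH L α γ * Chain.gain L α γ ^ 2) ^ 2 * rho L α γ ≤ 1 :=
    mul_le_one₀ h4 hρ0.le hρ1.le
  calc _ = 3 * ((gammaH L α γ * Chain.gain L α γ ^ 2) ^ 2 * rho L α γ) := by ring
    _ ≤ _ := by linarith

/-- The threshold says `ρ ^ (2 * W) ≤ (√α - α) / (4 c₁ ^ 2 L ^ 3)`, at most `1 / (16 c₁ ^ 2 L ^ 3)`.
This excludes `W = 0`, and as `c₁ ≥ 3 gain ^ 4` it makes the jump small enough to absorb. -/
theorem horizon_bounds (hL : 1 ≤ L) (hα0 : 0 < α) (hα1 : α < 1) (hγ0 : 0 < γ) (hγ1 : γ ≤ 1)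
    {W : ℕ} (hW : WBar L α γ ≤ W) :
    1 ≤ W ∧ 5 * Chain.gain L α γ *
      (32 * Chain.gain L α γ ^ 2 * L ^ 3 * rho L α γ ^ (2 * W - 1)) ≤ 1 := by
  obtain ⟨hρ0, hρ1, hρ2, -⟩ := rho_bounds hL hα0 hα1 hγ0 hγ1
  have hc := le_c₁ hL hα0 hα1 hγ0 hγ1
  have hG := le_gain hL hα0 hα1 hγ0 hγ1
  set G := Chain.gain L α γ
  set ρ := rho L α γ
  have hG30 : 30 ≤ G := by linarith
  have hG4 : G ≤ G ^ 4 := le_self_pow₀ (by linarith) (by norm_num)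
  have hc1 : 1 ≤ c₁ L α γ := by linarith
  have hL0 : 0 < L := by linarith
  -- Completing the square: `√α - α = 1 / 4 - (√α - 1 / 2) ^ 2`.
  have hs : α ^ (1 / 2 : ℝ) - α ≤ 1 / 4 := by
    rw [← Real.sqrt_eq_rpow]
    nlinarith [Real.sq_sqrt hα0.le, sq_nonneg (√α - 1 / 2)]
  have hs0 : 0 < α ^ (1 / 2 : ℝ) - α := by
    rw [← Real.sqrt_eq_rpow]
    have h1 := Real.sq_sqrt hα0.le
    have h2 : 0 < √α := Real.sqrt_pos.mpr hα0
    have h3 : √α < 1 := by nlinarith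
    nlinarith
  have hden : 0 < 4 * c₁ L α γ ^ 2 * L ^ 3 := by positivity
  have hlog : Real.log ρ < 0 := Real.log_neg hρ0 hρ1
  have hpow : ρ ^ (2 * W) ≤ (α ^ (1 / 2 : ℝ) - α) / (4 * c₁ L α γ ^ 2 * L ^ 3) := by
    rw [WBar, div_le_iff_of_neg (by linarith)] at hW
    rw [← Real.log_le_log_iff (by positivity) (by positivity), Real.log_pow]
    push_cast
    linarith
  have hpow2 : ρ ^ (2 * W) ≤ 1 / (16 * c₁ L α γ ^ 2 * L ^ 3) := by
    refine hpow.trans ?_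
    rw [div_le_div_iff₀ hden (by positivity)]
    have : 0 ≤ c₁ L α γ ^ 2 * L ^ 3 := by positivity
    nlinarith
  have hL3 : 1 ≤ L ^ 3 := one_le_pow₀ hL
  have hc2 : 1 ≤ c₁ L α γ ^ 2 := one_le_pow₀ hc1
  have hW1 : 1 ≤ W := by
    by_contra h
    have h0 : W = 0 := by omega
    rw [h0, mul_zero, pow_zero, le_div_iff₀ (by positivity)] at hpow2
    nlinarith
  refine ⟨hW1, ?_⟩
  have hpow3 : ρ ^ (2 * W - 1) ≤ 2 * ρ ^ (2 * W) := by
    have : ρ ^ (2 * W) = ρ ^ (2 * W - 1) * ρ := by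
      rw [← pow_succ]; congr 1; omega
    rw [this]
    have : 0 < ρ ^ (2 * W - 1) := by positivity
    nlinarith
  calc 5 * G * (32 * G ^ 2 * L ^ 3 * ρ ^ (2 * W - 1))
      ≤ 5 * G * (32 * G ^ 2 * L ^ 3 * (2 * (1 / (16 * c₁ L α γ ^ 2 * L ^ 3)))) := by
        have := hpow3.trans (mul_le_mul_of_nonneg_left hpow2 two_pos.le)
        gcongr
    _ = 20 * G ^ 3 / c₁ L α γ ^ 2 := by field_simp; ring
    _ ≤ 1 := by
        rw [div_le_one (by positivity)]
        have h1 : (3 * G ^ 4) ^ 2 ≤ c₁ L α γ ^ 2 := pow_le_pow_left₀ (by positivity) hc 2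
        have h2 : G ^ 3 * 900 ≤ G ^ 3 * G ^ 5 := by
          refine mul_le_mul_of_nonneg_left ?_ (by positivity)
          calc (900 : ℝ) ≤ 30 ^ 5 := by norm_num
            _ ≤ G ^ 5 := pow_le_pow_left₀ (by norm_num) hG30 5
        have h3 : 0 ≤ G ^ 3 := by positivity
        nlinarith

/-- With `σ = √ρ`, the left side is of order `gain ^ 5 / (1 - σ)`, whereas `c₁ ^ 2 ≥ 9 gain ^ 8`;
the surplus powers of `gain` absorb the numerical factors. -/
theorem gain_le_c₂ (hL : 1 ≤ L) (hα0 : 0 < α) (hα1 : α < 1) (hγ0 : 0 < γ) (hγ1 : γ ≤ 1) :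
    4 * Chain.gain L α γ * (1 + 32 * Chain.gain L α γ ^ 2 * L ^ 2 /
      (√(rho L α γ) ^ 4 * (1 - √(rho L α γ)))) ≤ c₂ L α γ := by
  obtain ⟨hρ0, hρ1, hρ2, -⟩ := rho_bounds hL hα0 hα1 hγ0 hγ1
  have hc := le_c₁ hL hα0 hα1 hγ0 hγ1
  have hG := le_gain hL hα0 hα1 hγ0 hγ1
  rw [c₂]
  set G := Chain.gain L α γ
  set ρ := rho L α γ
  have hG30 : 30 ≤ G := by linarith
  have hσ3 : ρ ^ (3 / 2 : ℝ) = √ρ ^ 3 := by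
    rw [Real.sqrt_eq_rpow, ← Real.rpow_natCast, ← Real.rpow_mul hρ0.le]
    norm_num
  have hσ2 := Real.sq_sqrt hρ0.le
  have hσ0 : 0 < √ρ := Real.sqrt_pos.mpr hρ0
  set σ := √ρ
  have hσ1 : σ < 1 := by nlinarith
  rw [hσ3]
  have hs : 0 < 1 - σ := by linarith
  have h4 : 1 / 4 ≤ σ ^ 4 := by
    calc (1 / 4 : ℝ) = (1 / 2) ^ 2 := by norm_num
      _ ≤ ρ ^ 2 := pow_le_pow_left₀ (by norm_num) hρ2 2
      _ = σ ^ 4 := by rw [← hσ2]; ring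
  have hLG : L ≤ G := by linarith
  have lhs : 4 * G * (1 + 32 * G ^ 2 * L ^ 2 / (σ ^ 4 * (1 - σ))) ≤ 6 * G ^ 8 / (1 - σ) := by
    have e1 : 32 * G ^ 2 * L ^ 2 / (σ ^ 4 * (1 - σ)) ≤ 128 * G ^ 4 / (1 - σ) := by
      rw [div_le_div_iff₀ (by positivity) hs]
      have : 32 * G ^ 2 * L ^ 2 ≤ 128 * G ^ 4 * σ ^ 4 := by
        have h1 : L ^ 2 ≤ G ^ 2 := pow_le_pow_left₀ (by linarith) hLG 2
        have h2 : G ^ 2 * L ^ 2 ≤ G ^ 2 * G ^ 2 := mul_le_mul_of_nonneg_left h1 (sq_nonneg _)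
        have h3 : G ^ 4 * (1 / 4) ≤ G ^ 4 * σ ^ 4 := mul_le_mul_of_nonneg_left h4 (by positivity)
        nlinarith
      nlinarith
    have e2 : 1 ≤ 1 / (1 - σ) := by
      rw [le_div_iff₀ hs]; linarith
    calc _ ≤ 4 * G * (1 / (1 - σ) + 128 * G ^ 4 / (1 - σ)) := by
          refine mul_le_mul_of_nonneg_left (add_le_add e2 e1) (by linarith)
      _ = (4 * G + 512 * G ^ 5) / (1 - σ) := by ring
      _ ≤ _ := by
          refine div_le_div_of_nonneg_right ?_ hs.le
          have h1 : G ≤ G ^ 5 := le_self_pow₀ (by linarith) (by norm_num)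
          have h2 : G ^ 5 * 27000 ≤ G ^ 5 * G ^ 3 := by
            refine mul_le_mul_of_nonneg_left ?_ (by positivity)
            calc (27000 : ℝ) = 30 ^ 3 := by norm_num
              _ ≤ G ^ 3 := pow_le_pow_left₀ (by norm_num) hG30 3
          nlinarith
  refine lhs.trans ?_
  have h1 : (3 * G ^ 4) ^ 2 ≤ c₁ L α γ ^ 2 := pow_le_pow_left₀ (by positivity) hc 2
  -- From `1 - σ ^ 3 = (1 - σ) (1 + σ + σ ^ 2)`.
  have h3 : ρ * (1 - σ ^ 3) ≤ 3 * (1 - σ) := by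
    have : 1 - σ ^ 3 ≤ 3 * (1 - σ) := by
      nlinarith [mul_pos hσ0 hs, mul_pos (mul_pos hσ0 hs) hs]
    have : 0 ≤ 1 - σ ^ 3 := by
      have := pow_le_one₀ (n := 3) hσ0.le hσ1.le
      linarith
    nlinarith
  have h5 : 0 < 1 - σ ^ 3 := by
    have := pow_lt_one₀ (n := 3) hσ0.le hσ1 (by norm_num)
    linarith
  calc 6 * G ^ 8 / (1 - σ) = 18 * G ^ 8 / (3 * (1 - σ)) := by
        field_simp
        norm_num
    _ ≤ 2 * c₁ L α γ ^ 2 * L / (ρ * (1 - σ ^ 3)) := by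
        refine div_le_div₀ (by positivity) ?_ (by positivity) h3
        have h6 : 0 ≤ c₁ L α γ ^ 2 := sq_nonneg _
        nlinarith

theorem rpow_half_eq {ρ : ℝ} (hρ : 0 ≤ ρ) (t : ℕ) : ρ ^ ((t : ℝ) / 2) = √ρ ^ t := by
  rw [Real.sqrt_eq_rpow, ← Real.rpow_natCast, ← Real.rpow_mul hρ]
  congr 1
  ring

theorem rpow_abs_sub_half_eq {ρ : ℝ} (hρ : 0 ≤ ρ) (t s : ℕ) :
    ρ ^ (|(t : ℝ) - (s : ℝ)| / 2) = √ρ ^ Nat.dist s t := by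
  rw [← rpow_half_eq hρ]
  congr 2
  unfold Nat.dist
  rcases le_total s t with h | h
  · rw [abs_of_nonneg (by simpa using h), Nat.sub_eq_zero_of_le h, zero_add, Nat.cast_sub h]
  · rw [abs_of_nonpos (by simpa using h), Nat.sub_eq_zero_of_le h, add_zero, Nat.cast_sub h]
    ring

end ConstantBounds

/-! ### Matrix facts -/

section MatrixFacts

variable {m n k : ℕ}

theorem norm_toEuclideanLin_le {A : Matrix (Fin m) (Fin n) ℝ} {L : ℝ} (hA : ‖A‖ ≤ L)
    (x : EuclideanSpace ℝ (Fin n)) : ‖Matrix.toEuclideanLin A x‖ ≤ L * ‖x‖ :=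
  (Matrix.l2_opNorm_mulVec A x).trans (mul_le_mul_of_nonneg_right hA (norm_nonneg x))

theorem toEuclideanLin_mul_apply (A : Matrix (Fin m) (Fin n) ℝ) (B : Matrix (Fin n) (Fin k) ℝ)
    (x : EuclideanSpace ℝ (Fin k)) :
    Matrix.toEuclideanLin (A * B) x = Matrix.toEuclideanLin A (Matrix.toEuclideanLin B x) := by
  simp [Matrix.toLpLin_apply, Matrix.mulVec_mulVec]

theorem inner_toEuclideanLin_comm {A : Matrix (Fin n) (Fin n) ℝ} (hA : A.IsHermitian)
    (x y : EuclideanSpace ℝ (Fin n)) :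
    inner ℝ (Matrix.toEuclideanLin A x) y = inner ℝ x (Matrix.toEuclideanLin A y) :=
  Matrix.isSymmetric_toEuclideanLin_iff.mpr hA x y

theorem isHermitian_sqrt (Q : Matrix (Fin n) (Fin n) ℝ) : (CFC.sqrt Q).IsHermitian :=
  (Matrix.nonneg_iff_posSemidef.mp (CFC.sqrt_nonneg Q)).isHermitian

theorem sqrt_mul_sqrt {Q : Matrix (Fin n) (Fin n) ℝ} (hQ : Q.PosSemidef) :
    CFC.sqrt Q * CFC.sqrt Q = Q :=
  CFC.sqrt_mul_sqrt_self Q (Matrix.nonneg_iff_posSemidef.mpr hQ)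

theorem inner_sqrt_sqrt {Q : Matrix (Fin n) (Fin n) ℝ} (hQ : Q.PosSemidef)
    (x y : EuclideanSpace ℝ (Fin n)) :
    inner ℝ (Matrix.toEuclideanLin (CFC.sqrt Q) x) (Matrix.toEuclideanLin (CFC.sqrt Q) y)
      = inner ℝ x (Matrix.toEuclideanLin Q y) := by
  rw [inner_toEuclideanLin_comm (isHermitian_sqrt Q), ← toEuclideanLin_mul_apply,
    sqrt_mul_sqrt hQ]

/-- The C*-identity gives `‖√Q‖ ^ 2 = ‖Q‖ ≤ L ≤ L ^ 2`. -/
theorem norm_sqrt_le {Q : Matrix (Fin n) (Fin n) ℝ} (hQ : Q.PosSemidef) {L : ℝ} (hL : 1 ≤ L)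
    (h : ‖Q‖ ≤ L) : ‖CFC.sqrt Q‖ ≤ L := by
  have h1 := Matrix.l2_opNorm_conjTranspose_mul_self (CFC.sqrt Q)
  rw [(isHermitian_sqrt Q).eq, sqrt_mul_sqrt hQ] at h1
  by_contra hlt
  push Not at hlt
  nlinarith

theorem isHermitian_of_sub_smul_one {R : Matrix (Fin n) (Fin n) ℝ} {γ : ℝ}
    (h : (R - γ • (1 : Matrix (Fin n) (Fin n) ℝ)).PosSemidef) : R.IsHermitian := by
  have h1 : (γ • (1 : Matrix (Fin n) (Fin n) ℝ)).IsHermitian := by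
    simp [Matrix.IsHermitian]
  have := h.isHermitian.add h1
  rwa [sub_add_cancel] at this

theorem coercive_of_sub_smul_one {R : Matrix (Fin n) (Fin n) ℝ} {γ : ℝ}
    (h : (R - γ • (1 : Matrix (Fin n) (Fin n) ℝ)).PosSemidef) (u : EuclideanSpace ℝ (Fin n)) :
    γ * ‖u‖ ^ 2 ≤ inner ℝ (Matrix.toEuclideanLin R u) u := by
  have h1 := (Matrix.isPositive_toEuclideanLin_iff.mpr h).re_inner_nonneg_left u
  have e : Matrix.toEuclideanLin (R - γ • (1 : Matrix (Fin n) (Fin n) ℝ)) u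
      = Matrix.toEuclideanLin R u - γ • u := by
    rw [map_sub, map_smul, LinearMap.sub_apply, LinearMap.smul_apply]
    simp [Matrix.toLpLin_apply]
  rw [e, inner_sub_left, inner_smul_left, real_inner_self_eq_norm_sq] at h1
  simpa using h1

end MatrixFacts

/-! ### Random vectors on a finite scenario set -/

section Scenario

/-- Random vectors on a finite set of scenarios, as a Euclidean space. -/
abbrev Field (S : Type*) [Fintype S] (k : ℕ) : Type _ :=
  PiLp 2 fun _ : S => EuclideanSpace ℝ (Fin k)

variable {S : Type*} [Fintype S] {k m n : ℕ}

/-- The random vector `f`, scaled such that the norm is the root of the second moment with respect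
to the weights `p`. -/
def embed (p : S → ℝ) (f : S → EuclideanSpace ℝ (Fin k)) : Field S k :=
  WithLp.toLp 2 fun s => √(p s) • f s

theorem inner_embed {p : S → ℝ} (hp : ∀ s, 0 < p s) (f g : S → EuclideanSpace ℝ (Fin k)) :
    inner ℝ (embed p f) (embed p g) = ∑ s, p s * inner ℝ (f s) (g s) := by
  rw [PiLp.inner_apply]
  refine Finset.sum_congr rfl fun s _ => ?_
  simp only [embed, inner_smul_left, inner_smul_right, RCLike.conj_to_real]
  rw [← mul_assoc, Real.mul_self_sqrt (hp s).le]

theorem norm_embed_sq {p : S → ℝ} (hp : ∀ s, 0 < p s) (f : S → EuclideanSpace ℝ (Fin k)) :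
    ‖embed p f‖ ^ 2 = ∑ s, p s * ‖f s‖ ^ 2 := by
  rw [← real_inner_self_eq_norm_sq, inner_embed hp]
  simp only [real_inner_self_eq_norm_sq]

theorem embed_add (p : S → ℝ) (f g : S → EuclideanSpace ℝ (Fin k)) :
    embed p f + embed p g = embed p (fun s => f s + g s) := by
  ext1 s
  simp [embed]

theorem embed_injective {p : S → ℝ} (hp : ∀ s, 0 < p s) {f g : S → EuclideanSpace ℝ (Fin k)}
    (h : embed p f = embed p g) : f = g := by
  funext s
  have : √(p s) • f s = √(p s) • g s := congrArg (fun v : Field S k => v s) h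
  exact smul_right_injective _ (Real.sqrt_pos.mpr (hp s)).ne' this

/-- Multiplication by a random matrix. -/
def mulOp (φ : S → Matrix (Fin m) (Fin n) ℝ) : Field S n →ₗ[ℝ] Field S m where
  toFun v := WithLp.toLp 2 fun s => Matrix.toEuclideanLin (φ s) (v s)
  map_add' v w := by ext1 s; simp
  map_smul' a v := by ext1 s; simp

theorem mulOp_apply (φ : S → Matrix (Fin m) (Fin n) ℝ) (v : Field S n) (s : S) :
    mulOp φ v s = Matrix.toEuclideanLin (φ s) (v s) := rfl

theorem mulOp_embed (p : S → ℝ) (φ : S → Matrix (Fin m) (Fin n) ℝ)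
    (f : S → EuclideanSpace ℝ (Fin n)) :
    mulOp φ (embed p f) = embed p fun s => Matrix.toEuclideanLin (φ s) (f s) := by
  ext1 s
  rw [mulOp_apply]
  simp [embed]

theorem norm_mulOp_le {φ : S → Matrix (Fin m) (Fin n) ℝ} {L : ℝ} (hL : 0 ≤ L)
    (h : ∀ s, ‖φ s‖ ≤ L) (v : Field S n) : ‖mulOp φ v‖ ≤ L * ‖v‖ := by
  refine le_of_sq_le_sq ?_ (by positivity)
  rw [mul_pow, PiLp.norm_sq_eq_of_L2, PiLp.norm_sq_eq_of_L2, Finset.mul_sum]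
  refine Finset.sum_le_sum fun s _ => ?_
  rw [← mul_pow, mulOp_apply]
  exact pow_le_pow_left₀ (norm_nonneg _) (norm_toEuclideanLin_le (h s) _) 2

theorem mulOp_sub_mul (φ : S → Matrix (Fin m) (Fin n) ℝ) (ψ : S → Matrix (Fin m) (Fin k) ℝ)
    (χ : S → Matrix (Fin k) (Fin n) ℝ) :
    mulOp φ - mulOp ψ ∘ₗ mulOp χ = mulOp fun s => φ s - ψ s * χ s := by
  ext1 v
  ext1 s
  rw [mulOp_apply, map_sub, LinearMap.sub_apply, LinearMap.sub_apply, toEuclideanLin_mul_apply]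
  rfl

/-- These operators act scenario by scenario, so pointwise bounds on matrix products pass to `flow`.
-/
theorem flow_mulOp (Φ : ℕ → S → Matrix (Fin n) (Fin n) ℝ) (t j : ℕ) (v : Field S n) :
    flow (fun i => mulOp (Φ i)) t j v = mulOp (fun s => transition (fun i => Φ i s) t j) v := by
  induction j with
  | zero =>
    ext1 s
    rw [mulOp_apply]
    simp [flow, transition]
  | succ j ih =>
    change mulOp (Φ (t + j + 1)) (flow (fun i => mulOp (Φ i)) t j v) = _
    rw [ih]
    ext1 s
    rw [mulOp_apply, mulOp_apply, mulOp_apply, ← toEuclideanLin_mul_apply]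
    rfl

end Scenario

/-! ### The chain of a finite set of scenarios -/

section ScenarioChain

variable {Ω Ξ : Type*} {nx nu : ℕ}

/-- The pointwise version of `Regular` on a set of outcomes. -/
structure RegularOn (M : Model Ξ nx nu) (G : Set Ω) (ξ : ℕ → Ω → Ξ) (T : ℕ)
    (L α γ : ℝ) : Prop where
  one_le_L : 1 ≤ L
  α_pos : 0 < α
  α_lt_one : α < 1
  γ_pos : 0 < γ
  γ_le_one : γ ≤ 1
  A_bdd : ∀ t ≤ T, ∀ ω ∈ G, ‖M.A (ξ t ω)‖ ≤ L
  B_bdd : ∀ t ≤ T, ∀ ω ∈ G, ‖M.B (ξ t ω)‖ ≤ L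
  Q_bdd : ∀ t ≤ T, ∀ ω ∈ G, ‖M.Q (ξ t ω)‖ ≤ L
  R_bdd : ∀ t ≤ T, ∀ ω ∈ G, ‖M.R (ξ t ω)‖ ≤ L
  Q_psd : ∀ t ≤ T, ∀ ω ∈ G, (M.Q (ξ t ω)).PosSemidef
  R_pd : ∀ t ≤ T, ∀ ω ∈ G, (M.R (ξ t ω) - γ • (1 : Matrix (Fin nu) (Fin nu) ℝ)).PosSemidef
  stabilizable : ∃ K : (t : ℕ) → (Fin (t + 1) → Ξ) → Matrix (Fin nu) (Fin nx) ℝ,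
    (∀ t < T, ∀ ω ∈ G, ‖K t (hist ξ t ω)‖ ≤ L) ∧
    ∀ s n : ℕ, 0 < n → s + n ≤ T → ∀ ω ∈ G, ‖transition (fun t => M.A (ξ t ω)
      - M.B (ξ t ω) * K (t - 1) (hist ξ (t - 1) ω)) s n‖ ≤ L * α ^ n
  detectable : ∃ K : (t : ℕ) → (Fin (t + 1) → Ξ) → Matrix (Fin nx) (Fin nx) ℝ,
    (∀ t, 1 ≤ t → t ≤ T → ∀ ω ∈ G, ‖K t (hist ξ t ω)‖ ≤ L) ∧
    ∀ s n : ℕ, 0 < n → s + n ≤ T → ∀ ω ∈ G, ‖transition (fun t => M.A (ξ t ω)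
      - K t (hist ξ t ω) * CFC.sqrt (M.Q (ξ (t - 1) ω))) s n‖ ≤ L * α ^ n

/-- Only countably many almost sure statements are involved, so one set of full measure serves them
all. -/
theorem Regular.exists_regularOn [MeasurableSpace Ω] {M : Model Ξ nx nu} {ν : Measure Ω}
    {ξ : ℕ → Ω → Ξ} {T : ℕ}
    {L α γ : ℝ} (h : Regular M ν ξ T L α γ) :
    ∃ G : Set Ω, (∀ᵐ ω ∂ν, ω ∈ G) ∧ RegularOn M G ξ T L α γ := by
  obtain ⟨K, hK1, hK2⟩ := h.stabilizable
  obtain ⟨J, hJ1, hJ2⟩ := h.detectable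
  have hA := (ae_all_iff.mpr fun t => ae_all_iff.mpr fun ht : t ≤ T => h.A_bdd t ht)
  have hB := (ae_all_iff.mpr fun t => ae_all_iff.mpr fun ht : t ≤ T => h.B_bdd t ht)
  have hQ := (ae_all_iff.mpr fun t => ae_all_iff.mpr fun ht : t ≤ T => h.Q_bdd t ht)
  have hR := (ae_all_iff.mpr fun t => ae_all_iff.mpr fun ht : t ≤ T => h.R_bdd t ht)
  have hQp := (ae_all_iff.mpr fun t => ae_all_iff.mpr fun ht : t ≤ T => h.Q_psd t ht)
  have hRp := (ae_all_iff.mpr fun t => ae_all_iff.mpr fun ht : t ≤ T => h.R_pd t ht)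
  have hK1 := (ae_all_iff.mpr fun t => ae_all_iff.mpr fun ht : t < T => hK1 t ht)
  have hJ1 := (ae_all_iff.mpr fun t => ae_all_iff.mpr fun h1 : 1 ≤ t => ae_all_iff.mpr
    fun ht : t ≤ T => hJ1 t h1 ht)
  have hK2 := (ae_all_iff.mpr fun s => ae_all_iff.mpr fun n => ae_all_iff.mpr fun h1 : 0 < n =>
    ae_all_iff.mpr fun ht : s + n ≤ T => hK2 s n h1 ht)
  have hJ2 := (ae_all_iff.mpr fun s => ae_all_iff.mpr fun n => ae_all_iff.mpr fun h1 : 0 < n =>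
    ae_all_iff.mpr fun ht : s + n ≤ T => hJ2 s n h1 ht)
  refine ⟨{ω | _}, (((((((((hA.and hB).and hQ).and hR).and hQp).and hRp).and hK1).and hJ1).and
    hK2).and hJ2), h.one_le_L, h.α_pos, h.α_lt_one, h.γ_pos, h.γ_le_one, ?_, ?_, ?_, ?_, ?_, ?_,
    ⟨K, ?_, ?_⟩, ⟨J, ?_, ?_⟩⟩
  · exact fun t ht ω hω => hω.1.1.1.1.1.1.1.1.1 t ht
  · exact fun t ht ω hω => hω.1.1.1.1.1.1.1.1.2 t ht
  · exact fun t ht ω hω => hω.1.1.1.1.1.1.1.2 t ht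
  · exact fun t ht ω hω => hω.1.1.1.1.1.1.2 t ht
  · exact fun t ht ω hω => hω.1.1.1.1.1.2 t ht
  · exact fun t ht ω hω => hω.1.1.1.1.2 t ht
  · exact fun t ht ω hω => hω.1.1.1.2 t ht
  · exact fun s n h1 ht ω hω => hω.1.2 s n h1 ht
  · exact fun t h1 ht ω hω => hω.1.1.2 t h1 ht
  · exact fun s n h1 ht ω hω => hω.2 s n h1 ht

variable {S : Type*} [Fintype S]

/-- Random vectors that are functions of the history up to time `t`. -/
def adapted (p : S → ℝ) (ξ : ℕ → Ω → Ξ) (pt : S → Ω) (k t : ℕ) : Submodule ℝ (Field S k) where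
  carrier := {v | ∃ f : (Fin (t + 1) → Ξ) → EuclideanSpace ℝ (Fin k),
    v = embed p fun s => f (hist ξ t (pt s))}
  add_mem' := by
    rintro _ _ ⟨f, rfl⟩ ⟨g, rfl⟩
    exact ⟨fun h => f h + g h, embed_add p _ _⟩
  zero_mem' := ⟨fun _ => 0, by ext1 s; simp [embed]⟩
  smul_mem' := by
    rintro a _ ⟨f, rfl⟩
    exact ⟨fun h => a • f h, by ext1 s; simp [embed, smul_comm a]⟩

/-- The linear-quadratic chain of the scenarios `pt s` with weights `p s`. -/
def scenarioChain (M : Model Ξ nx nu) (p : S → ℝ) (ξ : ℕ → Ω → Ξ) (pt : S → Ω) :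
    Chain (Field S nx) (Field S nu) where
  V := adapted p ξ pt nx
  Y := adapted p ξ pt nu
  A t := mulOp fun s => M.A (ξ t (pt s))
  B t := mulOp fun s => M.B (ξ t (pt s))
  C t := mulOp fun s => CFC.sqrt (M.Q (ξ t (pt s)))
  R t := mulOp fun s => M.R (ξ t (pt s))

variable {M : Model Ξ nx nu} {p : S → ℝ} {ξ : ℕ → Ω → Ξ} {pt : S → Ω} {T : ℕ} {L α γ : ℝ}
  {G : Set Ω}

/-- Norm bounds hold scenario by scenario. Adaptedness survives one step because a function of
`ξ_{0:t}` multiplied by a matrix depending on `ξ_{t+1}` is a function of `ξ_{0:t+1}`; the feedback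
gains depend on `ξ_{0:t}` only. -/
theorem RegularOn.good (h : RegularOn M G ξ T L α γ) (hG : ∀ s, pt s ∈ G) :
    (scenarioChain M p ξ pt).Good T L α γ := by
  have hL1 := h.one_le_L
  have hL : 0 ≤ L := by linarith
  have hα := h.α_pos
  refine ⟨h.one_le_L, h.α_pos, h.α_lt_one, h.γ_pos, h.γ_le_one, ?_, ?_, ?_, ?_, ?_, ?_, ?_, ?_, ?_⟩
  · rintro t _ _ ⟨f, rfl⟩
    exact ⟨fun h' => Matrix.toEuclideanLin (M.A (h' (Fin.last _))) (f (Fin.init h')),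
      mulOp_embed p _ _⟩
  · rintro t _ _ ⟨f, rfl⟩
    exact ⟨fun h' => Matrix.toEuclideanLin (M.B (h' (Fin.last _))) (f (Fin.init h')),
      mulOp_embed p _ _⟩
  · exact fun t ht => norm_mulOp_le hL fun s => h.A_bdd t ht _ (hG s)
  · exact fun t ht => norm_mulOp_le hL fun s => h.B_bdd t ht _ (hG s)
  · exact fun t ht => norm_mulOp_le hL fun s =>
      norm_sqrt_le (h.Q_psd t ht _ (hG s)) hL1 (h.Q_bdd t ht _ (hG s))
  · exact fun t ht => norm_mulOp_le hL fun s => h.R_bdd t ht _ (hG s)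
  · intro t ht u
    rw [PiLp.inner_apply, PiLp.norm_sq_eq_of_L2, Finset.mul_sum]
    exact Finset.sum_le_sum fun s _ => coercive_of_sub_smul_one (h.R_pd t ht _ (hG s)) (u s)
  · obtain ⟨K, hK1, hK2⟩ := h.stabilizable
    refine ⟨fun t => mulOp fun s => K t (hist ξ t (pt s)), ?_, ?_, ?_⟩
    · rintro t _ _ ⟨f, rfl⟩
      exact ⟨fun h' => Matrix.toEuclideanLin (K t h') (f h'), mulOp_embed p _ _⟩
    · exact fun t ht => norm_mulOp_le hL fun s => hK1 t ht _ (hG s)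
    · intro s n hn x
      simp only [scenarioChain, mulOp_sub_mul]
      rcases Nat.eq_zero_or_pos n with rfl | hn0
      · simpa [flow] using le_mul_of_one_le_left (norm_nonneg x) hL1
      · rw [flow_mulOp]
        exact norm_mulOp_le (by positivity) (fun i => hK2 s n hn0 hn _ (hG i)) x
  · obtain ⟨K, hK1, hK2⟩ := h.detectable
    refine ⟨fun t => mulOp fun s => K t (hist ξ t (pt s)), ?_, ?_⟩
    · exact fun t h1 ht => norm_mulOp_le hL fun s => hK1 t h1 ht _ (hG s)
    · intro s n hn x
      simp only [scenarioChain, mulOp_sub_mul]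
      rcases Nat.eq_zero_or_pos n with rfl | hn0
      · simpa [flow] using le_mul_of_one_le_left (norm_nonneg x) hL1
      · rw [flow_mulOp]
        exact norm_mulOp_le (by positivity) (fun i => hK2 s n hn0 hn _ (hG i)) x

end ScenarioChain

/-- Allows states and controls to be replaced, inside the window only, by chosen functions of the
history. -/
theorem Chain.Exact.congr {E F : Type*} [NormedAddCommGroup E] [InnerProductSpace ℝ E]
    [NormedAddCommGroup F] [InnerProductSpace ℝ F] {c : Chain E F} {lo hi : ℕ} {q d : ℕ → E}
    {r : ℕ → F} {y : E} {x x' l : ℕ → E} {u u' : ℕ → F} (h : c.Exact lo hi q r d y x u l)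
    (hle : lo ≤ hi) (hx : ∀ t, lo ≤ t → t ≤ hi → x t = x' t)
    (hu : ∀ t, lo ≤ t → t ≤ hi → u t = u' t) : c.Exact lo hi q r d y x' u' l where
  x_mem t h1 h2 := hx t h1 h2 ▸ h.x_mem t h1 h2
  u_mem t h1 h2 := hu t h1 h2 ▸ h.u_mem t h1 h2
  l_mem := h.l_mem
  l_end := h.l_end
  init := hx lo le_rfl hle ▸ h.init
  dyn t h1 h2 := by
    rw [← hx t h1 h2.le, ← hu t h1 h2.le, ← hx (t + 1) (by omega) h2]
    exact h.dyn t h1 h2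
  adj t h1 h2 := by
    rw [← hx t h1 h2]
    exact h.adj t h1 h2
  opt t h1 h2 := by
    rw [← hu t h1 h2]
    exact h.opt t h1 h2

/-! ### Optimality on the branches of the scenario tree. -/

section Branch

variable {Ω Ξ : Type*} {nx nu : ℕ} {S : Type*} [Fintype S] {M : Model Ξ nx nu} {p : S → ℝ}
  {ξ : ℕ → Ω → Ξ} {pt : S → Ω} {T : ℕ} {L α γ : ℝ} {G : Set Ω} {τ N : ℕ}

/-- The decision process `w`, with costates `l`, solves the joint optimality system of all
scenarios on the stages `τ ≤ t ≤ N`, started from the previous states and controls `prev`. -/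
def SolvesSystem (M : Model Ξ nx nu) (p : S → ℝ) (ξ : ℕ → Ω → Ξ) (pt : S → Ω) (τ N : ℕ)
    (prev : (Fin (τ + 1) → Ξ) → StateControl nx nu) (w : Decisions Ξ nx nu)
    (l : ℕ → Field S nx) : Prop :=
  (scenarioChain M p ξ pt).Exact τ N (fun t => embed p fun s => M.q (ξ t (pt s)))
    (fun t => embed p fun s => M.r (ξ t (pt s))) (fun t => embed p fun s => M.d (ξ t (pt s)))
    (embed p fun s => M.f (prev (hist ξ τ (pt s))) (ξ τ (pt s)))
    (fun t => embed p fun s => (w t (hist ξ t (pt s))).fst)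
    (fun t => embed p fun s => (w t (hist ξ t (pt s))).snd) l

theorem RegularOn.exists_solvesSystem (h : RegularOn M G ξ T L α γ) (hG : ∀ s, pt s ∈ G)
    (p : S → ℝ) (hτ : τ ≤ N) (hN : N ≤ T) (prev : (Fin (τ + 1) → Ξ) → StateControl nx nu) :
    ∃ w l, SolvesSystem M p ξ pt τ N prev w l := by
  obtain ⟨x, u, l, hex⟩ := (h.good (p := p) hG).exists_exact hτ hN
    (fun t => embed p fun s => M.q (ξ t (pt s)))
    (fun t => embed p fun s => M.r (ξ t (pt s)))
    (d := fun t => embed p fun s => M.d (ξ t (pt s)))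
    (y := embed p fun s => M.f (prev (hist ξ τ (pt s))) (ξ τ (pt s)))
    (fun t _ _ => ⟨fun h' => M.d (h' (Fin.last t)), rfl⟩)
    ⟨fun h' => M.f (prev h') (h' (Fin.last τ)), rfl⟩
  have hx : ∀ t, ∃ f : (Fin (t + 1) → Ξ) → EuclideanSpace ℝ (Fin nx), τ ≤ t → t ≤ N →
      x t = embed p fun s => f (hist ξ t (pt s)) := fun t => by
    by_cases ht : τ ≤ t ∧ t ≤ N
    · obtain ⟨f, hf⟩ := hex.x_mem t ht.1 ht.2
      exact ⟨f, fun _ _ => hf⟩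
    · exact ⟨0, fun h1 h2 => (ht ⟨h1, h2⟩).elim⟩
  have hu : ∀ t, ∃ f : (Fin (t + 1) → Ξ) → EuclideanSpace ℝ (Fin nu), τ ≤ t → t ≤ N →
      u t = embed p fun s => f (hist ξ t (pt s)) := fun t => by
    by_cases ht : τ ≤ t ∧ t ≤ N
    · obtain ⟨f, hf⟩ := hex.u_mem t ht.1 ht.2
      exact ⟨f, fun _ _ => hf⟩
    · exact ⟨0, fun h1 h2 => (ht ⟨h1, h2⟩).elim⟩
  choose fx hfx using hx
  choose fu hfu using hu
  exact ⟨fun t h' => WithLp.toLp 2 (fx t h', fu t h'), l, hex.congr hτ hfx hfu⟩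

variable {prev : (Fin (τ + 1) → Ξ) → StateControl nx nu} {w v : Decisions Ξ nx nu}
  {l : ℕ → Field S nx}

theorem SolvesSystem.init_eq (h : SolvesSystem M p ξ pt τ N prev w l) (hp : ∀ s, 0 < p s) (s : S) :
    (w τ (hist ξ τ (pt s))).fst = M.f (prev (hist ξ τ (pt s))) (ξ τ (pt s)) :=
  congrFun (embed_injective hp h.init) s

theorem embed_f (M : Model Ξ nx nu) (p : S → ℝ) (ξ : ℕ → Ω → Ξ) (pt : S → Ω) (t : ℕ)
    (g : S → StateControl nx nu) :
    embed p (fun s => M.f (g s) (ξ t (pt s)))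
      = (scenarioChain M p ξ pt).A t (embed p fun s => (g s).fst)
        + (scenarioChain M p ξ pt).B t (embed p fun s => (g s).snd)
        + embed p fun s => M.d (ξ t (pt s)) := by
  simp only [scenarioChain, mulOp_embed, embed_add]
  rfl

theorem SolvesSystem.dyn_eq (h : SolvesSystem M p ξ pt τ N prev w l) (hp : ∀ s, 0 < p s) {t : ℕ}
    (h1 : τ ≤ t) (h2 : t < N) (s : S) :
    (w (t + 1) (hist ξ (t + 1) (pt s))).fst
      = M.f (w t (hist ξ t (pt s))) (ξ (t + 1) (pt s)) := by
  have := h.dyn t h1 h2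
  rw [← embed_f] at this
  exact congrFun (embed_injective hp this) s

/-- The second-order expansion of the quadratic cost is exact. Of the remainder `½ ⟪x, Q x⟫ + ½ ⟪u,
R u⟫` the first term is dropped and the second bounded below by `γ / 2 * ‖u‖ ^ 2`. -/
theorem Model.cost_sub_ge (M : Model Ξ nx nu) {z : Ξ} (hQ : (M.Q z).PosSemidef)
    (hR : (M.R z - γ • (1 : Matrix (Fin nu) (Fin nu) ℝ)).PosSemidef) (a b : StateControl nx nu) :
    (inner ℝ (Matrix.toEuclideanLin (CFC.sqrt (M.Q z)) a.fst)
        (Matrix.toEuclideanLin (CFC.sqrt (M.Q z)) (b.fst - a.fst))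
      - inner ℝ (M.q z) (b.fst - a.fst)
      + (inner ℝ (Matrix.toEuclideanLin (M.R z) a.snd) (b.snd - a.snd)
        - inner ℝ (M.r z) (b.snd - a.snd)))
      + γ / 2 * ‖b.snd - a.snd‖ ^ 2 ≤ M.cost b z - M.cost a z := by
  obtain ⟨x, hx⟩ : ∃ x, x = b.fst - a.fst := ⟨_, rfl⟩
  obtain ⟨u, hu⟩ : ∃ u, u = b.snd - a.snd := ⟨_, rfl⟩
  have hb1 : b.fst = a.fst + x := by rw [hx]; abel
  have hb2 : b.snd = a.snd + u := by rw [hu]; abel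
  rw [← hx, ← hu, inner_sqrt_sqrt hQ]
  have e1 := inner_toEuclideanLin_comm hQ.isHermitian x a.fst
  have e2 := inner_toEuclideanLin_comm (isHermitian_of_sub_smul_one hR) a.snd u
  have e3 := coercive_of_sub_smul_one hR u
  have e4 : 0 ≤ inner ℝ x (Matrix.toEuclideanLin (M.Q z) x) := by
    rw [← inner_sqrt_sqrt hQ]
    exact real_inner_self_nonneg
  have e5 := real_inner_comm (Matrix.toEuclideanLin (M.Q z) x) a.fst
  have e6 := real_inner_comm (Matrix.toEuclideanLin (M.R z) a.snd) u
  have e7 := real_inner_comm (Matrix.toEuclideanLin (M.R z) u) u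
  simp only [Model.cost, hb1, hb2, map_add, inner_add_left, inner_add_right]
  linarith

/-- Optimality gap of a feasible process on the scenarios `J` that pass through the history `h`. -/
theorem SolvesSystem.gap (hw : SolvesSystem M p ξ pt τ N prev w l) (h : RegularOn M G ξ T L α γ)
    (hG : ∀ s, pt s ∈ G) (hp : ∀ s, 0 < p s) (hτ : τ ≤ N) (hN : N ≤ T)
    {h₀ : Fin (τ + 1) → Ξ} {J : Finset S} (hJ : ∀ s, s ∈ J ↔ hist ξ τ (pt s) = h₀)
    (hv0 : ∀ s ∈ J, (v τ (hist ξ τ (pt s))).fst = M.f (prev h₀) (ξ τ (pt s)))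
    (hv : ∀ s ∈ J, ∀ t, τ ≤ t → t < N → (v (t + 1) (hist ξ (t + 1) (pt s))).fst
      = M.f (v t (hist ξ t (pt s))) (ξ (t + 1) (pt s))) :
    γ / 2 * ∑ s ∈ J, p s * ∑ t ∈ Finset.Icc τ N,
        ‖(v t (hist ξ t (pt s))).snd - (w t (hist ξ t (pt s))).snd‖ ^ 2
      ≤ ∑ s ∈ J, p s * ∑ t ∈ Finset.Icc τ N, M.cost (v t (hist ξ t (pt s))) (ξ t (pt s))
        - ∑ s ∈ J, p s * ∑ t ∈ Finset.Icc τ N, M.cost (w t (hist ξ t (pt s))) (ξ t (pt s)) := by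
  classical
  set dx : ℕ → S → EuclideanSpace ℝ (Fin nx) := fun t s =>
    (v t (hist ξ t (pt s))).fst - (w t (hist ξ t (pt s))).fst with hdx
  set du : ℕ → S → EuclideanSpace ℝ (Fin nu) := fun t s =>
    (v t (hist ξ t (pt s))).snd - (w t (hist ξ t (pt s))).snd with hdu
  -- Membership in `J` is decided by `ξ_{0:τ}`, hence by `ξ_{0:t}` for `t ≥ τ`. The direction `v -
  -- w` cut off outside the branch is therefore still adapted, and joint stationarity localizes to
  -- the branch.
  have hpre : ∀ t (ht : τ ≤ t) s, s ∈ J ↔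
      (fun i : Fin (τ + 1) => hist ξ t (pt s) ⟨i, by omega⟩) = h₀ := fun t ht s => hJ s
  have key := hw.sum_eq_zero hτ (δx := fun t => embed p fun s => if s ∈ J then dx t s else 0)
    (δu := fun t => embed p fun s => if s ∈ J then du t s else 0) ?_ ?_ ?_ ?_
  rotate_left
  · intro t h1 h2
    refine ⟨fun h' => if (fun i : Fin (τ + 1) => h' ⟨i, by omega⟩) = h₀
      then (v t h').fst - (w t h').fst else 0, ?_⟩
    simp only [← hpre t h1]
    rfl
  · intro t h1 h2
    refine ⟨fun h' => if (fun i : Fin (τ + 1) => h' ⟨i, by omega⟩) = h₀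
      then (v t h').snd - (w t h').snd else 0, ?_⟩
    simp only [← hpre t h1]
    rfl
  · have : (fun s => if s ∈ J then dx τ s else 0) = fun _ => 0 := by
      funext s
      split_ifs with hs
      · simp only [hdx]
        rw [hv0 s hs, hw.init_eq hp s, (hJ s).mp hs, sub_self]
      · rfl
    simp only [this]
    ext1 s
    simp [embed]
  · intro t h1 h2
    simp only [scenarioChain, mulOp_embed, embed_add]
    congr 1
    funext s
    split_ifs with hs
    · simp only [hdx, hdu]
      rw [hv s hs t h1 h2, hw.dyn_eq hp h1 h2 s, map_sub, map_sub]
      simp only [Model.f]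
      abel
    · simp
  have stage : ∀ t ∈ Finset.Icc τ N, ∑ s ∈ J, p s *
      (inner ℝ (Matrix.toEuclideanLin (CFC.sqrt (M.Q (ξ t (pt s)))) (w t (hist ξ t (pt s))).fst)
        (Matrix.toEuclideanLin (CFC.sqrt (M.Q (ξ t (pt s)))) (dx t s))
      - inner ℝ (M.q (ξ t (pt s))) (dx t s)
      + (inner ℝ (Matrix.toEuclideanLin (M.R (ξ t (pt s))) (w t (hist ξ t (pt s))).snd) (du t s)
        - inner ℝ (M.r (ξ t (pt s))) (du t s))) = 
      (inner ℝ ((scenarioChain M p ξ pt).C t (embed p fun s => (w t (hist ξ t (pt s))).fst))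
        ((scenarioChain M p ξ pt).C t (embed p fun s => if s ∈ J then dx t s else 0))
      - inner ℝ (embed p fun s => M.q (ξ t (pt s))) (embed p fun s => if s ∈ J then dx t s else 0)
      + (inner ℝ ((scenarioChain M p ξ pt).R t (embed p fun s => (w t (hist ξ t (pt s))).snd))
        (embed p fun s => if s ∈ J then du t s else 0)
        - inner ℝ (embed p fun s => M.r (ξ t (pt s)))
          (embed p fun s => if s ∈ J then du t s else 0))) := by
    intro t _
    simp only [scenarioChain, mulOp_embed, inner_embed hp]
    rw [← Finset.sum_sub_distrib, ← Finset.sum_sub_distrib, ← Finset.sum_add_distrib]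
    rw [← Finset.sum_subset (Finset.subset_univ J)]
    · refine Finset.sum_congr rfl fun s hs => ?_
      simp only [hs, if_true]
      ring
    · intro s _ hs
      simp [hs]
  rw [← Finset.sum_congr rfl stage, Finset.sum_comm] at key
  simp only [← Finset.mul_sum] at key
  rw [← Finset.sum_sub_distrib, Finset.mul_sum]
  rw [← add_zero (∑ i ∈ J, γ / 2 * _), ← key, ← Finset.sum_add_distrib]
  refine Finset.sum_le_sum fun s _ => ?_
  rw [← mul_sub, ← Finset.sum_sub_distrib, mul_left_comm, ← mul_add]
  refine mul_le_mul_of_nonneg_left ?_ (hp s).le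
  rw [Finset.mul_sum, ← Finset.sum_add_distrib]
  refine Finset.sum_le_sum fun t ht => ?_
  have htT : t ≤ T := (Finset.mem_Icc.mp ht).2.trans hN
  rw [add_comm]
  exact M.cost_sub_ge (h.Q_psd t htT _ (hG s)) (h.R_pd t htT _ (hG s)) _ _

/-- A feasible process that is not worse than the solution of the optimality system agrees
with it. -/
theorem SolvesSystem.eq_of_le (hw : SolvesSystem M p ξ pt τ N prev w l)
    (h : RegularOn M G ξ T L α γ)
    (hG : ∀ s, pt s ∈ G) (hp : ∀ s, 0 < p s) (hτ : τ ≤ N) (hN : N ≤ T)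
    {h₀ : Fin (τ + 1) → Ξ} {J : Finset S} (hJ : ∀ s, s ∈ J ↔ hist ξ τ (pt s) = h₀)
    (hv0 : ∀ s ∈ J, (v τ (hist ξ τ (pt s))).fst = M.f (prev h₀) (ξ τ (pt s)))
    (hv : ∀ s ∈ J, ∀ t, τ ≤ t → t < N → (v (t + 1) (hist ξ (t + 1) (pt s))).fst
      = M.f (v t (hist ξ t (pt s))) (ξ (t + 1) (pt s)))
    (hle : ∑ s ∈ J, p s * ∑ t ∈ Finset.Icc τ N, M.cost (v t (hist ξ t (pt s))) (ξ t (pt s))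
      ≤ ∑ s ∈ J, p s * ∑ t ∈ Finset.Icc τ N, M.cost (w t (hist ξ t (pt s))) (ξ t (pt s)))
    {s : S} (hs : s ∈ J) {t : ℕ} (h1 : τ ≤ t) (h2 : t ≤ N) :
    v t (hist ξ t (pt s)) = w t (hist ξ t (pt s)) := by
  have hgap := hw.gap h hG hp hτ hN hJ hv0 hv
  have hγ := h.γ_pos
  have hnn : ∀ s ∈ J, 0 ≤ p s * ∑ t ∈ Finset.Icc τ N,
      ‖(v t (hist ξ t (pt s))).snd - (w t (hist ξ t (pt s))).snd‖ ^ 2 := fun s _ =>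
    mul_nonneg (hp s).le (Finset.sum_nonneg fun t _ => sq_nonneg _)
  have hsum : ∑ s ∈ J, p s * ∑ t ∈ Finset.Icc τ N,
      ‖(v t (hist ξ t (pt s))).snd - (w t (hist ξ t (pt s))).snd‖ ^ 2 = 0 := by
    refine le_antisymm ?_ (Finset.sum_nonneg hnn)
    by_contra hc
    push Not at hc
    have := mul_pos (half_pos hγ) hc
    linarith
  have hs0 := (Finset.sum_eq_zero_iff_of_nonneg hnn).mp hsum s hs
  have hs1 := (mul_eq_zero.mp hs0).resolve_left (hp s).ne'
  rw [Finset.sum_eq_zero_iff_of_nonneg fun t _ => sq_nonneg _] at hs1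
  -- The gap identifies the controls only, `Q` being merely semidefinite; the states then agree by
  -- the dynamics.
  have hsnd : ∀ t, τ ≤ t → t ≤ N →
      (v t (hist ξ t (pt s))).snd = (w t (hist ξ t (pt s))).snd := fun t h1 h2 => by
    have := hs1 t (Finset.mem_Icc.mpr ⟨h1, h2⟩)
    rwa [sq_eq_zero_iff, norm_eq_zero, sub_eq_zero] at this
  have hext : ∀ a b : StateControl nx nu, a.fst = b.fst → a.snd = b.snd → a = b :=
    fun a b ha hb => (WithLp.equiv 2 _).injective (Prod.ext ha hb)
  induction t, h1 using Nat.le_induction with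
  | base =>
    refine hext _ _ ?_ (hsnd τ le_rfl h2)
    rw [hv0 s hs, hw.init_eq hp s, (hJ s).mp hs]
  | succ t ht ih =>
    refine hext _ _ ?_ (hsnd (t + 1) (by omega) h2)
    rw [hv s hs t ht h2, hw.dyn_eq hp ht h2 s, ih (by omega)]

end Branch

/-! ### Reduction to a finite set of scenarios -/

section Histories

variable {Ω Ξ : Type*} {ξ : ℕ → Ω → Ξ} {T : ℕ}

theorem apply_eq_of_hist_eq {t : ℕ} {ω ω' : Ω} (h : hist ξ t ω = hist ξ t ω') {i : ℕ}
    (hi : i ≤ t) : ξ i ω = ξ i ω' :=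
  congrFun h ⟨i, by omega⟩

theorem hist_eq_of_hist_eq {t : ℕ} {ω ω' : Ω} (h : hist ξ T ω = hist ξ T ω') (ht : t ≤ T) :
    hist ξ t ω = hist ξ t ω' :=
  funext fun i => apply_eq_of_hist_eq h (by omega)

variable [MeasurableSpace Ω]

theorem measureReal_cond_apply {P : Measure Ω} {s : Set Ω} (hs : MeasurableSet s) (t : Set Ω) :
    (ProbabilityTheory.cond P s).real t = (P.real s)⁻¹ * P.real (s ∩ t) := by
  simp only [measureReal_def, cond_apply hs, ENNReal.toReal_mul, ENNReal.toReal_inv]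

theorem measurableSet_hist [MeasurableSpace Ξ] [MeasurableSingletonClass Ξ]
    (hξ : ∀ t ≤ T, Measurable (ξ t)) {t : ℕ} (ht : t ≤ T) (h : Fin (t + 1) → Ξ) :
    MeasurableSet {ω | hist ξ t ω = h} := by
  have : {ω | hist ξ t ω = h} = ⋂ i : Fin (t + 1), ξ i ⁻¹' {h i} := by
    ext ω
    simp [hist, funext_iff]
  rw [this]
  exact MeasurableSet.iInter fun i => hξ i (by omega) (measurableSet_singleton _)

theorem mem_histSupportFrom_hist_iff {P : Measure Ω} {τ t : ℕ} (ht : τ ≤ t)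
    {h : Fin (τ + 1) → Ξ} {ω : Ω} :
    hist ξ t ω ∈ histSupportFrom P ξ h t ↔ hist ξ t ω ∈ histSupport P ξ t ∧ hist ξ τ ω = h := by
  refine and_congr_right fun _ => ⟨fun H => ?_, fun H i j hij => ?_⟩
  · exact funext fun i => H i ⟨i, by omega⟩ rfl
  · rw [← H]
    simp only [hist, hij]

variable {P : Measure Ω}

theorem finite_histSupport (hfin : FiniteSupport P ξ T) : (histSupport P ξ T).Finite := by
  obtain ⟨S, hS, hae⟩ := hfin
  refine hS.subset fun h hh => ?_
  by_contra hn
  refine hh (measure_mono_null (fun ω hω => ?_) (ae_iff.mp hae))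
  have hω : hist ξ T ω = h := hω
  simpa [hω] using hn

theorem ae_mem_histSupport (hfin : FiniteSupport P ξ T) :
    ∀ᵐ ω ∂P, hist ξ T ω ∈ histSupport P ξ T := by
  obtain ⟨S, hS, hae⟩ := hfin
  have h1 : ∀ᵐ ω ∂P, ∀ h ∈ S, P {ω | hist ξ T ω = h} = 0 → hist ξ T ω ≠ h := by
    rw [ae_ball_iff hS.countable]
    intro h _
    by_cases h0 : P {ω | hist ξ T ω = h} = 0
    · have : ∀ᵐ ω ∂P, hist ξ T ω ≠ h := by
        rw [ae_iff]
        simpa using h0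
      filter_upwards [this] with ω hω _ using hω
    · exact Filter.Eventually.of_forall fun ω h2 => (h0 h2).elim
  filter_upwards [hae, h1] with ω h2 h3 h4
  exact h3 _ h2 h4 rfl

theorem exists_mem_of_ae {ν : Measure Ω} {A : Set Ω} (hA : ν A ≠ 0) {p : Ω → Prop}
    (hp : ∀ᵐ ω ∂ν, p ω) : ∃ ω ∈ A, p ω := by
  by_contra hn
  push Not at hn
  exact hA (measure_mono_null (fun ω hω => hn ω hω) (ae_iff.mp hp))

/-- Measurability of `g` is not needed: it agrees almost everywhere with a finite combination of
indicators of atoms. -/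
theorem integral_eq_sum_scenarios {S : Type*} [Fintype S] {ν : Measure Ω} [IsFiniteMeasure ν]
    {pt : S → Ω} (hinj : ∀ s s', hist ξ T (pt s) = hist ξ T (pt s') → s = s')
    (hmeas : ∀ h, MeasurableSet {ω | hist ξ T ω = h})
    (hae : ∀ᵐ ω ∂ν, ∃ s, hist ξ T ω = hist ξ T (pt s)) {g : Ω → ℝ}
    (hg : ∀ ω ω', hist ξ T ω = hist ξ T ω' → g ω = g ω') :
    ∫ ω, g ω ∂ν = ∑ s, ν.real {ω | hist ξ T ω = hist ξ T (pt s)} * g (pt s) := by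
  have e1 : g =ᵐ[ν] fun ω => ∑ s,
      ({ω | hist ξ T ω = hist ξ T (pt s)}.indicator fun _ => g (pt s)) ω := by
    filter_upwards [hae] with ω ⟨s, hs⟩
    rw [Finset.sum_eq_single s]
    · rw [Set.indicator_of_mem (show ω ∈ {ω | hist ξ T ω = hist ξ T (pt s)} from hs)]
      exact hg _ _ hs
    · intro s' _ hne
      refine Set.indicator_of_notMem (fun h => hne (hinj _ _ ?_)) _
      exact (show hist ξ T ω = hist ξ T (pt s') from h).symm.trans hs
    · exact fun h => (h (Finset.mem_univ s)).elim
  rw [integral_congr_ae e1, integral_finsetSum]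
  · refine Finset.sum_congr rfl fun s _ => ?_
    rw [integral_indicator_const _ (hmeas _), smul_eq_mul]
  · exact fun s _ => (integrable_const _).indicator (hmeas _)

/-- A finite set of scenarios `pt s` in `G` with weights `p s`, which represents the law of
`ξ_{0:T}` conditioned on `ξ_0 = s₀`. -/
structure Scenarios (P : Measure Ω) (ξ : ℕ → Ω → Ξ) (T : ℕ) (s₀ : Ξ) (G : Set Ω) {S : Type*}
    [Fintype S] (p : S → ℝ) (pt : S → Ω) : Prop where
  pos : ∀ s, 0 < p s
  mem : ∀ s, pt s ∈ G
  hist_mem : ∀ s, ∀ t ≤ T, hist ξ t (pt s) ∈ histSupportFrom P ξ (root s₀) t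
  exists_hist : ∀ t ≤ T, ∀ h ∈ histSupportFrom P ξ (root s₀) t, ∃ s, hist ξ t (pt s) = h
  integral_root : ∀ g : Ω → ℝ, (∀ ω ω', hist ξ T ω = hist ξ T ω' → g ω = g ω') →
    ∫ ω, g ω ∂(condHist P ξ (root s₀)) = ∑ s, p s * g (pt s)
  integral_branch : ∀ τ ≤ T, ∀ h ∈ histSupportFrom P ξ (root s₀) τ, ∃ C : ℝ, 0 < C ∧
    ∀ J : Finset S, (∀ s, s ∈ J ↔ hist ξ τ (pt s) = h) →
      ∀ g : Ω → ℝ, (∀ ω ω', hist ξ T ω = hist ξ T ω' → g ω = g ω') →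
        ∫ ω, g ω ∂(condHist P ξ h) = C * ∑ s ∈ J, p s * g (pt s)

/-- One outcome is picked for each atom of `ξ_{0:T}` starting at `s₀`; it can be taken in `G` since
the atom has positive conditional probability. The weights are these conditional probabilities. -/
theorem exists_scenarios [MeasurableSpace Ξ] [MeasurableSingletonClass Ξ] [IsProbabilityMeasure P]
    (hξ : ∀ t ≤ T, Measurable (ξ t)) (hfin : FiniteSupport P ξ T)
    {s₀ : Ξ} (hs₀ : root s₀ ∈ histSupport P ξ 0) {G : Set Ω}
    (hG : ∀ᵐ ω ∂(condHist P ξ (root s₀)), ω ∈ G) :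
    ∃ (n : ℕ) (p : Fin n → ℝ) (pt : Fin n → Ω), Scenarios P ξ T s₀ G p pt := by
  have hmeas := fun {t : ℕ} (ht : t ≤ T) h => measurableSet_hist (ξ := ξ) hξ ht h
  have hreal : ∀ {t : ℕ} {h : Fin (t + 1) → Ξ}, h ∈ histSupport P ξ t →
      0 < P.real {ω | hist ξ t ω = h} := fun hh =>
    measureReal_nonneg.lt_of_ne fun h0 => hh ((measureReal_eq_zero_iff).mp h0.symm)
  have hSfin : (histSupportFrom P ξ (root s₀) T).Finite :=
    (finite_histSupport hfin).subset fun h hh => hh.1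
  obtain ⟨n, ⟨enum⟩⟩ : ∃ n, Nonempty (Fin n ≃ histSupportFrom P ξ (root s₀) T) := by
    have := hSfin.to_subtype
    obtain ⟨n, ⟨e⟩⟩ := Finite.exists_equiv_fin (histSupportFrom P ξ (root s₀) T)
    exact ⟨n, ⟨e.symm⟩⟩
  have hroot : ∀ h ∈ histSupportFrom P ξ (root s₀) T,
      condHist P ξ (root s₀) {ω | hist ξ T ω = h} ≠ 0 := by
    intro h hh
    have hsub : {ω | hist ξ 0 ω = root s₀} ∩ {ω | hist ξ T ω = h} = {ω | hist ξ T ω = h} := by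
      refine Set.inter_eq_right.mpr fun ω hω => ?_
      have hω : hist ξ T ω = h := hω
      rw [← hω] at hh
      exact ((mem_histSupportFrom_hist_iff (Nat.zero_le T)).mp hh).2
    rw [condHist, cond_apply (hmeas (Nat.zero_le T) _), hsub]
    exact mul_ne_zero (ENNReal.inv_ne_zero.mpr (measure_ne_top _ _)) hh.1
  have hpt : ∀ i : Fin n, ∃ ω, hist ξ T ω = (enum i).1 ∧ ω ∈ G := fun i =>
    exists_mem_of_ae (hroot _ (enum i).2) hG
  choose pt hpt1 hpt2 using hpt
  have hinj : ∀ i j, hist ξ T (pt i) = hist ξ T (pt j) → i = j := fun i j hij => by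
    rw [hpt1, hpt1] at hij
    exact enum.injective (Subtype.ext hij)
  have hsurj : ∀ ω, hist ξ T ω ∈ histSupportFrom P ξ (root s₀) T →
      ∃ i, hist ξ T ω = hist ξ T (pt i) := fun ω hω =>
    ⟨enum.symm ⟨_, hω⟩, by rw [hpt1, Equiv.apply_symm_apply]⟩
  have hT : ∀ i, hist ξ T (pt i) ∈ histSupportFrom P ξ (root s₀) T := fun i => by
    rw [hpt1]
    exact (enum i).2
  have hsup : ∀ i, ∀ t ≤ T, hist ξ t (pt i) ∈ histSupport P ξ t := by
    intro i t ht h0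
    refine (hT i).1 (measure_mono_null (fun ω hω => ?_) h0)
    exact hist_eq_of_hist_eq (show hist ξ T ω = hist ξ T (pt i) from hω) ht
  have hzero : ∀ i, hist ξ 0 (pt i) = root s₀ := fun i =>
    ((mem_histSupportFrom_hist_iff (Nat.zero_le T)).mp (hT i)).2
  have hback : ∀ {t : ℕ}, t ≤ T → ∀ {h : Fin (t + 1) → Ξ}, h ∈ histSupportFrom P ξ (root s₀) t →
      ∀ ω, hist ξ t ω = h → hist ξ 0 ω = root s₀ := by
    intro t ht h hh ω hω
    rw [← hω] at hh
    exact ((mem_histSupportFrom_hist_iff (Nat.zero_le t)).mp hh).2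
  have hcover : ∀ t ≤ T, ∀ h ∈ histSupportFrom P ξ (root s₀) t,
      ∀ᵐ ω ∂(condHist P ξ h), ∃ i, hist ξ T ω = hist ξ T (pt i) := by
    intro t ht h hh
    have h1 : ∀ᵐ ω ∂(condHist P ξ h), hist ξ t ω = h := ae_cond_mem (hmeas ht h)
    have h2 : ∀ᵐ ω ∂(condHist P ξ h), hist ξ T ω ∈ histSupport P ξ T :=
      cond_absolutelyContinuous.ae_le (ae_mem_histSupport hfin)
    filter_upwards [h1, h2] with ω h3 h4
    exact hsurj ω ((mem_histSupportFrom_hist_iff (Nat.zero_le T)).mpr ⟨h4, hback ht hh ω h3⟩)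
  have hrootmem : root s₀ ∈ histSupportFrom P ξ (root s₀) 0 :=
    ⟨hs₀, fun i j _ => rfl⟩
  have hweight : ∀ t ≤ T, ∀ h : Fin (t + 1) → Ξ, ∀ i, hist ξ t (pt i) = h →
      (condHist P ξ h).real {ω | hist ξ T ω = hist ξ T (pt i)}
        = (P.real {ω | hist ξ t ω = h})⁻¹ * P.real {ω | hist ξ T ω = hist ξ T (pt i)} := by
    intro t ht h i hi
    rw [condHist, measureReal_cond_apply (hmeas ht h)]
    congr 2
    refine Set.inter_eq_right.mpr fun ω hω => ?_
    exact (hist_eq_of_hist_eq (show hist ξ T ω = hist ξ T (pt i) from hω) ht).trans hi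
  refine ⟨n, fun i => (condHist P ξ (root s₀)).real {ω | hist ξ T ω = hist ξ T (pt i)}, pt,
    ?_, hpt2, ?_, ?_, ?_, ?_⟩
  · intro i
    rw [hweight 0 (Nat.zero_le T) _ i (hzero i)]
    exact mul_pos (inv_pos.mpr (hreal hs₀)) (hreal (hT i).1)
  · exact fun i t ht => (mem_histSupportFrom_hist_iff (Nat.zero_le t)).mpr ⟨hsup i t ht, hzero i⟩
  · intro t ht h hh
    obtain ⟨ω, hω1, hω2⟩ := exists_mem_of_ae hh.1 (ae_mem_histSupport hfin)
    obtain ⟨i, hi⟩ := hsurj ω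
      ((mem_histSupportFrom_hist_iff (Nat.zero_le T)).mpr ⟨hω2, hback ht hh ω hω1⟩)
    exact ⟨i, (hist_eq_of_hist_eq hi ht).symm.trans hω1⟩
  · intro g hg
    have : IsFiniteMeasure (condHist P ξ (root s₀)) := by unfold condHist; infer_instance
    exact integral_eq_sum_scenarios hinj (hmeas le_rfl) (hcover 0 (Nat.zero_le T) _ hrootmem) hg
  · intro τ hτ h hh
    have : IsFiniteMeasure (condHist P ξ h) := by unfold condHist; infer_instance
    have k1 := hreal hh.1
    have k2 := hreal hs₀
    -- The ratio converts probabilities given the root into probabilities given `h`. Only its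
    -- positivity matters when objectives are compared.
    refine ⟨(P.real {ω | hist ξ τ ω = h})⁻¹ * P.real {ω | hist ξ 0 ω = root s₀}, by positivity,
      fun J hJ g hg => ?_⟩
    rw [integral_eq_sum_scenarios hinj (hmeas le_rfl) (hcover τ hτ h hh) hg, Finset.mul_sum,
      ← Finset.sum_subset (Finset.subset_univ J)]
    · refine Finset.sum_congr rfl fun i hi => ?_
      rw [hweight τ hτ h i ((hJ i).mp hi), hweight 0 (Nat.zero_le T) _ i (hzero i)]
      field_simp
    · intro i _ hi
      have hempty : {ω | hist ξ τ ω = h} ∩ {ω | hist ξ T ω = hist ξ T (pt i)} = ∅ := by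
        refine Set.eq_empty_of_forall_notMem fun ω hω => hi ((hJ i).mpr ?_)
        exact (hist_eq_of_hist_eq (show hist ξ T ω = hist ξ T (pt i) from hω.2) hτ).symm.trans hω.1
      rw [condHist, measureReal_cond_apply (hmeas hτ h), hempty]
      simp

end Histories

/-! ### The truncated problems and the policy -/

section PolicyBound

variable {Ω Ξ : Type*} [MeasurableSpace Ω] {nx nu : ℕ} {S : Type*} [Fintype S]
  {M : Model Ξ nx nu} {P : Measure Ω} {p : S → ℝ} {ξ : ℕ → Ω → Ξ} {pt : S → Ω} {T W τ : ℕ}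
  {L α γ : ℝ} {G : Set Ω} {s₀ : Ξ} {prev : (Fin (τ + 1) → Ξ) → StateControl nx nu}
  {w : Decisions Ξ nx nu} {l : ℕ → Field S nx}

/-- On a branch the objective is a positive constant times the weighted sum over its scenarios, so
`SolvesSystem.gap` gives minimality and `SolvesSystem.eq_of_le` uniqueness. -/
theorem Scenarios.isSolution (sc : Scenarios P ξ T s₀ G p pt) (h : RegularOn M G ξ T L α γ)
    (hτ : τ ≤ T) (hw : SolvesSystem M p ξ pt τ (min (τ + W) T) prev w l)
    {h₀ : Fin (τ + 1) → Ξ} (hh : h₀ ∈ histSupportFrom P ξ (root s₀) τ) :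
    IsSolution M P ξ T W τ h₀ (prev h₀) w ∧ ∀ v, IsSolution M P ξ T W τ h₀ (prev h₀) v →
      ∀ t, τ ≤ t → t ≤ min (τ + W) T → ∀ h' ∈ histSupportFrom P ξ h₀ t, v t h' = w t h' := by
  classical
  have hp := sc.pos
  have hle : τ ≤ min (τ + W) T := by omega
  have hN : min (τ + W) T ≤ T := by omega
  obtain ⟨C, hC, hint⟩ := sc.integral_branch τ hτ h₀ hh
  set J := Finset.univ.filter fun s => hist ξ τ (pt s) = h₀ with hJdef
  have hJ : ∀ s, s ∈ J ↔ hist ξ τ (pt s) = h₀ := fun s => by simp [hJdef]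
  have hobj : ∀ v : Decisions Ξ nx nu, objective M P ξ T W τ h₀ v
      = C * ∑ s ∈ J, p s * ∑ t ∈ Finset.Icc τ (min (τ + W) T),
        M.cost (v t (hist ξ t (pt s))) (ξ t (pt s)) := fun v => by
    refine hint J hJ _ fun ω ω' hω => Finset.sum_congr rfl fun t ht => ?_
    have htT : t ≤ T := (Finset.mem_Icc.mp ht).2.trans hN
    rw [hist_eq_of_hist_eq hω htT, apply_eq_of_hist_eq hω htT]
  have hbranch : ∀ t, τ ≤ t → t ≤ T → ∀ h' ∈ histSupportFrom P ξ h₀ t, ∃ s ∈ J,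
      hist ξ t (pt s) = h' := by
    intro t h1 h2 h' hh'
    obtain ⟨s₁, hs₁⟩ := sc.exists_hist τ hτ h₀ hh
    have h0 : h' ∈ histSupportFrom P ξ (root s₀) t := by
      refine ⟨hh'.1, fun i j hij => ?_⟩
      have hj : (j : ℕ) = 0 := by omega
      rw [hh'.2 ⟨0, by omega⟩ j hj.symm]
      exact hh.2 0 ⟨0, by omega⟩ rfl
    obtain ⟨s, hs⟩ := sc.exists_hist t h2 h' h0
    refine ⟨s, (hJ s).mpr ?_, hs⟩
    rw [← hs] at hh'
    exact ((mem_histSupportFrom_hist_iff h1).mp hh').2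
  have hfeas0 : ∀ v, Feasible M P ξ T W τ h₀ (prev h₀) v → ∀ s ∈ J,
      (v τ (hist ξ τ (pt s))).fst = M.f (prev h₀) (ξ τ (pt s)) := fun v hv s hs => by
    have := hv.1
    rw [← (hJ s).mp hs] at this ⊢
    exact this
  have hfeas : ∀ v, Feasible M P ξ T W τ h₀ (prev h₀) v → ∀ s ∈ J, ∀ t, τ ≤ t →
      t < min (τ + W) T → (v (t + 1) (hist ξ (t + 1) (pt s))).fst
        = M.f (v t (hist ξ t (pt s))) (ξ (t + 1) (pt s)) := fun v hv s hs t h1 h2 => by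
    refine hv.2 t h1 h2 (hist ξ (t + 1) (pt s)) ?_
    exact (mem_histSupportFrom_hist_iff (by omega)).mpr
      ⟨(sc.hist_mem s (t + 1) (by omega)).1, (hJ s).mp hs⟩
  have hwfeas : Feasible M P ξ T W τ h₀ (prev h₀) w := by
    constructor
    · obtain ⟨s, hs⟩ := sc.exists_hist τ hτ h₀ hh
      rw [← hs]
      exact hw.init_eq hp s
    · intro t h1 h2 h' hh'
      obtain ⟨s, -, rfl⟩ := hbranch (t + 1) (by omega) (by omega) h' hh'
      exact hw.dyn_eq hp h1 h2 s
  have hγ := h.γ_pos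
  refine ⟨⟨hwfeas, fun v hv => ?_⟩, fun v hv t h1 h2 h' hh' => ?_⟩
  · have := hw.gap h sc.mem hp hle hN hJ (hfeas0 v hv) (hfeas v hv)
    have h0 : 0 ≤ γ / 2 * ∑ s ∈ J, p s * ∑ t ∈ Finset.Icc τ (min (τ + W) T),
        ‖(v t (hist ξ t (pt s))).snd - (w t (hist ξ t (pt s))).snd‖ ^ 2 :=
      mul_nonneg (half_pos hγ).le (Finset.sum_nonneg fun s _ =>
        mul_nonneg (hp s).le (Finset.sum_nonneg fun t _ => sq_nonneg _))
    rw [hobj, hobj]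
    exact mul_le_mul_of_nonneg_left (by linarith) hC.le
  · obtain ⟨s, hs, rfl⟩ := hbranch t h1 (by omega) h' hh'
    have hle' := hv.2 w hwfeas
    rw [hobj, hobj] at hle'
    exact hw.eq_of_le h sc.mem hp hle hN hJ (hfeas0 v hv.1) (hfeas v hv.1)
      (le_of_mul_le_mul_left hle' hC) hs h1 h2

theorem Scenarios.hasUniqueSolution (sc : Scenarios P ξ T s₀ G p pt)
    (h : RegularOn M G ξ T L α γ) (hτ : τ ≤ T) {h₀ : Fin (τ + 1) → Ξ}
    (hh : h₀ ∈ histSupportFrom P ξ (root s₀) τ) (w' : StateControl nx nu) :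
    HasUniqueSolution M P ξ T W τ h₀ w' := by
  obtain ⟨w, l, hw⟩ := h.exists_solvesSystem sc.mem p (show τ ≤ min (τ + W) T by omega)
    (by omega) fun _ => w'
  exact ⟨w, sc.isSolution h hτ hw hh⟩

/-- The state and control that precede stage `t` in closed loop. -/
def prevPolicy (M : Model Ξ nx nu) (P : Measure Ω) (ξ : ℕ → Ω → Ξ) (T W : ℕ)
    (w₀ : StateControl nx nu) : (t : ℕ) → (Fin (t + 1) → Ξ) → StateControl nx nu
  | 0, _ => w₀
  | t + 1, h => policy M P ξ T W w₀ t (Fin.init h)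

theorem policy_eq (w₀ : StateControl nx nu) (t : ℕ) (h : Fin (t + 1) → Ξ) :
    policy M P ξ T W w₀ t h
      = openLoop M P ξ T W t h (prevPolicy M P ξ T W w₀ t h) t h := by
  cases t <;> rfl

/-- The policy picks a solution separately for each history. By uniqueness these choices agree at
stage `t` with a single joint solution over all scenarios, as the closed-loop estimate requires. -/
theorem Scenarios.policy_solves (sc : Scenarios P ξ T s₀ G p pt) (h : RegularOn M G ξ T L α γ)
    (w₀ : StateControl nx nu) {t : ℕ} (ht : t ≤ T) :
    ∃ w l, SolvesSystem M p ξ pt t (min (t + W) T) (prevPolicy M P ξ T W w₀ t) w l ∧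
      ∀ s, w t (hist ξ t (pt s)) = policy M P ξ T W w₀ t (hist ξ t (pt s)) := by
  obtain ⟨w, l, hw⟩ := h.exists_solvesSystem sc.mem p (show t ≤ min (t + W) T by omega)
    (by omega) (prevPolicy M P ξ T W w₀ t)
  refine ⟨w, l, hw, fun s => ?_⟩
  have hm := sc.hist_mem s t ht
  obtain ⟨h1, h2⟩ := sc.isSolution h ht hw hm
  rw [policy_eq]
  refine (h2 _ (Classical.epsilon_spec ⟨w, h1⟩) t le_rfl (by omega) _ ?_).symm
  exact (mem_histSupportFrom_hist_iff le_rfl).mpr ⟨hm.1, rfl⟩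

theorem rms_nonneg {F : Type*} [NormedAddCommGroup F] (ν : Measure Ω) (g : Ω → F) :
    0 ≤ rms ν g := Real.sqrt_nonneg _

theorem Scenarios.rms_eq {F : Type*} [NormedAddCommGroup F] (sc : Scenarios P ξ T s₀ G p pt)
    {g : Ω → F} (hg : ∀ ω ω', hist ξ T ω = hist ξ T ω' → g ω = g ω') :
    rms (condHist P ξ (root s₀)) g = √(∑ s, p s * ‖g (pt s)‖ ^ 2) := by
  rw [rms, sc.integral_root]
  exact fun ω ω' h => by rw [hg ω ω' h]

theorem Model.norm_le_p (M : Model Ξ nx nu) (z : Ξ) :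
    ‖M.q z‖ ^ 2 ≤ ‖M.p z‖ ^ 2 ∧ ‖M.r z‖ ^ 2 ≤ ‖M.p z‖ ^ 2 ∧ ‖M.d z‖ ^ 2 ≤ ‖M.p z‖ ^ 2 := by
  have e : ‖M.p z‖ ^ 2 = ‖M.q z‖ ^ 2 + (‖M.r z‖ ^ 2 + ‖M.d z‖ ^ 2) := by
    rw [WithLp.prod_norm_sq_eq_of_L2, WithLp.prod_norm_sq_eq_of_L2]
    rfl
  have h1 := sq_nonneg ‖M.q z‖
  have h2 := sq_nonneg ‖M.r z‖
  have h3 := sq_nonneg ‖M.d z‖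
  refine ⟨?_, ?_, ?_⟩ <;> linarith

theorem norm_embed_le_rms (sc : Scenarios P ξ T s₀ G p pt) {F : Type*} [NormedAddCommGroup F]
    {k t : ℕ} (ht : t ≤ T) {a : Ξ → EuclideanSpace ℝ (Fin k)} {b : Ξ → F}
    (h : ∀ z, ‖a z‖ ^ 2 ≤ ‖b z‖ ^ 2) :
    ‖embed p fun s => a (ξ t (pt s))‖ ≤ rms (condHist P ξ (root s₀)) fun ω => b (ξ t ω) := by
  rw [sc.rms_eq fun ω ω' hω => by rw [apply_eq_of_hist_eq hω ht]]
  refine Real.le_sqrt_of_sq_le ?_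
  rw [norm_embed_sq sc.pos]
  exact Finset.sum_le_sum fun s _ => mul_le_mul_of_nonneg_left (h _) (sc.pos s).le

/-- The weights sum to one, so the deterministic pair `w̄_{-1}` keeps its norm. -/
theorem Scenarios.norm_embed_const [IsProbabilityMeasure (condHist P ξ (root s₀))]
    (sc : Scenarios P ξ T s₀ G p pt) {k : ℕ}
    (a : EuclideanSpace ℝ (Fin k)) : ‖embed p fun _ : S => a‖ = ‖a‖ := by
  have h1 := sc.integral_root (fun _ => 1) fun _ _ _ => rfl
  simp only [integral_const, probReal_univ, smul_eq_mul, mul_one] at h1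
  have h2 := norm_embed_sq sc.pos fun _ : S => a
  rw [← Finset.sum_mul, ← h1, one_mul] at h2
  exact (sq_eq_sq₀ (norm_nonneg _) (norm_nonneg _)).mp h2

theorem Scenarios.policy_bound [IsProbabilityMeasure (condHist P ξ (root s₀))]
    (sc : Scenarios P ξ T s₀ G p pt)
    (h : RegularOn M G ξ T L α γ) (hW : WBar L α γ ≤ (W : ℝ)) (w₀ : StateControl nx nu)
    {t : ℕ} (ht : t ≤ T) :
    rms (condHist P ξ (root s₀)) (fun ω => policy M P ξ T W w₀ t (hist ξ t ω)) ≤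
      c₂ L α γ * (2 * L * rho L α γ ^ ((t : ℝ) / 2) * ‖w₀‖ +
        ∑ t' ∈ Finset.range (T + 1), rho L α γ ^ (|(t : ℝ) - (t' : ℝ)| / 2) *
          rms (condHist P ξ (root s₀)) (fun ω => M.p (ξ t' ω))) := by
  have hL1 := h.one_le_L
  have hL : 0 ≤ L := by linarith
  have hα0 := h.α_pos
  have hα1 := h.α_lt_one
  have hγ0 := h.γ_pos
  have hγ1 := h.γ_le_one
  obtain ⟨hρ0, hρ1, -, hρ3⟩ := rho_bounds hL1 hα0 hα1 hγ0 hγ1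
  obtain ⟨hW1, hW2⟩ := horizon_bounds hL1 hα0 hα1 hγ0 hγ1 hW
  have hconst := gain_le_c₂ hL1 hα0 hα1 hγ0 hγ1
  have hgood := h.good (p := p) sc.mem
  set Pm : ℕ → ℝ := fun t' => rms (condHist P ξ (root s₀)) (fun ω => M.p (ξ t' ω)) with hPm
  set X : ℕ → Field S nx := fun t =>
    embed p fun s => (policy M P ξ T W w₀ t (hist ξ t (pt s))).fst with hX
  set U : ℕ → Field S nu := fun t =>
    embed p fun s => (policy M P ξ T W w₀ t (hist ξ t (pt s))).snd with hU
  have hw1 : ‖w₀.fst‖ ≤ ‖w₀‖ ∧ ‖w₀.snd‖ ≤ ‖w₀‖ := by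
    have e := WithLp.prod_norm_sq_eq_of_L2 w₀
    constructor
    · refine le_of_sq_le_sq ?_ (norm_nonneg _)
      linarith [sq_nonneg ‖w₀.snd‖]
    · refine le_of_sq_le_sq ?_ (norm_nonneg _)
      linarith [sq_nonneg ‖w₀.fst‖]
  have hy₀ : ‖embed p fun s => M.f w₀ (ξ 0 (pt s))‖ ≤ 2 * L * ‖w₀‖ + Pm 0 := by
    rw [embed_f M p ξ pt 0 fun _ => w₀]
    refine norm_add₃_le.trans ?_
    have a1 := hgood.A_bdd 0 (Nat.zero_le T) (embed p fun _ : S => w₀.fst)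
    have a2 := hgood.B_bdd 0 (Nat.zero_le T) (embed p fun _ : S => w₀.snd)
    rw [sc.norm_embed_const] at a1 a2
    have a3 := norm_embed_le_rms sc (Nat.zero_le T) (a := M.d) (b := M.p)
      fun z => (M.norm_le_p z).2.2
    have a4 := mul_le_mul_of_nonneg_left hw1.1 hL
    have a5 := mul_le_mul_of_nonneg_left hw1.2 hL
    change _ ≤ Pm 0 at a3
    linarith
  have hσ0 : 0 < √(rho L α γ) := Real.sqrt_pos.mpr hρ0
  have hσ2 := Real.sq_sqrt hρ0.le
  have hσ1 : √(rho L α γ) < 1 := by nlinarith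
  -- Applied with rate `σ = √ρ`, initial size `b = 2 * L * ‖w₀‖` and data size the second-moment
  -- root of `p`.
  have main := hgood.closed_loop_le hW1 (P := Pm) (fun _ => rms_nonneg _ _)
    (q := fun t => embed p fun s => M.q (ξ t (pt s)))
    (r := fun t => embed p fun s => M.r (ξ t (pt s)))
    (d := fun t => embed p fun s => M.d (ξ t (pt s)))
    (fun t ht => norm_embed_le_rms sc ht fun z => (M.norm_le_p z).1)
    (fun t ht => norm_embed_le_rms sc ht fun z => (M.norm_le_p z).2.1)
    (fun t ht => norm_embed_le_rms sc ht fun z => (M.norm_le_p z).2.2)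
    (by positivity) hy₀ (X := X) (U := U) ?_ hσ0 hσ1 (by rw [hσ2]; exact hρ3)
    (by rw [hσ2]; exact hW2) ht
  · have hleft : rms (condHist P ξ (root s₀)) (fun ω => policy M P ξ T W w₀ t (hist ξ t ω))
        = √(‖X t‖ ^ 2 + ‖U t‖ ^ 2) := by
      rw [sc.rms_eq fun ω ω' hω => by rw [hist_eq_of_hist_eq hω ht], norm_embed_sq sc.pos,
        norm_embed_sq sc.pos, ← Finset.sum_add_distrib]
      congr 1
      refine Finset.sum_congr rfl fun s _ => ?_
      rw [WithLp.prod_norm_sq_eq_of_L2, mul_add]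
    rw [hleft]
    refine main.trans ?_
    rw [rpow_half_eq hρ0.le]
    simp only [rpow_abs_sub_half_eq hρ0.le]
    set σ := √(rho L α γ)
    set K := 32 * Chain.gain L α γ ^ 2 * L ^ 2 / (σ ^ 4 * (1 - σ))
    have hG := Chain.gain_nonneg (α := α) hγ0 hL1
    have hK : 0 ≤ K := div_nonneg (by positivity)
      (mul_nonneg (by positivity) (by linarith))
    have hsum : 0 ≤ ∑ s ∈ Finset.range (T + 1), σ ^ Nat.dist s t * Pm s :=
      Finset.sum_nonneg fun s _ => mul_nonneg (by positivity) (rms_nonneg _ _)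
    have hb : 0 ≤ σ ^ t * (2 * L * ‖w₀‖) := by positivity
    have hGc : 4 * Chain.gain L α γ ≤ c₂ L α γ := by nlinarith
    calc _ = 4 * Chain.gain L α γ * (σ ^ t * (2 * L * ‖w₀‖)) + 4 * Chain.gain L α γ * (1 + K) *
            ∑ s ∈ Finset.range (T + 1), σ ^ Nat.dist s t * Pm s := by ring
      _ ≤ c₂ L α γ * (σ ^ t * (2 * L * ‖w₀‖)) + c₂ L α γ *
            ∑ s ∈ Finset.range (T + 1), σ ^ Nat.dist s t * Pm s :=
          add_le_add (mul_le_mul_of_nonneg_right hGc hb) (mul_le_mul_of_nonneg_right hconst hsum)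
      _ = _ := by ring
  · intro t ht
    obtain ⟨w, l, hw, hwp⟩ := sc.policy_solves (W := W) h w₀ ht
    refine ⟨fun t => embed p fun s => (w t (hist ξ t (pt s))).fst,
      fun t => embed p fun s => (w t (hist ξ t (pt s))).snd, l, ?_, ?_, ?_⟩
    · have e : (embed p fun s => M.f (prevPolicy M P ξ T W w₀ t (hist ξ t (pt s))) (ξ t (pt s)))
          = if t = 0 then embed p fun s => M.f w₀ (ξ 0 (pt s)) else
            (scenarioChain M p ξ pt).A t (X (t - 1)) + (scenarioChain M p ξ pt).B t (U (t - 1))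
              + embed p fun s => M.d (ξ t (pt s)) := by
        cases t with
        | zero => rfl
        | succ t =>
          rw [if_neg (by omega), embed_f]
          rfl
      rw [← e]
      exact hw
    · simp only [hX, hwp]
    · simp only [hU, hwp]

end PolicyBound

end SPC

end

theorem theorem3 {Ω Ξ : Type*} [MeasurableSpace Ω] [MeasurableSpace Ξ] [MeasurableSingletonClass Ξ]
    (P : Measure Ω) [IsProbabilityMeasure P] (T : ℕ) (hT : 0 < T)
    (ξ : ℕ → Ω → Ξ) (hξ : ∀ t ≤ T, Measurable (ξ t)) (hfin : SPC.FiniteSupport P ξ T)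
    {nx nu : ℕ} (M : SPC.Model Ξ nx nu)
    (s₀ : Ξ) (hs₀ : SPC.root s₀ ∈ SPC.histSupport P ξ 0)
    (L α γ : ℝ) (hreg : SPC.Regular M (SPC.condHist P ξ (SPC.root s₀)) ξ T L α γ)
    (W : ℕ) (hW : SPC.WBar L α γ ≤ (W : ℝ)) :
    -- the problems that define the policy are well posed
    (∀ τ ≤ T, ∀ h ∈ SPC.histSupportFrom P ξ (SPC.root s₀) τ, ∀ w' : SPC.StateControl nx nu,
      SPC.HasUniqueSolution M P ξ T W τ h w') ∧
    ∀ w₀ : SPC.StateControl nx nu,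
      -- the perturbation bound
      (∀ t ≤ T,
        SPC.rms (SPC.condHist P ξ (SPC.root s₀))
            (fun ω => SPC.policy M P ξ T W w₀ t (SPC.hist ξ t ω)) ≤
          SPC.c₂ L α γ * (2 * L * SPC.rho L α γ ^ ((t : ℝ) / 2) * ‖w₀‖ +
            ∑ t' ∈ Finset.range (T + 1), SPC.rho L α γ ^ (|(t : ℝ) - (t' : ℝ)| / 2) *
              SPC.rms (SPC.condHist P ξ (SPC.root s₀)) (fun ω => M.p (ξ t' ω)))) ∧
      -- exponential input-to-state stability in expectation
      (∀ D : ℝ, (∀ t' ≤ T,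
          SPC.rms (SPC.condHist P ξ (SPC.root s₀)) (fun ω => M.p (ξ t' ω)) ≤ D) →
        ∀ t ≤ T,
          SPC.rms (SPC.condHist P ξ (SPC.root s₀))
              (fun ω => SPC.policy M P ξ T W w₀ t (SPC.hist ξ t ω)) ≤
            SPC.c₂ L α γ * (2 * L * SPC.rho L α γ ^ ((t : ℝ) / 2) * ‖w₀‖ +
              2 / (1 - SPC.rho L α γ ^ (1 / 2 : ℝ)) * D)) := by
  obtain ⟨G, hG, h⟩ := hreg.exists_regularOn
  obtain ⟨n, p, pt, sc⟩ := SPC.exists_scenarios hξ hfin hs₀ hG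
  have hprob : IsProbabilityMeasure (SPC.condHist P ξ (SPC.root s₀)) :=
    ProbabilityTheory.cond_isProbabilityMeasure hs₀
  refine ⟨fun τ hτ h₀ hh w' => sc.hasUniqueSolution h hτ hh w', fun w₀ =>
    ⟨fun t ht => sc.policy_bound h hW w₀ ht, fun D hD t ht => ?_⟩⟩
  obtain ⟨hρ0, hρ1, -, -⟩ := SPC.rho_bounds h.one_le_L h.α_pos h.α_lt_one h.γ_pos h.γ_le_one
  -- Nonnegativity of `D` follows from its bound at time `0`; it is needed to replace the kernel sum
  -- by `2 / (1 - √ρ)`.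
  have hD0 : 0 ≤ D := (SPC.rms_nonneg _ _).trans (hD 0 (Nat.zero_le T))
  have hσ0 : 0 ≤ √(SPC.rho L α γ) := Real.sqrt_nonneg _
  have hσ1 : √(SPC.rho L α γ) < 1 := by
    nlinarith [Real.sq_sqrt hρ0.le]
  have hc : 0 ≤ SPC.c₂ L α γ := by
    refine le_trans ?_ (SPC.gain_le_c₂ h.one_le_L h.α_pos h.α_lt_one h.γ_pos h.γ_le_one)
    have := SPC.Chain.gain_nonneg (α := α) h.γ_pos h.one_le_L
    have : 0 ≤ 1 - √(SPC.rho L α γ) := by linarith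
    positivity
  refine (sc.policy_bound h hW w₀ ht).trans (mul_le_mul_of_nonneg_left ?_ hc)
  refine add_le_add le_rfl ?_
  rw [← Real.sqrt_eq_rpow]
  refine le_trans ?_ (mul_le_mul_of_nonneg_right (SPC.sum_pow_dist_le hσ0 hσ1 t (T + 1)) hD0)
  rw [Finset.sum_mul]
  refine Finset.sum_le_sum fun s hs => ?_
  rw [SPC.rpow_abs_sub_half_eq hρ0.le, Nat.dist_comm]
  exact mul_le_mul_of_nonneg_left (hD s (by have := Finset.mem_range.mp hs; omega))
    (pow_nonneg hσ0 _)
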